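/- Let $G$ be a locally compact Hausdorff group with unit $e$, with left Haar measure $dr$ and modular function $\Delta$, normalized by $\int_G f(rt)\,dr=\Delta(t)^{-1}\int_G f(r)\,dr$ for $f\in C_c(G)$. Let $\mathcal A=(A_t)_{t\in G}$ be a Fell bundle ($C^*$-algebraic bundle) over $G$. **Kernels.** Let $k_c(\mathcal A)$ be the space of compactly supported continuous maps $k:G\times G\to\mathcal A$ with $k(r,s)\in A_{rs^{-1}}$. It is a normed $*$-algebra with $(k_1k_2)(r,s)=\int_G k_1(r,u)k_2(u,s)\,du$, $k^*(r,s)=k(s,r)^*$ and $\|k\|_2=\bigl(\int_G\int_G\|k(r,s)\|^2\,ds\,dr\bigr)^{1/2}$. Let $HS(\mathcal A)$ be the Banach $*$-algebra which is its completion, and let $\mathbb k(\mathcal A)=C^*(HS(\mathcal A))$ be the enveloping $C^*$-algebra. For $t\in G$ let $\beta_t:\mathbb k(\mathcal A)\to\mathbb k(\mathcal A)$ be the $*$-homomorphism which extends $\beta_t(k)(r,s)=\Delta(t)\,k(rt,st)$, $k\in k_c(\mathcal A)$. **Modules.** For $t\in G$ let $C_c^t(\mathcal A)$ be the space of compactly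 supported continuous maps $\xi:G\to\mathcal A$ with $\xi(r)\in A_{rt}$, and let $L^2_t(\mathcal A)$ be the right Hilbert $A_e$-module obtained by completing it for $(\xi a)(r)=\xi(r)a$ and $\langle\xi,\eta\rangle=\int_G\xi(r)^*\eta(r)\,dr$. Put $L^2(\mathcal A)=L^2_e(\mathcal A)$. Let $I_t(\mathcal A)=\mathcal K(L^2_t(\mathcal A))$ be the $C^*$-algebra of compact operators, that is, the closed linear span of the operators $\theta_{x,y}:z\mapsto x\langle y,z\rangle$, and put $I(\mathcal A)=I_e(\mathcal A)$. **Statement.** 1. For every $t\in G$ there is exactly one $*$-homomorphism $\iota_t:I_t(\mathcal A)\to\mathbb k(\mathcal A)$ such that, for all $\xi,\eta\in C_c^t(\mathcal A)$, $\iota_t(\theta_{\xi,\eta})$ is the class of the kernel $(r,s)\mapsto\xi(r)\eta(s)^*$; and $\iota_t$ is isometric. Through $\iota_t$ the algebra $I_t(\mathcal A)$ is regarded as a $C^*$-subalgebra of $\mathbb k(\mathcal A)$. 2. For every $t\in G$, with these identifications, $I_t(\mathcal A)=\beta_t(I(\mathcal A))$; that is, $\iota_t(I_t(\mathcal A))=\beta_t(\iota_e(I(\mathcal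 A)))$. 3. For every $t\in G$, the map $\rho_t(\xi)(r)=\Delta(t)^{1/2}\xi(rt)$, $\xi\in C_c^e(\mathcal A)$, extends to a unitary operator (an $A_e$-linear surjective isometry which preserves the inner products) $\rho_t:L^2(\mathcal A)\to L^2_t(\mathcal A)$; the map $T\mapsto\rho_tT\rho_t^*$ is a $*$-isomorphism $\rho_t^l:I(\mathcal A)\to I_t(\mathcal A)$; and $\beta_t(\iota_e(T))=\iota_t(\rho_t^l(T))$ for all $T\in I(\mathcal A)$. -/

import Mathlib

open MeasureTheory Filter Topology
open scoped ENNReal NNReal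

universe u v

noncomputable section

set_option linter.unusedSectionVars false

/-! ### Hilbert modules -/

section HilbertModule

/-- A right module with an inner product over a `C*`-algebra `A`; the inner product is
conjugate-linear in the first and linear in the second variable. -/
structure InnerCore (A E : Type*) [NonUnitalCStarAlgebra A] [AddCommGroup E] [Module ℂ E] where
  /-- the right action `(ξ, a) ↦ ξ a` -/
  rsmul : E →ₗ[ℂ] A →ₗ[ℂ] E
  /-- the `A`-valued inner product -/
  inner : E →ₗ⋆[ℂ] E →ₗ[ℂ] A
  rsmul_rsmul (x : E) (a b : A) : rsmul (rsmul x a) b = rsmul x (a * b)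
  inner_rsmul (x y : E) (a : A) : inner x (rsmul y a) = inner x y * a
  star_inner (x y : E) : star (inner x y) = inner y x
  /-- `⟪x, x⟫` is a positive element of `A` -/
  inner_self_pos (x : E) : ∃ c : A, inner x x = star c * c

namespace InnerCore

variable {A E : Type*} [NonUnitalCStarAlgebra A] [AddCommGroup E] [Module ℂ E]
  (C : InnerCore A E)

lemma inner_rsmul_left (x y : E) (a : A) : C.inner (C.rsmul x a) y = star a * C.inner x y := by
  rw [← C.star_inner, C.inner_rsmul, star_mul, C.star_inner]

/-- The (semi)norm `‖x‖ = ‖⟪x, x⟫‖ ^ (1 / 2)`. -/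
def nrm (x : E) : ℝ := √‖C.inner x x‖

lemma nrm_sq (x : E) : C.nrm x ^ 2 = ‖C.inner x x‖ := Real.sq_sqrt (norm_nonneg _)

lemma norm_inner_le (x y : E) : ‖C.inner x y‖ ≤ C.nrm x * C.nrm y := by
  let _ := CStarAlgebra.spectralOrder A
  let _ := CStarAlgebra.spectralOrderedRing A
  have hpos : ∀ z, 0 ≤ C.inner z z := fun z => by
    obtain ⟨c, hc⟩ := C.inner_self_pos z
    rw [hc]; exact star_mul_self_nonneg c
  have key : ∀ s : ℝ, 0 ≤ s → ‖C.inner x x‖ ≤ s →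
      ‖C.inner x y‖ ^ 2 * s ≤ s ^ 2 * ‖C.inner y y‖ := by
    intro s hs hxs
    set b := C.inner x y with hb
    have h0 := hpos (C.rsmul x b - (s : ℂ) • y)
    have e : C.inner (C.rsmul x b - (s : ℂ) • y) (C.rsmul x b - (s : ℂ) • y) =
        star b * C.inner x x * b - s • (star b * b) - s • (star b * b)
          + (s ^ 2) • C.inner y y := by
      have hyx : C.inner y x = star b := by rw [hb, C.star_inner]
      simp only [map_sub, LinearMap.sub_apply, C.inner_rsmul, C.inner_rsmul_left, map_smul,
        LinearMap.map_smulₛₗ, LinearMap.smul_apply, hyx, ← hb, Complex.conj_ofReal]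
      simp only [Complex.coe_smul, smul_sub, smul_smul, mul_assoc, pow_two]
      abel
    have hle : star b * C.inner x x * b ≤ s • (star b * b) := by
      refine (CStarAlgebra.star_left_conjugate_le_norm_smul (hb := ?_)).trans ?_
      · exact (C.star_inner x x)
      · exact smul_le_smul_of_nonneg_right hxs (star_mul_self_nonneg b)
    have h1 : s • (star b * b) ≤ (s ^ 2) • C.inner y y := by
      rw [e] at h0
      have h2 : 0 ≤ (s ^ 2) • C.inner y y - s • (star b * b) := by
        refine h0.trans ?_
        rw [← sub_nonneg] at hle ⊢
        convert hle using 1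
        abel
      exact sub_nonneg.1 h2
    have h3 := CStarAlgebra.norm_le_norm_of_nonneg_of_le
      (smul_nonneg hs (star_mul_self_nonneg b)) h1
    rw [norm_smul, norm_smul, CStarRing.norm_star_mul_self, Real.norm_of_nonneg hs,
      Real.norm_of_nonneg (sq_nonneg s)] at h3
    nlinarith [h3]
  have key2 : ‖C.inner x y‖ ^ 2 ≤ ‖C.inner x x‖ * ‖C.inner y y‖ := by
    refine le_of_forall_pos_le_add fun ε hε => ?_
    have hd : 0 < ε / (‖C.inner y y‖ + 1) := by positivity
    set s := ‖C.inner x x‖ + ε / (‖C.inner y y‖ + 1) with hsdef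
    have hs : 0 < s := by positivity
    have := key s hs.le (by linarith)
    have h4 : ‖C.inner x y‖ ^ 2 ≤ s * ‖C.inner y y‖ := by
      have : s * ‖C.inner x y‖ ^ 2 ≤ s * (s * ‖C.inner y y‖) := by nlinarith
      exact le_of_mul_le_mul_left this hs
    refine h4.trans ?_
    rw [hsdef, add_mul]
    gcongr
    rw [div_mul_eq_mul_div, div_le_iff₀ (by positivity)]
    nlinarith [norm_nonneg (C.inner y y)]
  rw [nrm, nrm, ← Real.sqrt_mul (norm_nonneg _)]
  exact Real.le_sqrt_of_sq_le key2

/-- The seminormed group structure induced by the inner product. -/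
abbrev toSeminormedAddCommGroup : SeminormedAddCommGroup E :=
  AddGroupSeminorm.toSeminormedAddCommGroup
    { toFun := C.nrm
      map_zero' := by simp [nrm]
      neg' := fun x => by simp [nrm]
      add_le' := fun x y => by
        refine le_of_sq_le_sq ?_ (add_nonneg (Real.sqrt_nonneg _) (Real.sqrt_nonneg _))
        rw [C.nrm_sq]
        have h : C.inner (x + y) (x + y) =
            C.inner x x + C.inner x y + (C.inner y x + C.inner y y) := by
          simp only [map_add, LinearMap.add_apply]; abel
        rw [h]
        have h1 := norm_add_le (C.inner x x + C.inner x y) (C.inner y x + C.inner y y)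
        have h2 := norm_add_le (C.inner x x) (C.inner x y)
        have h3 := norm_add_le (C.inner y x) (C.inner y y)
        have h4 := C.norm_inner_le x y
        have h5 := C.norm_inner_le y x
        nlinarith [C.nrm_sq x, C.nrm_sq y] }

end InnerCore

/-- A right pre-Hilbert module over the `C*`-algebra `A`, with its norm
`‖x‖ = ‖⟪x, x⟫‖ ^ (1 / 2)`. It is a Hilbert module if it is separated and complete. -/
class PreHilbertModule (A E : Type*) [NonUnitalCStarAlgebra A] [SeminormedAddCommGroup E]
    [NormedSpace ℂ E] extends InnerCore A E where
  norm_sq (x : E) : ‖x‖ ^ 2 = ‖inner x x‖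

namespace PreHilbertModule

section Pre

variable (A : Type*) {E : Type*} [NonUnitalCStarAlgebra A] [SeminormedAddCommGroup E]
  [NormedSpace ℂ E] [H : PreHilbertModule A E]

lemma nrm_eq (x : E) : H.nrm x = ‖x‖ := by
  rw [InnerCore.nrm, ← H.norm_sq, Real.sqrt_sq (norm_nonneg _)]

/-- The inner product as a bounded sesquilinear map. -/
def innerL : E →L⋆[ℂ] E →L[ℂ] A :=
  LinearMap.mkContinuous₂ H.inner 1 fun x y => by
    rw [one_mul, ← nrm_eq A x, ← nrm_eq A y]; exact H.norm_inner_le x y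

/-- The right action as a bounded bilinear map. -/
def rsmulL : E →L[ℂ] A →L[ℂ] E :=
  LinearMap.mkContinuous₂ H.rsmul 1 fun x a => by
    refine le_of_sq_le_sq ?_ (by positivity)
    rw [H.norm_sq, H.inner_rsmul, H.inner_rsmul_left, one_mul, mul_pow, H.norm_sq]
    calc ‖star a * H.inner x x * a‖ ≤ ‖star a‖ * ‖H.inner x x‖ * ‖a‖ :=
          (norm_mul_le _ _).trans (mul_le_mul_of_nonneg_right (norm_mul_le _ _) (norm_nonneg _))
      _ = _ := by rw [norm_star]; ring

variable {A}

lemma star_innerL (x y : E) : star (innerL A x y) = innerL A y x := H.star_inner x y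
lemma innerL_rsmulL (x y : E) (a : A) : innerL A x (rsmulL A y a) = innerL A x y * a :=
  H.inner_rsmul x y a
lemma innerL_rsmulL_left (x y : E) (a : A) :
    innerL A (rsmulL A x a) y = star a * innerL A x y :=
  H.inner_rsmul_left x y a
lemma norm_sq_eq (x : E) : ‖x‖ ^ 2 = ‖innerL A x x‖ := H.norm_sq x
lemma rsmulL_rsmulL (x : E) (a b : A) : rsmulL A (rsmulL A x a) b = rsmulL A x (a * b) :=
  H.rsmul_rsmul x a b
lemma norm_innerL_le (x y : E) : ‖innerL A x y‖ ≤ ‖x‖ * ‖y‖ := by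
  rw [← nrm_eq A x, ← nrm_eq A y]; exact H.norm_inner_le x y

end Pre

/-! #### Completion -/

section Completion

open UniformSpace

variable (A E : Type*) [NonUnitalCStarAlgebra A] [SeminormedAddCommGroup E]
  [NormedSpace ℂ E] [H : PreHilbertModule A E]

/-- Continuous extension of the right action to the completion. -/
def rsmulCompl : Completion E →L[ℂ] A →L[ℂ] Completion E :=
  ((ContinuousLinearMap.compL ℂ A E (Completion E) Completion.toComplL).comp
    (rsmulL A (E := E))).extend (Completion.toComplL (𝕜 := ℂ) (E := E))

/-- Continuous extension of the inner product to the completion. -/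
def innerCompl : Completion E →L⋆[ℂ] Completion E →L[ℂ] A :=
  (((innerL A (E := E)).extend (Completion.toComplL (𝕜 := ℂ) (E := E))).flip.extend
    (Completion.toComplL (𝕜 := ℂ) (E := E))).flip

lemma isUI : IsUniformInducing (Completion.toComplL (𝕜 := ℂ) (E := E)) :=
  Completion.isUniformInducing_coe E

lemma dR : DenseRange (Completion.toComplL (𝕜 := ℂ) (E := E)) :=
  Completion.denseRange_coe

variable {E}

lemma rsmulCompl_coe (x : E) (a : A) : rsmulCompl A E x a = (rsmulL A x a : E) := by
  have := ContinuousLinearMap.extend_eq ((ContinuousLinearMap.compL ℂ A E (Completion E)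
    Completion.toComplL).comp (rsmulL A (E := E))) (dR E) (isUI E) x
  exact congrArg (fun f => f a) this

lemma innerCompl_coe (x y : E) : innerCompl A E x y = innerL A x y := by
  have h1 := ContinuousLinearMap.extend_eq (((innerL A (E := E)).extend
    (Completion.toComplL (𝕜 := ℂ) (E := E))).flip) (dR E) (isUI E) y
  have h2 := ContinuousLinearMap.extend_eq (innerL A (E := E)) (dR E) (isUI E) x
  have h3 := congrArg (fun f => f (x : Completion E)) h1
  exact h3.trans (congrArg (fun f => f y) h2)

instance completion : PreHilbertModule A (Completion E) where
  rsmul := ContinuousLinearMap.toLinearMap₁₂ (rsmulCompl A E)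
  inner := ContinuousLinearMap.toLinearMap₁₂ (innerCompl A E)
  rsmul_rsmul x a b := by
    change rsmulCompl A E (rsmulCompl A E x a) b = rsmulCompl A E x (a * b)
    induction x using Completion.induction_on with
    | hp => exact isClosed_eq (by fun_prop) (by fun_prop)
    | ih x => simp only [rsmulCompl_coe, rsmulL_rsmulL]
  inner_rsmul x y a := by
    change innerCompl A E x (rsmulCompl A E y a) = innerCompl A E x y * a
    induction x, y using Completion.induction_on₂ with
    | hp => exact isClosed_eq (by fun_prop) (by fun_prop)
    | ih x y => simp only [rsmulCompl_coe, innerCompl_coe, innerL_rsmulL]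
  star_inner x y := by
    change star (innerCompl A E x y) = innerCompl A E y x
    induction x, y using Completion.induction_on₂ with
    | hp => exact isClosed_eq (by fun_prop) (by fun_prop)
    | ih x y => simp only [innerCompl_coe, star_innerL]
  inner_self_pos x := by
    let _ := CStarAlgebra.spectralOrder A
    let _ := CStarAlgebra.spectralOrderedRing A
    change ∃ c, innerCompl A E x x = star c * c
    rw [← CStarAlgebra.nonneg_iff_eq_star_mul_self]
    induction x using Completion.induction_on with
    | hp => exact isClosed_le (by fun_prop) (by fun_prop)
    | ih x =>
      obtain ⟨c, hc⟩ := H.inner_self_pos x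
      rw [innerCompl_coe]
      exact hc ▸ star_mul_self_nonneg c
  norm_sq x := by
    change ‖x‖ ^ 2 = ‖innerCompl A E x x‖
    induction x using Completion.induction_on with
    | hp => exact isClosed_eq (by fun_prop) (by fun_prop)
    | ih x => rw [innerCompl_coe, Completion.norm_coe]; exact H.norm_sq x

end Completion

/-! #### Adjointable and compact operators -/

section Operators

variable (A E : Type*) [NonUnitalCStarAlgebra A] [NormedAddCommGroup E]
  [NormedSpace ℂ E] [H : PreHilbertModule A E]

/-- The algebra of adjointable operators on a Hilbert module, as a subalgebra of the algebra of
all bounded operators. -/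
def adjointableSubalgebra : Subalgebra ℂ (E →L[ℂ] E) where
  carrier := {T | ∃ S : E →L[ℂ] E, ∀ x y, innerL A (T x) y = innerL A x (S y)}
  mul_mem' := by
    rintro T T' ⟨S, hS⟩ ⟨S', hS'⟩
    exact ⟨S' * S, fun x y => by simp [hS, hS']⟩
  add_mem' := by
    rintro T T' ⟨S, hS⟩ ⟨S', hS'⟩
    exact ⟨S + S', fun x y => by simp [hS, hS']⟩
  algebraMap_mem' c := ⟨algebraMap ℂ _ (star c), fun x y => by
    simp [Algebra.algebraMap_eq_smul_one]⟩

/-- The algebra `ℒ(E)` of adjointable operators on a Hilbert module `E`, with the operator norm. -/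
def Adjointable : Type _ := adjointableSubalgebra A E

variable {A E}

namespace Adjointable

instance : NormedRing (Adjointable A E) :=
  inferInstanceAs (NormedRing (adjointableSubalgebra A E))
instance : NormedAlgebra ℂ (Adjointable A E) :=
  inferInstanceAs (NormedAlgebra ℂ (adjointableSubalgebra A E))

/-- The underlying bounded operator. -/
def op (T : Adjointable A E) : E →L[ℂ] E := T.1

lemma ext_op {T S : Adjointable A E} (h : ∀ x, T.op x = S.op x) : T = S :=
  Subtype.ext (ContinuousLinearMap.ext h)

lemma norm_op (T : Adjointable A E) : ‖T.op‖ = ‖T‖ := rfl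
lemma dist_op (T S : Adjointable A E) : dist T.op S.op = dist T S := rfl

end Adjointable

lemma ext_inner {x y : E} (h : ∀ z, innerL A z x = innerL A z y) : x = y := by
  have : ‖x - y‖ ^ 2 = 0 := by
    rw [norm_sq_eq (A := A), map_sub, h, sub_self, norm_zero]
  simpa [sub_eq_zero] using this

/-- The adjoint of an adjointable operator. -/
instance : Star (Adjointable A E) where
  star T := ⟨T.2.choose, T.1, fun x y => by
    have h := T.2.choose_spec y x
    rw [← star_innerL, ← h, star_innerL]⟩

lemma inner_star (T : Adjointable A E) (x y : E) :
    innerL A (T.op x) y = innerL A x ((star T).op y) := T.2.choose_spec x y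

lemma star_eq_of_inner {T S : Adjointable A E}
    (h : ∀ x y, innerL A (T.op x) y = innerL A x (S.op y)) : star T = S :=
  Adjointable.ext_op fun y => ext_inner (A := A) fun x => by rw [← inner_star, h]

instance : StarRing (Adjointable A E) where
  star_involutive T := star_eq_of_inner fun x y => by
    rw [← star_innerL, ← inner_star, star_innerL]
  star_mul T S := star_eq_of_inner fun x y => by
    change innerL A (T.op (S.op x)) y = innerL A x ((star S).op ((star T).op y))
    rw [inner_star, inner_star]
  star_add T S := star_eq_of_inner fun x y => by
    change innerL A (T.op x + S.op x) y = innerL A x ((star T).op y + (star S).op y)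
    rw [map_add, map_add, add_apply, inner_star, inner_star]

instance : StarModule ℂ (Adjointable A E) where
  star_smul c T := star_eq_of_inner fun x y => by
    change innerL A (c • T.op x) y = innerL A x (star c • (star T).op y)
    simp [inner_star]

instance : CStarRing (Adjointable A E) where
  norm_mul_self_le T := by
    have h : ∀ x, ‖T.op x‖ ≤ √‖star T * T‖ * ‖x‖ := fun x => by
      refine le_of_sq_le_sq ?_ (by positivity)
      rw [mul_pow, Real.sq_sqrt (norm_nonneg _), norm_sq_eq (A := A), inner_star]
      refine (norm_innerL_le _ _).trans ?_
      have h1 : ‖(star T).op (T.op x)‖ ≤ ‖star T * T‖ * ‖x‖ := (star T * T).op.le_opNorm x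
      nlinarith [norm_nonneg x]
    have h2 := ContinuousLinearMap.opNorm_le_bound T.op (Real.sqrt_nonneg _) h
    rw [Adjointable.norm_op] at h2
    calc ‖T‖ * ‖T‖ ≤ √‖star T * T‖ * √‖star T * T‖ :=
          mul_le_mul h2 h2 (norm_nonneg _) (Real.sqrt_nonneg _)
      _ = ‖star T * T‖ := Real.mul_self_sqrt (norm_nonneg _)

instance [CompleteSpace E] : CompleteSpace (Adjointable A E) := by
  refine Metric.complete_of_cauchySeq_tendsto fun T hT => ?_
  have h1 : CauchySeq fun n => (T n).op := by
    rw [Metric.cauchySeq_iff] at hT ⊢; exact hT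
  have h2 : CauchySeq fun n => (star (T n)).op := by
    have e : ∀ m n, dist (star (T m)).op (star (T n)).op = dist (T m) (T n) := fun m n => by
      rw [Adjointable.dist_op, dist_eq_norm, dist_eq_norm, ← star_sub, norm_star]
    rw [Metric.cauchySeq_iff] at hT ⊢
    simpa only [e] using hT
  obtain ⟨U, hU⟩ := cauchySeq_tendsto_of_complete h1
  obtain ⟨V, hV⟩ := cauchySeq_tendsto_of_complete h2
  have hUV : ∀ x y, innerL A (U x) y = innerL A x (V y) := fun x y => by
    have ha : Tendsto (fun n => innerL A ((T n).op x) y) atTop (𝓝 (innerL A (U x) y)) :=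
      ((((innerL A (E := E)).flip y).continuous.comp
        (ContinuousLinearMap.apply ℂ E x).continuous).tendsto U).comp hU
    have hb : Tendsto (fun n => innerL A x ((star (T n)).op y)) atTop (𝓝 (innerL A x (V y))) :=
      (((innerL A x).continuous.comp
        (ContinuousLinearMap.apply ℂ E y).continuous).tendsto V).comp hV
    refine tendsto_nhds_unique ha (hb.congr fun n => ?_)
    rw [inner_star]
  have h3 := tendsto_iff_dist_tendsto_zero.1 hU
  refine ⟨⟨U, V, hUV⟩, tendsto_iff_dist_tendsto_zero.2 ?_⟩
  exact h3

/-- The adjointable operators on a Hilbert module form a `C*`-algebra. -/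
instance [CompleteSpace E] : CStarAlgebra (Adjointable A E) where

/-- The rank-one operator `θ_{x, y} : z ↦ x ⟪y, z⟫`. -/
def theta (x y : E) : Adjointable A E :=
  ⟨(rsmulL A x).comp (innerL A y), (rsmulL A y).comp (innerL A x), fun z w => by
    simp [innerL_rsmulL, innerL_rsmulL_left, star_innerL]⟩

lemma theta_op (x y z : E) : (theta (A := A) x y).op z = rsmulL A x (innerL A y z) := rfl

lemma star_theta (x y : E) : star (theta (A := A) x y) = theta y x :=
  star_eq_of_inner fun z w => by
    simp [theta_op, innerL_rsmulL, innerL_rsmulL_left, star_innerL]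

lemma mul_theta (T : Adjointable A E) (x y : E) : T * theta x y = theta (T.op x) y := by
  have hT : ∀ a : A, T.op (rsmulL A x a) = rsmulL A (T.op x) a := fun a =>
    ext_inner (A := A) fun z => by
      have h := inner_star (star T)
      rw [star_star] at h
      rw [← h, innerL_rsmulL, innerL_rsmulL, h]
  exact Adjointable.ext_op fun z => hT _

variable (A E) [CompleteSpace E]

/-- The `*`-algebra of finite-rank operators: the linear span of the rank-one operators. -/
def finiteRank : NonUnitalStarSubalgebra ℂ (Adjointable A E) where
  __ := Submodule.span ℂ (Set.range fun p : E × E => theta (A := A) p.1 p.2)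
  mul_mem' := by
    intro T S _ hS
    induction hS using Submodule.span_induction with
    | mem S hS =>
      obtain ⟨p, rfl⟩ := hS
      rw [mul_theta]
      exact Submodule.subset_span ⟨(T.op p.1, p.2), rfl⟩
    | zero => rw [mul_zero]; exact Submodule.zero_mem _
    | add x y _ _ hx hy => rw [mul_add]; exact Submodule.add_mem _ hx hy
    | smul c x _ hx => rw [mul_smul_comm]; exact Submodule.smul_mem _ _ hx
  star_mem' := by
    intro S hS
    induction hS using Submodule.span_induction with
    | mem S hS =>
      obtain ⟨p, rfl⟩ := hS
      rw [star_theta]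
      exact Submodule.subset_span ⟨(p.2, p.1), rfl⟩
    | zero => rw [star_zero]; exact Submodule.zero_mem _
    | add x y _ _ hx hy => rw [star_add]; exact Submodule.add_mem _ hx hy
    | smul c x _ hx => rw [star_smul]; exact Submodule.smul_mem _ _ hx

/-- The compact operators as a `C*`-subalgebra of the adjointable operators: the norm closure of the
linear span of the rank-one operators. -/
def compacts : NonUnitalStarSubalgebra ℂ (Adjointable A E) := (finiteRank A E).topologicalClosure

instance : IsClosed (compacts A E : Set (Adjointable A E)) :=
  NonUnitalStarSubalgebra.isClosed_topologicalClosure _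

/-- The `C*`-algebra `𝒦(E)` of compact operators on a Hilbert module. -/
def CompactOp : Type _ := compacts A E

instance : NonUnitalCStarAlgebra (CompactOp A E) :=
  inferInstanceAs (NonUnitalCStarAlgebra (compacts A E))

variable {A E}

/-- The underlying bounded operator of a compact operator. -/
def CompactOp.op (T : CompactOp A E) : E →L[ℂ] E := Adjointable.op T.1

variable (A) in
/-- The rank-one operator `θ_{x, y} : z ↦ x ⟪y, z⟫` as an element of `𝒦(E)`. -/
def thetaK (x y : E) : CompactOp A E :=
  ⟨theta x y, subset_closure (Submodule.subset_span ⟨(x, y), rfl⟩)⟩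

lemma thetaK_op (x y z : E) : (thetaK A x y).op z = rsmulL A x (innerL A y z) := rfl

end Operators

end PreHilbertModule

end HilbertModule

/-! ### Completion of a normed `*`-algebra -/

section StarCompletion

open UniformSpace

/-- The completion of a normed `*`-algebra, as a Banach `*`-algebra. -/
def StarCompletion (B : Type*) [SeminormedAddCommGroup B] : Type _ := Completion B

namespace StarCompletion

section Group
variable {B : Type*} [SeminormedAddCommGroup B] [NormedSpace ℂ B]

instance : NormedAddCommGroup (StarCompletion B) := inferInstanceAs (NormedAddCommGroup (Completion B))
instance : NormedSpace ℂ (StarCompletion B) := inferInstanceAs (NormedSpace ℂ (Completion B))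
instance : CompleteSpace (StarCompletion B) := inferInstanceAs (CompleteSpace (Completion B))

/-- The canonical map of a normed `*`-algebra into its completion. -/
def of : B →L[ℂ] StarCompletion B := Completion.toComplL

lemma isUniformInducing_of : IsUniformInducing (of (B := B)) := Completion.isUniformInducing_coe B
lemma denseRange_of : DenseRange (of (B := B)) := Completion.denseRange_coe
lemma norm_of (b : B) : ‖of b‖ = ‖b‖ := Completion.norm_coe b

end Group

variable {B : Type*} [NonUnitalSeminormedRing B] [NormedSpace ℂ B] [IsScalarTower ℂ B B]
  [SMulCommClass ℂ B B]

/-- Continuous extension of the product to the completion. -/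
def mulCompl : StarCompletion B →L[ℂ] StarCompletion B →L[ℂ] StarCompletion B :=
  ((((ContinuousLinearMap.compL ℂ B B (StarCompletion B) of).comp
    (ContinuousLinearMap.mul ℂ B)).extend (of (B := B))).flip.extend (of (B := B))).flip

lemma mulCompl_of (x y : B) : mulCompl (of x) (of y) = of (x * y) := by
  set f := (ContinuousLinearMap.compL ℂ B B (StarCompletion B) of).comp
    (ContinuousLinearMap.mul ℂ B)
  have h1 := ContinuousLinearMap.extend_eq ((f.extend (of (B := B))).flip) denseRange_of
    isUniformInducing_of y
  have h2 := ContinuousLinearMap.extend_eq f denseRange_of isUniformInducing_of x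
  exact (congrArg (fun g => g (of x)) h1).trans (congrArg (fun g => g y) h2)

instance : Mul (StarCompletion B) := ⟨fun x y => mulCompl x y⟩

lemma mul_def (x y : StarCompletion B) : x * y = mulCompl x y := rfl
lemma of_mul (x y : B) : of (x * y) = of x * of y := (mulCompl_of x y).symm

instance : NonUnitalNormedRing (StarCompletion B) where
  __ := (inferInstance : NormedAddCommGroup (StarCompletion B))
  left_distrib x y z := by simp only [mul_def, map_add]
  right_distrib x y z := by simp only [mul_def, map_add, add_apply]
  zero_mul x := by simp only [mul_def, map_zero, zero_apply]
  mul_zero x := by simp only [mul_def, map_zero]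
  mul_assoc x y z := by
    refine denseRange_of.induction_on₃ (p := fun x y z : StarCompletion B => x * y * z = x * (y * z))
      ?_ (fun x y z => by simp only [← of_mul, mul_assoc]) x y z
    simp only [mul_def]
    exact isClosed_eq (by fun_prop) (by fun_prop)
  norm_mul_le x y := by
    refine denseRange_of.induction_on₂ (p := fun x y : StarCompletion B => ‖x * y‖ ≤ ‖x‖ * ‖y‖)
      ?_ (fun x y => by simp only [← of_mul, norm_of]; exact norm_mul_le x y) x y
    simp only [mul_def]
    exact isClosed_le (by fun_prop) (by fun_prop)

instance : IsScalarTower ℂ (StarCompletion B) (StarCompletion B) where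
  smul_assoc c x y := by simp only [smul_eq_mul, mul_def, map_smul, smul_apply]

instance : SMulCommClass ℂ (StarCompletion B) (StarCompletion B) where
  smul_comm c x y := by simp only [smul_eq_mul, mul_def, map_smul]

variable [StarRing B] [StarModule ℂ B] [NormedStarGroup B]

/-- Continuous extension of the involution to the completion. -/
def starCompl : StarCompletion B →L⋆[ℂ] StarCompletion B :=
  ((of (B := B)).comp ((starₗᵢ ℂ : B ≃ₗᵢ⋆[ℂ] B).toContinuousLinearEquiv : B →L⋆[ℂ] B)).extend
    (of (B := B))

lemma starCompl_of (x : B) : starCompl (of x) = of (star x) :=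
  ContinuousLinearMap.extend_eq ((of (B := B)).comp
    ((starₗᵢ ℂ : B ≃ₗᵢ⋆[ℂ] B).toContinuousLinearEquiv : B →L⋆[ℂ] B)) denseRange_of
    isUniformInducing_of x

instance : Star (StarCompletion B) := ⟨fun x => starCompl x⟩

lemma star_def (x : StarCompletion B) : star x = starCompl x := rfl
lemma of_star (x : B) : of (star x) = star (of x) := (starCompl_of x).symm

instance : StarRing (StarCompletion B) where
  star_involutive x := by
    refine denseRange_of.induction_on (p := fun x : StarCompletion B => star (star x) = x) x
      ?_ (fun x => by simp only [← of_star, star_star])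
    simp only [star_def]
    exact isClosed_eq (by fun_prop) (by fun_prop)
  star_mul x y := by
    refine denseRange_of.induction_on₂
      (p := fun x y : StarCompletion B => star (x * y) = star y * star x)
      ?_ (fun x y => by simp only [← of_star, ← of_mul, star_mul]) x y
    simp only [star_def, mul_def]
    exact isClosed_eq (by fun_prop) (by fun_prop)
  star_add x y := by simp only [star_def, map_add]

instance : StarModule ℂ (StarCompletion B) where
  star_smul c x := by simp only [star_def, map_smulₛₗ]; rfl

/-- Extension to the completions of a contractive `*`-homomorphism. -/
def map {B' : Type*} [NonUnitalSeminormedRing B'] [NormedSpace ℂ B'] [IsScalarTower ℂ B' B']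
    [SMulCommClass ℂ B' B'] [StarRing B'] [StarModule ℂ B'] [NormedStarGroup B']
    (φ : B →⋆ₙₐ[ℂ] B') (hφ : ∀ b, ‖φ b‖ ≤ ‖b‖) : StarCompletion B →⋆ₙₐ[ℂ] StarCompletion B' :=
  let f : B →L[ℂ] StarCompletion B' := (of (B := B')).comp
    (LinearMap.mkContinuous (φ : B →ₗ[ℂ] B') 1 fun b => by rw [one_mul]; exact hφ b)
  have hf : ∀ b, f.extend (of (B := B)) (of b) = of (φ b) := fun b =>
    ContinuousLinearMap.extend_eq f denseRange_of isUniformInducing_of b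
  { toFun := f.extend (of (B := B))
    map_smul' := fun c x => map_smul _ c x
    map_zero' := map_zero _
    map_add' := map_add _
    map_mul' := fun x y => by
      refine denseRange_of.induction_on₂ (p := fun x y : StarCompletion B =>
        f.extend (of (B := B)) (x * y) = f.extend (of (B := B)) x * f.extend (of (B := B)) y)
        ?_ (fun x y => by simp only [← of_mul, hf, map_mul]) x y
      simp only [mul_def]
      exact isClosed_eq (by fun_prop) (by fun_prop)
    map_star' := fun x => by
      refine denseRange_of.induction_on (p := fun x : StarCompletion B =>
        f.extend (of (B := B)) (star x) = star (f.extend (of (B := B)) x)) x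
        ?_ (fun x => by simp only [← of_star, hf, map_star])
      simp only [star_def]
      exact isClosed_eq (by fun_prop) (by fun_prop) }

lemma map_of {B' : Type*} [NonUnitalSeminormedRing B'] [NormedSpace ℂ B'] [IsScalarTower ℂ B' B']
    [SMulCommClass ℂ B' B'] [StarRing B'] [StarModule ℂ B'] [NormedStarGroup B']
    (φ : B →⋆ₙₐ[ℂ] B') (hφ : ∀ b, ‖φ b‖ ≤ ‖b‖) (b : B) : map φ hφ (of b) = of (φ b) :=
  ContinuousLinearMap.extend_eq ((of (B := B')).comp
    (LinearMap.mkContinuous (φ : B →ₗ[ℂ] B') 1 fun b => by rw [one_mul]; exact hφ b))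
    denseRange_of isUniformInducing_of b

lemma norm_map_le {B' : Type*} [NonUnitalSeminormedRing B'] [NormedSpace ℂ B']
    [IsScalarTower ℂ B' B'] [SMulCommClass ℂ B' B'] [StarRing B'] [StarModule ℂ B']
    [NormedStarGroup B'] (φ : B →⋆ₙₐ[ℂ] B') (hφ : ∀ b, ‖φ b‖ ≤ ‖b‖) (x : StarCompletion B) :
    ‖map φ hφ x‖ ≤ ‖x‖ := by
  have hc : Continuous (map φ hφ) :=
    (((of (B := B')).comp (LinearMap.mkContinuous (φ : B →ₗ[ℂ] B') 1
      fun b => by rw [one_mul]; exact hφ b)).extend (of (B := B))).continuous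
  refine denseRange_of.induction_on (p := fun x : StarCompletion B => ‖map φ hφ x‖ ≤ ‖x‖) x
    (isClosed_le hc.norm continuous_norm) fun b => ?_
  rw [map_of, norm_of, norm_of]
  exact hφ b

end StarCompletion
end StarCompletion

/-! ### The enveloping `C*`-algebra of a Banach `*`-algebra -/

section Envelope

/-- A `*`-representation of the Banach `*`-algebra `B` on a Hilbert space. (A `*`-representation of
a Banach `*`-algebra with isometric involution is automatically contractive.) -/
structure HilbertRep (B : Type u) [NonUnitalNormedRing B] [NormedSpace ℂ B] [StarRing B] where
  /-- the Hilbert space -/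
  H : Type u
  [instNormed : NormedAddCommGroup H]
  [instInner : InnerProductSpace ℂ H]
  [instComplete : CompleteSpace H]
  /-- the action of `B` on `H` -/
  π : B →⋆ₙₐ[ℂ] (H →L[ℂ] H)
  norm_le (b : B) : ‖π b‖ ≤ ‖b‖

attribute [instance] HilbertRep.instNormed HilbertRep.instInner HilbertRep.instComplete

variable (B : Type u) [NonUnitalNormedRing B] [NormedSpace ℂ B] [StarRing B]

/-- The `C*`-algebra of all bounded families of operators on the Hilbert spaces of all
`*`-representations of `B`. -/
def RepProduct : Type (u + 1) := lp (fun ρ : HilbertRep B => ρ.H →L[ℂ] ρ.H) ∞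

instance : NonUnitalCStarAlgebra (RepProduct B) :=
  inferInstanceAs (NonUnitalCStarAlgebra (lp (fun ρ : HilbertRep B => ρ.H →L[ℂ] ρ.H) ∞))

variable {B}

namespace RepProduct

/-- The component at the representation `ρ`. -/
def comp (x : RepProduct B) (ρ : HilbertRep B) : ρ.H →L[ℂ] ρ.H := x.1 ρ

/-- A bounded family of operators. -/
def mk (x : ∀ ρ : HilbertRep B, ρ.H →L[ℂ] ρ.H) (C : ℝ) (hC : ∀ ρ, ‖x ρ‖ ≤ C) : RepProduct B :=
  ⟨x, memℓp_infty ⟨C, by rintro _ ⟨ρ, rfl⟩; exact hC ρ⟩⟩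

lemma ext {x y : RepProduct B} (h : ∀ ρ, x.comp ρ = y.comp ρ) : x = y :=
  Subtype.ext (funext h)

lemma norm_comp_le (x : RepProduct B) (ρ : HilbertRep B) : ‖x.comp ρ‖ ≤ ‖x‖ :=
  lp.norm_apply_le_norm ENNReal.top_ne_zero x ρ

lemma norm_le {x : RepProduct B} {C : ℝ} (hC : 0 ≤ C) (h : ∀ ρ, ‖x.comp ρ‖ ≤ C) : ‖x‖ ≤ C :=
  lp.norm_le_of_forall_le hC h

end RepProduct

variable (B) in
/-- The universal representation: the direct sum of all `*`-representations of `B`. -/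
def universalRep : B →⋆ₙₐ[ℂ] RepProduct B where
  toFun b := RepProduct.mk (fun ρ => ρ.π b) ‖b‖ fun ρ => ρ.norm_le b
  map_smul' c b := RepProduct.ext fun ρ => map_smul ρ.π c b
  map_zero' := RepProduct.ext fun ρ => map_zero ρ.π
  map_add' a b := RepProduct.ext fun ρ => map_add ρ.π a b
  map_mul' a b := RepProduct.ext fun ρ => map_mul ρ.π a b
  map_star' b := RepProduct.ext fun ρ => map_star ρ.π b

variable (B) in
/-- The enveloping `C*`-algebra `C*(B)`, as the norm closure of the image of `B` in its universal
representation. Thus the norm of (the image of) `b` is the supremum of `‖π b‖` over all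
`*`-representations `π` of `B`. -/
def envelopeSubalgebra : NonUnitalStarSubalgebra ℂ (RepProduct B) :=
  (NonUnitalStarAlgHom.range (universalRep B)).topologicalClosure

instance : IsClosed (envelopeSubalgebra B : Set (RepProduct B)) :=
  NonUnitalStarSubalgebra.isClosed_topologicalClosure _

variable (B) in
/-- The enveloping `C*`-algebra `C*(B)` of the Banach `*`-algebra `B`. -/
def Envelope : Type (u + 1) := envelopeSubalgebra B

instance : NonUnitalCStarAlgebra (Envelope B) :=
  inferInstanceAs (NonUnitalCStarAlgebra (envelopeSubalgebra B))

/-- The inclusion of `C*(B)` into the product of all representations. -/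
def Envelope.subtype : Envelope B →⋆ₙₐ[ℂ] RepProduct B :=
  NonUnitalStarSubalgebraClass.subtype (envelopeSubalgebra B)

/-- Restriction of the codomain of a homomorphism to the enveloping `C*`-algebra. -/
def Envelope.codRestrict {C : Type*} [NonUnitalNonAssocSemiring C] [Module ℂ C] [Star C]
    (φ : C →⋆ₙₐ[ℂ] RepProduct B) (h : ∀ c, φ c ∈ envelopeSubalgebra B) : C →⋆ₙₐ[ℂ] Envelope B :=
  NonUnitalStarAlgHom.codRestrict φ (envelopeSubalgebra B) h

/-- The canonical `*`-homomorphism of `B` into its enveloping `C*`-algebra. -/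
def toEnvelope : B →⋆ₙₐ[ℂ] Envelope B :=
  Envelope.codRestrict (universalRep B) fun b => subset_closure ⟨b, rfl⟩

variable {B' : Type u} [NonUnitalNormedRing B'] [NormedSpace ℂ B'] [StarRing B']

/-- The pull-back of a representation along a contractive `*`-homomorphism. -/
def HilbertRep.comp (ρ : HilbertRep B') (φ : B →⋆ₙₐ[ℂ] B') (hφ : ∀ b, ‖φ b‖ ≤ ‖b‖) :
    HilbertRep B where
  H := ρ.H
  π := ρ.π.comp φ
  norm_le b := (ρ.norm_le _).trans (hφ b)

/-- The map on products of representations induced by pulling back representations. -/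
def repProductMap (φ : B →⋆ₙₐ[ℂ] B') (hφ : ∀ b, ‖φ b‖ ≤ ‖b‖) :
    RepProduct B →⋆ₙₐ[ℂ] RepProduct B' where
  toFun x := RepProduct.mk (fun ρ => x.comp (ρ.comp φ hφ)) ‖x‖ fun ρ =>
    x.norm_comp_le (ρ.comp φ hφ)
  map_smul' _ _ := rfl
  map_zero' := rfl
  map_add' _ _ := rfl
  map_mul' _ _ := rfl
  map_star' _ := rfl

lemma continuous_repProductMap (φ : B →⋆ₙₐ[ℂ] B') (hφ : ∀ b, ‖φ b‖ ≤ ‖b‖) :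
    Continuous (repProductMap φ hφ) :=
  AddMonoidHomClass.continuous_of_bound (repProductMap φ hφ) 1 fun x => by
    rw [one_mul]
    exact RepProduct.norm_le (norm_nonneg _) fun ρ => x.norm_comp_le (ρ.comp φ hφ)

/-- Functoriality of the enveloping `C*`-algebra: the continuous extension of `φ`. -/
def envelopeMap (φ : B →⋆ₙₐ[ℂ] B') (hφ : ∀ b, ‖φ b‖ ≤ ‖b‖) : Envelope B →⋆ₙₐ[ℂ] Envelope B' :=
  Envelope.codRestrict ((repProductMap φ hφ).comp Envelope.subtype) fun x => by
    refine map_mem_closure (f := repProductMap φ hφ)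
      (t := (NonUnitalStarAlgHom.range (universalRep B') : Set (RepProduct B')))
      (continuous_repProductMap φ hφ) x.2 ?_
    rintro _ ⟨b, rfl⟩
    exact ⟨φ b, rfl⟩

lemma envelopeMap_toEnvelope (φ : B →⋆ₙₐ[ℂ] B') (hφ : ∀ b, ‖φ b‖ ≤ ‖b‖) (b : B) :
    envelopeMap φ hφ (toEnvelope b) = toEnvelope (φ b) := rfl

end Envelope

/-- The fibre `p ⁻¹ {t}` of a map `p : T → G` over the point `t`. -/
@[ext]
structure BundleFiber {T : Type v} {G : Type u} (p : T → G) (t : G) where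
  val : T
  proj_val : p val = t

/-- A Fell bundle (`C*`-algebraic bundle in the sense of Fell and Doran) over a topological group:
a Banach bundle `proj : Tot → G` together with a continuous associative multiplication and a
continuous involution covering those of `G`, satisfying the `C*`-axioms. -/
structure FellBundle (G : Type u) [Group G] [TopologicalSpace G] where
  /-- the total space of the bundle -/
  Tot : Type v
  [topTot : TopologicalSpace Tot]
  [semigroupTot : Semigroup Tot]
  [starTot : StarMul Tot]
  /-- the bundle projection -/
  proj : Tot → G
  [normedFiber : ∀ t, NormedAddCommGroup (BundleFiber proj t)]
  [normedSpaceFiber : ∀ t, NormedSpace ℂ (BundleFiber proj t)]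
  [completeFiber : ∀ t, CompleteSpace (BundleFiber proj t)]
  continuous_proj : Continuous proj
  isOpenMap_proj : IsOpenMap proj
  continuous_norm_tot : Continuous fun a : Tot => ‖(⟨a, rfl⟩ : BundleFiber proj (proj a))‖
  continuous_add_tot : Continuous fun x : {x : Tot × Tot // proj x.1 = proj x.2} =>
    ((⟨x.1.1, x.2⟩ : BundleFiber proj (proj x.1.2)) + ⟨x.1.2, rfl⟩).val
  continuous_smul_tot (c : ℂ) : Continuous fun a : Tot =>
    (c • (⟨a, rfl⟩ : BundleFiber proj (proj a))).val
  /-- if `proj aᵢ → t` and `‖aᵢ‖ → 0` then `aᵢ → 0` in the fibre over `t` -/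
  nhds_zero (t : G) : comap proj (𝓝 t) ⊓
    comap (fun a : Tot => ‖(⟨a, rfl⟩ : BundleFiber proj (proj a))‖) (𝓝 0) ≤
      𝓝 (0 : BundleFiber proj t).val
  proj_mul (a b : Tot) : proj (a * b) = proj a * proj b
  proj_star (a : Tot) : proj (star a) = (proj a)⁻¹
  continuous_mul_tot : Continuous fun x : Tot × Tot => x.1 * x.2
  continuous_star_tot : Continuous fun a : Tot => star a
  fib_add_mul {r s : G} (a b : BundleFiber proj r) (c : BundleFiber proj s) :
    (⟨(a + b).val * c.val, by rw [proj_mul, (a + b).2, c.2]⟩ : BundleFiber proj (r * s)) =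
      ⟨a.val * c.val, by rw [proj_mul, a.2, c.2]⟩ + ⟨b.val * c.val, by rw [proj_mul, b.2, c.2]⟩
  fib_mul_add {r s : G} (a : BundleFiber proj r) (b c : BundleFiber proj s) :
    (⟨a.val * (b + c).val, by rw [proj_mul, a.2, (b + c).2]⟩ : BundleFiber proj (r * s)) =
      ⟨a.val * b.val, by rw [proj_mul, a.2, b.2]⟩ + ⟨a.val * c.val, by rw [proj_mul, a.2, c.2]⟩
  fib_smul_mul {r s : G} (z : ℂ) (a : BundleFiber proj r) (b : BundleFiber proj s) :
    (⟨(z • a).val * b.val, by rw [proj_mul, (z • a).2, b.2]⟩ : BundleFiber proj (r * s)) =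
      z • ⟨a.val * b.val, by rw [proj_mul, a.2, b.2]⟩
  fib_mul_smul {r s : G} (z : ℂ) (a : BundleFiber proj r) (b : BundleFiber proj s) :
    (⟨a.val * (z • b).val, by rw [proj_mul, a.2, (z • b).2]⟩ : BundleFiber proj (r * s)) =
      z • ⟨a.val * b.val, by rw [proj_mul, a.2, b.2]⟩
  fib_star_add {r : G} (a b : BundleFiber proj r) :
    (⟨star (a + b).val, by rw [proj_star, (a + b).2]⟩ : BundleFiber proj r⁻¹) =
      ⟨star a.val, by rw [proj_star, a.2]⟩ + ⟨star b.val, by rw [proj_star, b.2]⟩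
  fib_star_smul {r : G} (z : ℂ) (a : BundleFiber proj r) :
    (⟨star (z • a).val, by rw [proj_star, (z • a).2]⟩ : BundleFiber proj r⁻¹) =
      star z • ⟨star a.val, by rw [proj_star, a.2]⟩
  fib_norm_mul_le {r s : G} (a : BundleFiber proj r) (b : BundleFiber proj s) :
    ‖(⟨a.val * b.val, by rw [proj_mul, a.2, b.2]⟩ : BundleFiber proj (r * s))‖ ≤ ‖a‖ * ‖b‖
  fib_norm_star {r : G} (a : BundleFiber proj r) :
    ‖(⟨star a.val, by rw [proj_star, a.2]⟩ : BundleFiber proj r⁻¹)‖ = ‖a‖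
  fib_norm_star_mul_self {r : G} (a : BundleFiber proj r) :
    ‖(⟨star a.val * a.val, by rw [proj_mul, proj_star, a.2, inv_mul_cancel]⟩ :
      BundleFiber proj (1 : G))‖ = ‖a‖ ^ 2
  /-- `a* a` is a positive element of the `C*`-algebra which is the fibre over the unit -/
  fib_star_mul_self_pos {r : G} (a : BundleFiber proj r) :
    ∃ c : BundleFiber proj (1 : G), star a.val * a.val = star c.val * c.val

namespace FellBundle

attribute [instance] FellBundle.topTot FellBundle.semigroupTot FellBundle.starTot
  FellBundle.normedFiber FellBundle.normedSpaceFiber FellBundle.completeFiber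

section Basic

variable {G : Type u} [Group G] [TopologicalSpace G] (𝒜 : FellBundle.{u, v} G)

/-- The fibre `A_t` of the bundle over `t`. -/
abbrev Fiber (t : G) : Type v := BundleFiber 𝒜.proj t

variable {𝒜}

/-- Transport along an equality of base points; the underlying point of the total space is
unchanged. -/
def Fiber.cast {r s : G} (h : r = s) : 𝒜.Fiber r ≃ₗᵢ[ℂ] 𝒜.Fiber s where
  toFun a := ⟨a.val, a.proj_val.trans h⟩
  invFun a := ⟨a.val, a.proj_val.trans h.symm⟩
  map_add' a b := by subst h; rfl
  map_smul' c a := by subst h; rfl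
  left_inv a := rfl
  right_inv a := rfl
  norm_map' a := by subst h; rfl

@[simp] lemma Fiber.cast_val {r s : G} (h : r = s) (a : 𝒜.Fiber r) :
    (Fiber.cast h a).val = a.val := rfl

/-- The bundle multiplication as a bounded bilinear map `A_r × A_s → A_u`, where `u = r s`. -/
def mulL {r s u : G} (h : r * s = u) : 𝒜.Fiber r →L[ℂ] 𝒜.Fiber s →L[ℂ] 𝒜.Fiber u :=
  LinearMap.mkContinuous₂
    (LinearMap.mk₂ ℂ
      (fun a b => (⟨a.val * b.val, by rw [𝒜.proj_mul, a.2, b.2, h]⟩ : 𝒜.Fiber u))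
      (fun a b c => by subst h; exact 𝒜.fib_add_mul a b c)
      (fun z a b => by subst h; exact 𝒜.fib_smul_mul z a b)
      (fun a b c => by subst h; exact 𝒜.fib_mul_add a b c)
      (fun z a b => by subst h; exact 𝒜.fib_mul_smul z a b)) 1
    (fun a b => by subst h; rw [one_mul]; exact 𝒜.fib_norm_mul_le a b)

@[simp] lemma mulL_val {r s u : G} (h : r * s = u) (a : 𝒜.Fiber r) (b : 𝒜.Fiber s) :
    (mulL h a b).val = a.val * b.val := rfl

lemma norm_mulL_le {r s u : G} (h : r * s = u) (a : 𝒜.Fiber r) (b : 𝒜.Fiber s) :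
    ‖mulL h a b‖ ≤ ‖a‖ * ‖b‖ := by subst h; exact 𝒜.fib_norm_mul_le a b

/-- The bundle involution as a conjugate-linear isometry `A_r → A_u`, where `u = r⁻¹`. -/
def starL {r u : G} (h : r⁻¹ = u) : 𝒜.Fiber r →ₗᵢ⋆[ℂ] 𝒜.Fiber u where
  toFun a := ⟨star a.val, by rw [𝒜.proj_star, a.2, h]⟩
  map_add' a b := by subst h; exact 𝒜.fib_star_add a b
  map_smul' c a := by subst h; exact 𝒜.fib_star_smul c a
  norm_map' a := by subst h; exact 𝒜.fib_norm_star a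

@[simp] lemma starL_val {r u : G} (h : r⁻¹ = u) (a : 𝒜.Fiber r) :
    (starL h a).val = star a.val := rfl

/-! ### Continuity of sections along a map -/

lemma norm_mk_val {t : G} (a : 𝒜.Fiber t) :
    ‖(⟨a.val, rfl⟩ : 𝒜.Fiber (𝒜.proj a.val))‖ = ‖a‖ := by
  obtain ⟨a, rfl⟩ := a; rfl

lemma norm_sub_mk {t : G} (a b : 𝒜.Fiber t) :
    ‖(⟨a.val, a.2.trans b.2.symm⟩ : 𝒜.Fiber (𝒜.proj b.val)) - ⟨b.val, rfl⟩‖ = ‖a - b‖ := by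
  obtain ⟨b, rfl⟩ := b; rfl

variable {X : Type*} {φ : X → G} {l : Filter X} {t : G}

lemma tendsto_norm {f : ∀ x, 𝒜.Fiber (φ x)} {a : 𝒜.Fiber t}
    (hf : Tendsto (fun x => (f x).val) l (𝓝 a.val)) : Tendsto (fun x => ‖f x‖) l (𝓝 ‖a‖) := by
  have := (𝒜.continuous_norm_tot.tendsto a.val).comp hf
  simpa only [Function.comp_def, norm_mk_val] using this

lemma add_val_eq {t : G} (a b : 𝒜.Fiber t) :
    ((⟨a.val, a.2.trans b.2.symm⟩ : 𝒜.Fiber (𝒜.proj b.val)) + ⟨b.val, rfl⟩).val = (a + b).val := by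
  obtain ⟨b, rfl⟩ := b; rfl

lemma tendsto_add {f g : ∀ x, 𝒜.Fiber (φ x)} {a b : 𝒜.Fiber t}
    (hf : Tendsto (fun x => (f x).val) l (𝓝 a.val))
    (hg : Tendsto (fun x => (g x).val) l (𝓝 b.val)) :
    Tendsto (fun x => (f x + g x).val) l (𝓝 (a + b).val) := by
  have h1 : Tendsto (fun x => (⟨((f x).val, (g x).val), (f x).2.trans (g x).2.symm⟩ :
      {x : 𝒜.Tot × 𝒜.Tot // 𝒜.proj x.1 = 𝒜.proj x.2})) l
      (𝓝 ⟨(a.val, b.val), a.2.trans b.2.symm⟩) := by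
    rw [tendsto_subtype_rng]; exact hf.prodMk_nhds hg
  have := (𝒜.continuous_add_tot.tendsto _).comp h1
  simpa only [Function.comp_def, add_val_eq] using this

lemma smul_val_eq {t : G} (c : ℂ) (a : 𝒜.Fiber t) :
    (c • (⟨a.val, rfl⟩ : 𝒜.Fiber (𝒜.proj a.val))).val = (c • a).val := by
  obtain ⟨a, rfl⟩ := a; rfl

lemma tendsto_smul (c : ℂ) {f : ∀ x, 𝒜.Fiber (φ x)} {a : 𝒜.Fiber t}
    (hf : Tendsto (fun x => (f x).val) l (𝓝 a.val)) :
    Tendsto (fun x => (c • f x).val) l (𝓝 (c • a).val) := by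
  have := ((𝒜.continuous_smul_tot c).tendsto _).comp hf
  simpa only [Function.comp_def, smul_val_eq] using this

lemma tendsto_sub {f g : ∀ x, 𝒜.Fiber (φ x)} {a b : 𝒜.Fiber t}
    (hf : Tendsto (fun x => (f x).val) l (𝓝 a.val))
    (hg : Tendsto (fun x => (g x).val) l (𝓝 b.val)) :
    Tendsto (fun x => (f x - g x).val) l (𝓝 (a - b).val) := by
  have := tendsto_add hf (tendsto_smul (-1) hg)
  simpa only [neg_smul, one_smul, ← sub_eq_add_neg] using this

lemma tendsto_zero {f : ∀ x, 𝒜.Fiber (φ x)} (hφ : Tendsto φ l (𝓝 t))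
    (hf : Tendsto (fun x => ‖f x‖) l (𝓝 0)) :
    Tendsto (fun x => (f x).val) l (𝓝 (0 : 𝒜.Fiber t).val) := by
  refine Tendsto.mono_right (tendsto_inf.2 ⟨tendsto_comap_iff.2 ?_, tendsto_comap_iff.2 ?_⟩)
    (𝒜.nhds_zero t)
  · simpa only [Function.comp_def, BundleFiber.proj_val] using hφ
  · simpa only [Function.comp_def, norm_mk_val] using hf

variable [TopologicalSpace X]

/-- On a single fibre, the topology of the total space is the norm topology. -/
lemma continuous_val_iff {t : G} {f : X → 𝒜.Fiber t} :
    Continuous (fun x => (f x).val) ↔ Continuous f := by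
  simp only [continuous_iff_continuousAt, ContinuousAt]
  refine forall_congr' fun x₀ => ⟨fun h => ?_, fun h => ?_⟩
  · have := tendsto_norm (tendsto_sub h (tendsto_const_nhds (x := (f x₀).val)))
    rw [sub_self, norm_zero] at this
    exact tendsto_iff_norm_sub_tendsto_zero.2 this
  · have := tendsto_add (tendsto_zero (φ := fun _ => t) tendsto_const_nhds
      (tendsto_iff_norm_sub_tendsto_zero.1 h)) (tendsto_const_nhds (x := (f x₀).val))
    simpa only [sub_add_cancel, zero_add] using this

lemma continuousAt_of_approx {σ : ∀ x, 𝒜.Fiber (φ x)} {x₀ : X} (hφ : ContinuousAt φ x₀)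
    (h : ∀ ε > 0, ∃ τ : ∀ x, 𝒜.Fiber (φ x), ContinuousAt (fun x => (τ x).val) x₀ ∧
      ∀ᶠ x in 𝓝 x₀, ‖σ x - τ x‖ ≤ ε) : ContinuousAt (fun x => (σ x).val) x₀ := by
  rw [ContinuousAt, tendsto_def]
  intro W hW
  -- addition near `(0, σ x₀)`
  have hadd : Tendsto (fun x : {x : 𝒜.Tot × 𝒜.Tot // 𝒜.proj x.1 = 𝒜.proj x.2} =>
      ((⟨x.1.1, x.2⟩ : 𝒜.Fiber (𝒜.proj x.1.2)) + ⟨x.1.2, rfl⟩).val)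
      (𝓝 ⟨((0 : 𝒜.Fiber (φ x₀)).val, (σ x₀).val), (0 : 𝒜.Fiber (φ x₀)).2.trans (σ x₀).2.symm⟩)
      (𝓝 (σ x₀).val) := by
    have := 𝒜.continuous_add_tot.tendsto
      ⟨((0 : 𝒜.Fiber (φ x₀)).val, (σ x₀).val), (0 : 𝒜.Fiber (φ x₀)).2.trans (σ x₀).2.symm⟩
    simpa only [add_val_eq, zero_add] using this
  have h1 := hadd hW
  rw [nhds_subtype_eq_comap, mem_map, mem_comap] at h1
  obtain ⟨S, hS, hSW⟩ := h1
  rw [nhds_prod_eq, mem_prod_iff] at hS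
  obtain ⟨V, hV, U, hU, hVU⟩ := hS
  have hV' := 𝒜.nhds_zero (φ x₀) hV
  rw [mem_inf_iff_superset] at hV'
  obtain ⟨N₁, hN₁, N₂, hN₂, hN⟩ := hV'
  obtain ⟨N, hNt, hNN⟩ := mem_comap.1 hN₁
  obtain ⟨D, hD, hDD⟩ := mem_comap.1 hN₂
  obtain ⟨δ, hδ, hδD⟩ := Metric.mem_nhds_iff.1 hD
  obtain ⟨τ, hτ, hστ⟩ := h (δ / 3) (by positivity)
  -- the norm of the difference near `(τ x₀, σ x₀)`
  have hsub : ∀ᶠ y : {x : 𝒜.Tot × 𝒜.Tot // 𝒜.proj x.1 = 𝒜.proj x.2} in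
      𝓝 ⟨((τ x₀).val, (σ x₀).val), (τ x₀).2.trans (σ x₀).2.symm⟩,
      ‖(⟨y.1.1, y.2⟩ : 𝒜.Fiber (𝒜.proj y.1.2)) - ⟨y.1.2, rfl⟩‖ < 2 * δ / 3 := by
    have h1 : Tendsto (fun y : {x : 𝒜.Tot × 𝒜.Tot // 𝒜.proj x.1 = 𝒜.proj x.2} => y.1.1)
        (𝓝 ⟨((τ x₀).val, (σ x₀).val), (τ x₀).2.trans (σ x₀).2.symm⟩) (𝓝 (τ x₀).val) :=
      (continuous_fst.comp continuous_subtype_val).tendsto _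
    have h2 : Tendsto (fun y : {x : 𝒜.Tot × 𝒜.Tot // 𝒜.proj x.1 = 𝒜.proj x.2} => y.1.2)
        (𝓝 ⟨((τ x₀).val, (σ x₀).val), (τ x₀).2.trans (σ x₀).2.symm⟩) (𝓝 (σ x₀).val) :=
      (continuous_snd.comp continuous_subtype_val).tendsto _
    have h3 := tendsto_norm (tendsto_sub
      (φ := fun y : {x : 𝒜.Tot × 𝒜.Tot // 𝒜.proj x.1 = 𝒜.proj x.2} => 𝒜.proj y.1.2)
      (f := fun y => ⟨y.1.1, y.2⟩) (g := fun y => ⟨y.1.2, rfl⟩) h1 h2)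
    refine h3.eventually (gt_mem_nhds ?_)
    rw [norm_sub_rev]
    exact lt_of_le_of_lt hστ.self_of_nhds (by linarith)
  rw [nhds_subtype_eq_comap, eventually_comap] at hsub
  rw [nhds_prod_eq] at hsub
  obtain ⟨B, hB, U', hU', hBU⟩ := mem_prod_iff.1 hsub
  have hUN : U ∩ U' ∩ 𝒜.proj ⁻¹' N ∈ 𝓝 (σ x₀).val := by
    refine inter_mem (inter_mem hU hU') (𝒜.continuous_proj.continuousAt ?_)
    rw [(σ x₀).2]; exact hNt
  have himg := 𝒜.isOpenMap_proj.image_mem_nhds hUN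
  rw [(σ x₀).2] at himg
  filter_upwards [hφ himg, hτ hB, hστ] with x hx hxB hxε
  obtain ⟨c, ⟨⟨hcU, hcU'⟩, hcN⟩, hc⟩ := hx
  have hlt : ‖τ x - ⟨c, hc⟩‖ < 2 * δ / 3 := by
    have := hBU (Set.mk_mem_prod hxB hcU') ⟨((τ x).val, c), (τ x).2.trans hc.symm⟩ rfl
    rwa [norm_sub_mk (τ x) ⟨c, hc⟩] at this
  have hz : ‖σ x - ⟨c, hc⟩‖ < δ := by
    calc ‖σ x - ⟨c, hc⟩‖ = ‖(σ x - τ x) + (τ x - ⟨c, hc⟩)‖ := by rw [sub_add_sub_cancel]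
      _ ≤ ‖σ x - τ x‖ + ‖τ x - ⟨c, hc⟩‖ := norm_add_le _ _
      _ < δ := by linarith
  have hzV : (σ x - ⟨c, hc⟩).val ∈ V := by
    refine hN ⟨hNN ?_, hDD (hδD ?_)⟩
    · rw [Set.mem_preimage, (σ x - ⟨c, hc⟩).2, ← hc]; exact hcN
    · rw [mem_ball_zero_iff, norm_norm]
      exact (norm_mk_val (σ x - ⟨c, hc⟩)).trans_lt hz
  have hmem := hSW (a := ⟨((σ x - ⟨c, hc⟩).val, c), (σ x - ⟨c, hc⟩).2.trans hc.symm⟩)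
    (hVU (Set.mk_mem_prod hzV hcU))
  have e := add_val_eq (σ x - ⟨c, hc⟩) ⟨c, hc⟩
  rw [sub_add_cancel] at e
  rw [Set.mem_preimage, ← e]
  exact hmem

end Basic

/-! ### Compactly supported continuous sections along a map -/

section Sections

variable {G : Type u} [Group G] [TopologicalSpace G] (𝒜 : FellBundle.{u, v} G)
variable {X : Type*} [TopologicalSpace X]

/-- The space of compactly supported continuous maps `f : X → 𝒜` with `f x ∈ A_{φ x}`. -/
def Cc (φ : C(X, G)) : Submodule ℂ (∀ x, 𝒜.Fiber (φ x)) where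
  carrier := {f | Continuous (fun x => (f x).val) ∧ HasCompactSupport fun x => ‖f x‖}
  zero_mem' := by
    refine ⟨continuous_iff_continuousAt.2 fun x => ?_, ?_⟩
    · exact tendsto_zero (f := fun x => (0 : 𝒜.Fiber (φ x))) (φ.continuous.tendsto x) (by simp)
    · simpa using! HasCompactSupport.zero (α := X) (β := ℝ)
  add_mem' := by
    rintro f g ⟨hf, hf'⟩ ⟨hg, hg'⟩
    refine ⟨continuous_iff_continuousAt.2 fun x => ?_, (hf'.add hg').mono fun x hx => ?_⟩
    · exact tendsto_add (hf.tendsto x) (hg.tendsto x)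
    · contrapose! hx
      simp only [Pi.add_apply, Function.mem_support, not_not] at hx ⊢
      exact le_antisymm ((norm_add_le _ _).trans hx.le) (norm_nonneg _)
  smul_mem' := by
    rintro c f ⟨hf, hf'⟩
    refine ⟨continuous_iff_continuousAt.2 fun x => tendsto_smul c (hf.tendsto x),
      hf'.mono fun x hx => ?_⟩
    contrapose! hx
    simp only [Function.mem_support, not_not] at hx ⊢
    rw [Pi.smul_apply, norm_smul, hx, mul_zero]

variable {𝒜}

lemma continuous_norm_section {φ : X → G} {f : ∀ x, 𝒜.Fiber (φ x)}
    (hf : Continuous fun x => (f x).val) : Continuous fun x => ‖f x‖ :=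
  continuous_iff_continuousAt.2 fun x => tendsto_norm (hf.tendsto x)

variable {Y : Type*} [TopologicalSpace Y] [T2Space Y] [MeasurableSpace Y] [BorelSpace Y]
  {μ : Measure Y} [IsFiniteMeasureOnCompacts μ]

lemma integrable_section {t : G} {f : Y → 𝒜.Fiber t} (hf : Continuous fun y => (f y).val)
    {K : Set Y} (hK : IsCompact K) (h0 : ∀ y, y ∉ K → f y = 0) : Integrable f μ :=
  (continuous_val_iff.1 hf).integrable_of_hasCompactSupport (HasCompactSupport.intro hK h0)

/-- A parametric integral of sections is a continuous section. -/
lemma continuous_integral_section {φ : X → G} (hφ : Continuous φ) {F : ∀ x, Y → 𝒜.Fiber (φ x)}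
    (hF : Continuous fun p : X × Y => (F p.1 p.2).val) {K : Set Y} (hK : IsCompact K)
    (h0 : ∀ x y, y ∉ K → F x y = 0) :
    Continuous fun x => (∫ y, F x y ∂μ).val := by
  refine continuous_iff_continuousAt.2 fun x₀ => continuousAt_of_approx hφ.continuousAt ?_
  have hFy : ∀ y, Continuous fun x => (F x y).val := fun y =>
    hF.comp (Continuous.prodMk continuous_id continuous_const)
  have hFi : ∀ x, Integrable (F x) μ := fun x => integrable_section
    (hF.comp (Continuous.prodMk continuous_const continuous_id)) hK (h0 x)
  intro ε hε
  have hKfin : μ K < ∞ := hK.measure_lt_top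
  set δ : ℝ := ε / (μ.real K + 1) with hδdef
  have hδ : 0 < δ := by positivity
  -- local approximation by step functions
  have key : ∃ S : Set Y, MeasurableSet S ∧ K ⊆ S ∧ ∀ E : Set Y, MeasurableSet E → E ⊆ S → E ⊆ K →
      ∃ τ : ∀ x, 𝒜.Fiber (φ x), ContinuousAt (fun x => (τ x).val) x₀ ∧
        ∀ᶠ x in 𝓝 x₀, ‖(∫ y in E, F x y ∂μ) - τ x‖ ≤ δ * μ.real E := by
    refine hK.induction_on (p := fun T => ∃ S : Set Y, MeasurableSet S ∧ T ⊆ S ∧ ∀ E : Set Y,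
      MeasurableSet E → E ⊆ S → E ⊆ K →
      ∃ τ : ∀ x, 𝒜.Fiber (φ x), ContinuousAt (fun x => (τ x).val) x₀ ∧
        ∀ᶠ x in 𝓝 x₀, ‖(∫ y in E, F x y ∂μ) - τ x‖ ≤ δ * μ.real E) ?_ ?_ ?_ ?_
    · refine ⟨∅, MeasurableSet.empty, subset_rfl, fun E _ hE _ => ⟨fun x => 0, ?_, ?_⟩⟩
      · exact tendsto_zero (f := fun x => (0 : 𝒜.Fiber (φ x))) (hφ.tendsto x₀) (by simp)
      · rw [Set.subset_empty_iff.1 hE]; simp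
    · rintro s t hst ⟨S, hS, htS, h⟩
      exact ⟨S, hS, hst.trans htS, h⟩
    · rintro s t ⟨S, hS, hsS, h⟩ ⟨T, hT, htT, h'⟩
      refine ⟨S ∪ T, hS.union hT, Set.union_subset_union hsS htT, fun E hE hEST hEK => ?_⟩
      obtain ⟨τ, hτ, hτE⟩ := h (E ∩ S) (hE.inter hS) Set.inter_subset_right
        (Set.inter_subset_left.trans hEK)
      obtain ⟨τ', hτ', hτE'⟩ := h' (E \ S) (hE.diff hS)
        (fun y hy => (hEST hy.1).resolve_left hy.2) (Set.sdiff_subset.trans hEK)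
      refine ⟨fun x => τ x + τ' x, tendsto_add hτ hτ', ?_⟩
      filter_upwards [hτE, hτE'] with x h1 h2
      have hfin : μ E ≠ ∞ := ((measure_mono hEK).trans_lt hKfin).ne
      rw [← integral_inter_add_sdiff hS (hFi x).integrableOn, add_sub_add_comm,
        ← measureReal_inter_add_sdiff (s := E) hS hfin, mul_add]
      exact (norm_add_le _ _).trans (add_le_add h1 h2)
    · intro y₀ _
      have hn : Tendsto (fun p : X × Y => ‖F p.1 p.2 - F p.1 y₀‖) (𝓝 (x₀, y₀)) (𝓝 0) := by
        have h2 : Continuous fun p : X × Y => (F p.1 y₀).val := (hFy y₀).comp continuous_fst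
        have := tendsto_norm (φ := fun p : X × Y => φ p.1) (tendsto_sub
          (f := fun p : X × Y => F p.1 p.2) (g := fun p : X × Y => F p.1 y₀)
          (hF.tendsto (x₀, y₀)) (h2.tendsto (x₀, y₀)))
        simpa using this
      have hev := hn.eventually (gt_mem_nhds hδ)
      rw [nhds_prod_eq] at hev
      obtain ⟨N, hN, U, hU, hNU⟩ := mem_prod_iff.1 hev
      obtain ⟨V, hVU, hV, hyV⟩ := mem_nhds_iff.1 hU
      refine ⟨V, mem_nhdsWithin_of_mem_nhds (hV.mem_nhds hyV), V, hV.measurableSet, subset_rfl,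
        fun E hE hEV hEK => ?_⟩
      have hfin : μ E < ∞ := (measure_mono hEK).trans_lt hKfin
      refine ⟨fun x => (μ.real E : ℂ) • F x y₀, tendsto_smul _ ((hFy y₀).tendsto x₀), ?_⟩
      filter_upwards [hN] with x hx
      have hc : ∫ _ in E, F x y₀ ∂μ = (μ.real E : ℂ) • F x y₀ := by
        rw [setIntegral_const, Complex.coe_smul]
      rw [← hc, ← integral_sub (hFi x).integrableOn (integrableOn_const hfin.ne)]
      refine norm_setIntegral_le_of_norm_le_const hfin fun y hy => ?_
      exact (hNU (Set.mk_mem_prod hx (hVU (hEV hy)))).le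
  obtain ⟨S, -, hKS, h⟩ := key
  obtain ⟨τ, hτ, hτK⟩ := h K hK.measurableSet hKS subset_rfl
  refine ⟨τ, hτ, hτK.mono fun x hx => ?_⟩
  rw [setIntegral_eq_integral_of_forall_compl_eq_zero (h0 x)] at hx
  refine hx.trans ?_
  rw [hδdef, div_mul_eq_mul_div, div_le_iff₀ (by positivity)]
  nlinarith [measureReal_nonneg (μ := μ) (s := K)]

end Sections

/-! ### The fibre over the unit as a `C*`-algebra -/

section UnitFiber

variable {G : Type u} [Group G] [TopologicalSpace G] {𝒜 : FellBundle.{u, v} G}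

instance : Mul (𝒜.Fiber 1) := ⟨fun a b => mulL (mul_one 1) a b⟩
instance : Star (𝒜.Fiber 1) := ⟨fun a => starL inv_one a⟩

lemma fiber_mul_def (a b : 𝒜.Fiber 1) : a * b = mulL (mul_one 1) a b := rfl
lemma fiber_star_def (a : 𝒜.Fiber 1) : star a = starL inv_one a := rfl

/-- The fibre `A_e` over the unit, with the operations of the bundle, is a `C*`-algebra. -/
instance : NonUnitalCStarAlgebra (𝒜.Fiber 1) where
  __ := (inferInstance : NormedAddCommGroup (𝒜.Fiber 1))
  __ := (inferInstance : NormedSpace ℂ (𝒜.Fiber 1))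
  __ := (inferInstance : CompleteSpace (𝒜.Fiber 1))
  left_distrib a b c := by simp only [fiber_mul_def, map_add]
  right_distrib a b c := by simp only [fiber_mul_def, map_add, add_apply]
  zero_mul a := by simp only [fiber_mul_def, map_zero, zero_apply]
  mul_zero a := by simp only [fiber_mul_def, map_zero]
  mul_assoc a b c := BundleFiber.ext (mul_assoc a.val b.val c.val)
  norm_mul_le a b := norm_mulL_le _ a b
  star_involutive a := BundleFiber.ext (star_star a.val)
  star_mul a b := BundleFiber.ext (star_mul a.val b.val)
  star_add a b := by simp only [fiber_star_def, map_add]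
  norm_mul_self_le a := by
    have h := 𝒜.fib_norm_star_mul_self a
    rw [← pow_two, ← h]
    exact le_rfl
  smul_assoc c a b := by simp only [smul_eq_mul, fiber_mul_def, map_smul, smul_apply]
  smul_comm c a b := by simp only [smul_eq_mul, fiber_mul_def, map_smul]
  star_smul c a := by simp only [fiber_star_def, map_smulₛₗ]; rfl

end UnitFiber

/-! ### The `*`-algebra of compactly supported continuous kernels -/

section Kernels

variable {G : Type u} [Group G] [TopologicalSpace G] [IsTopologicalGroup G]

variable (G) in
/-- The map `(r, s) ↦ r s⁻¹`. -/
def kerMap : C(G × G, G) := ⟨fun x => x.1 * x.2⁻¹, by fun_prop⟩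

variable (𝒜 : FellBundle.{u, v} G) [MeasurableSpace G]

/-- The space `k_c(𝒜)` of continuous kernels of compact support: compactly supported continuous
maps `k : G × G → 𝒜` such that `k (r, s) ∈ A_{r s⁻¹}`. The product and the norm of kernels depend on
the Haar measure `μ`, which is therefore a parameter. -/
def Kernel (_μ : Measure G) : Type (max u v) := 𝒜.Cc (kerMap G)

namespace Kernel

variable {𝒜} {μ : Measure G}

instance : AddCommGroup (Kernel 𝒜 μ) := inferInstanceAs (AddCommGroup (𝒜.Cc (kerMap G)))
instance : Module ℂ (Kernel 𝒜 μ) := inferInstanceAs (Module ℂ (𝒜.Cc (kerMap G)))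

/-- The value `k (r, s) ∈ A_{r s⁻¹}` of a kernel. -/
def app (k : Kernel 𝒜 μ) (r s : G) : 𝒜.Fiber (r * s⁻¹) := k.1 (r, s)

@[ext] lemma ext {k l : Kernel 𝒜 μ} (h : ∀ r s, k.app r s = l.app r s) : k = l :=
  Subtype.ext (funext fun x => h x.1 x.2)

@[simp] lemma add_app (k l : Kernel 𝒜 μ) (r s : G) : (k + l).app r s = k.app r s + l.app r s := rfl
@[simp] lemma zero_app (r s : G) : (0 : Kernel 𝒜 μ).app r s = 0 := rfl
@[simp] lemma neg_app (k : Kernel 𝒜 μ) (r s : G) : (-k).app r s = -k.app r s := rfl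
@[simp] lemma smul_app (c : ℂ) (k : Kernel 𝒜 μ) (r s : G) : (c • k).app r s = c • k.app r s := rfl

lemma continuous_app (k : Kernel 𝒜 μ) : Continuous fun x : G × G => (k.app x.1 x.2).val := k.2.1

lemma exists_compact (k : Kernel 𝒜 μ) :
    ∃ K : Set G, IsCompact K ∧ ∀ r s, r ∉ K ∨ s ∉ K → k.app r s = 0 := by
  have hc : IsCompact (tsupport fun x : G × G => ‖k.app x.1 x.2‖) := k.2.2
  refine ⟨Prod.fst '' (tsupport fun x : G × G => ‖k.app x.1 x.2‖) ∪
    Prod.snd '' (tsupport fun x : G × G => ‖k.app x.1 x.2‖),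
    (hc.image continuous_fst).union (hc.image continuous_snd), fun r s h => ?_⟩
  by_contra h0
  have hmem : (r, s) ∈ tsupport fun x : G × G => ‖k.app x.1 x.2‖ :=
    subset_closure (by simpa using h0)
  rcases h with h | h
  · exact h (Or.inl ⟨_, hmem, rfl⟩)
  · exact h (Or.inr ⟨_, hmem, rfl⟩)

variable [T2Space G]

/-- Constructor for kernels. -/
def mk' (f : ∀ r s : G, 𝒜.Fiber (r * s⁻¹)) (hf : Continuous fun x : G × G => (f x.1 x.2).val)
    (hK : ∃ K : Set G, IsCompact K ∧ ∀ r s, r ∉ K ∨ s ∉ K → f r s = 0) : Kernel 𝒜 μ :=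
  ⟨fun x => f x.1 x.2, hf, by
    obtain ⟨K, hK, h0⟩ := hK
    refine HasCompactSupport.intro (hK.prod hK) fun x hx => ?_
    rw [Set.mem_prod, not_and_or] at hx
    exact (congrArg norm (h0 x.1 x.2 hx)).trans norm_zero⟩

@[simp] lemma mk'_app (f : ∀ r s : G, 𝒜.Fiber (r * s⁻¹)) (hf hK) (r s : G) :
    (mk' f hf hK : Kernel 𝒜 μ).app r s = f r s := rfl

/-- The involution `k* (r, s) = k (s, r)*`. -/
instance : Star (Kernel 𝒜 μ) where
  star k := mk' (fun r s => starL (by group) (k.app s r))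
    (𝒜.continuous_star_tot.comp (k.continuous_app.comp continuous_swap)) (by
      obtain ⟨K, hK, h0⟩ := k.exists_compact
      exact ⟨K, hK, fun r s h => by rw [h0 s r h.symm, map_zero]⟩)

lemma star_app (k : Kernel 𝒜 μ) (r s : G) :
    (star k).app r s = starL (by group) (k.app s r) := rfl

variable [BorelSpace G] [IsFiniteMeasureOnCompacts μ]

lemma continuous_mul_app (k l : Kernel 𝒜 μ) : Continuous fun p : (G × G) × G =>
    (k.app p.1.1 p.2).val * (l.app p.2 p.1.2).val := by
  refine 𝒜.continuous_mul_tot.comp (Continuous.prodMk ?_ ?_)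
  · exact k.continuous_app.comp
      (Continuous.prodMk (continuous_fst.comp continuous_fst) continuous_snd)
  · exact l.continuous_app.comp
      (Continuous.prodMk continuous_snd (continuous_snd.comp continuous_fst))

/-- The convolution product `(k * l) (r, s) = ∫ k (r, t) l (t, s) dt`. -/
instance : Mul (Kernel 𝒜 μ) where
  mul k l := mk' (fun r s => ∫ t, mulL (by group) (k.app r t) (l.app t s) ∂μ)
    (by
      obtain ⟨K, hK, h0⟩ := k.exists_compact
      refine continuous_integral_section (φ := fun x : G × G => x.1 * x.2⁻¹) (by fun_prop)
        (F := fun x t => mulL (by group) (k.app x.1 t) (l.app t x.2)) ?_ hK ?_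
      · exact continuous_mul_app k l
      · intro x y hy
        rw [h0 _ _ (Or.inr hy), map_zero, zero_apply])
    (by
      obtain ⟨K, hK, h0⟩ := k.exists_compact
      obtain ⟨L, hL, h0'⟩ := l.exists_compact
      refine ⟨K ∪ L, hK.union hL, fun r s h => ?_⟩
      refine integral_eq_zero_of_ae (ae_of_all _ fun t => ?_)
      rcases h with h | h
      · simp [h0 r t (Or.inl fun h' => h (Or.inl h'))]
      · simp [h0' t s (Or.inr fun h' => h (Or.inr h'))])

lemma mul_app (k l : Kernel 𝒜 μ) (r s : G) :
    (k * l).app r s = ∫ t, mulL (by group) (k.app r t) (l.app t s) ∂μ := rfl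

lemma integrable_mul_app (k l : Kernel 𝒜 μ) (r s : G) {u : G} (h : ∀ t, r * t⁻¹ * (t * s⁻¹) = u) :
    Integrable (fun t => mulL (h t) (k.app r t) (l.app t s)) μ := by
  obtain ⟨K, hK, h0⟩ := k.exists_compact
  refine integrable_section ?_ hK fun y hy => ?_
  · exact (continuous_mul_app k l).comp
      (Continuous.prodMk (continuous_const (y := (r, s))) continuous_id)
  · rw [h0 _ _ (Or.inr hy), map_zero, zero_apply]

/-- The real-linear isometry underlying the involution of the bundle. -/
def starR {r u : G} (h : r⁻¹ = u) : 𝒜.Fiber r →L[ℝ] 𝒜.Fiber u :=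
  LinearMap.mkContinuous
    { toFun := fun a => starL h a
      map_add' := fun a b => map_add _ a b
      map_smul' := fun c a => by
        rw [← Complex.coe_smul, map_smulₛₗ, Complex.conj_ofReal, Complex.coe_smul]; rfl } 1
    fun a => by
      rw [one_mul]; exact (LinearIsometry.norm_map (starL h) a).le

lemma mul_assoc_aux (k l m : Kernel 𝒜 μ) : k * l * m = k * (l * m) := by
  ext1 r s
  obtain ⟨K, hK, h0⟩ := k.exists_compact
  obtain ⟨L, hL, h0'⟩ := l.exists_compact
  have e1 : ∀ u, mulL (by group) ((k * l).app r u) (m.app u s) =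
      ∫ t, mulL (by group : r * u⁻¹ * (u * s⁻¹) = r * s⁻¹)
        (mulL (by group) (k.app r t) (l.app t u)) (m.app u s) ∂μ := fun u => by
    rw [mul_app]
    exact (((mulL (by group : r * u⁻¹ * (u * s⁻¹) = r * s⁻¹)).flip
      (m.app u s)).integral_comp_comm (integrable_mul_app k l r u fun t => by group)).symm
  have e2 : ∀ t, mulL (by group) (k.app r t) ((l * m).app t s) =
      ∫ u, mulL (by group : r * t⁻¹ * (t * s⁻¹) = r * s⁻¹) (k.app r t)
        (mulL (by group) (l.app t u) (m.app u s)) ∂μ := fun t => by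
    rw [mul_app]
    exact ((mulL (by group : r * t⁻¹ * (t * s⁻¹) = r * s⁻¹)
      (k.app r t)).integral_comp_comm (integrable_mul_app l m t s fun t => by group)).symm
  rw [mul_app, mul_app]
  simp_rw [e1, e2]
  rw [integral_integral_swap_of_hasCompactSupport]
  · refine integral_congr_ae (ae_of_all _ fun t => integral_congr_ae (ae_of_all _ fun u => ?_))
    exact BundleFiber.ext (mul_assoc _ _ _)
  · refine continuous_val_iff.1 ?_
    refine 𝒜.continuous_mul_tot.comp (Continuous.prodMk (𝒜.continuous_mul_tot.comp
      (Continuous.prodMk ?_ ?_)) ?_)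
    · exact k.continuous_app.comp (Continuous.prodMk continuous_const continuous_snd)
    · exact l.continuous_app.comp (Continuous.prodMk continuous_snd continuous_fst)
    · exact m.continuous_app.comp (Continuous.prodMk continuous_fst continuous_const)
  · refine HasCompactSupport.intro (hL.prod hK) fun x hx => ?_
    rw [Set.mem_prod, not_and_or] at hx
    rcases hx with hx | hx
    · simp [Function.uncurry, h0' x.2 x.1 (Or.inr hx)]
    · simp [Function.uncurry, h0 r x.2 (Or.inr hx)]

instance : NonUnitalRing (Kernel 𝒜 μ) where
  __ := (inferInstance : AddCommGroup (Kernel 𝒜 μ))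
  left_distrib k l m := by
    ext1 r s
    rw [add_app, mul_app, mul_app, mul_app, ← integral_add (integrable_mul_app _ _ _ _ _)
      (integrable_mul_app _ _ _ _ _)]
    simp only [add_app, map_add]
  right_distrib k l m := by
    ext1 r s
    rw [add_app, mul_app, mul_app, mul_app, ← integral_add (integrable_mul_app _ _ _ _ _)
      (integrable_mul_app _ _ _ _ _)]
    simp only [add_app, map_add, _root_.add_apply]
  zero_mul k := by ext1 r s; simp [mul_app]
  mul_zero k := by ext1 r s; simp [mul_app]
  mul_assoc := mul_assoc_aux

instance : StarRing (Kernel 𝒜 μ) where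
  star_involutive k := by
    ext1 r s
    exact BundleFiber.ext (star_star _)
  star_mul k l := by
    ext1 r s
    rw [star_app, mul_app, mul_app]
    refine ((starR (by group)).integral_comp_comm
      (integrable_mul_app k l s r fun t => by group)).symm.trans ?_
    refine integral_congr_ae (ae_of_all _ fun t => ?_)
    exact BundleFiber.ext (star_mul _ _)
  star_add k l := by
    ext1 r s
    simp only [star_app, add_app, map_add]

instance : StarModule ℂ (Kernel 𝒜 μ) where
  star_smul c k := by
    ext1 r s
    simp only [star_app, smul_app, map_smulₛₗ]; rfl

instance : IsScalarTower ℂ (Kernel 𝒜 μ) (Kernel 𝒜 μ) where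
  smul_assoc c k l := by
    ext1 r s
    simp only [smul_eq_mul, mul_app, smul_app, map_smul, _root_.smul_apply, integral_smul]

instance : SMulCommClass ℂ (Kernel 𝒜 μ) (Kernel 𝒜 μ) where
  smul_comm c k l := by
    ext1 r s
    simp only [smul_eq_mul, mul_app, smul_app, map_smul, integral_smul]

end Kernel

end Kernels

/-! ### The Hilbert–Schmidt norm and the modular function -/

section Positive

variable {X : Type*} [TopologicalSpace X]

open CompactlySupported in
/-- The Cauchy–Schwarz inequality for a positive functional. -/
lemma functional_cauchy_schwarz (Λ : C_c(X, ℝ) →ₗ[ℝ] ℝ) (hΛ : ∀ f, (∀ x, 0 ≤ f x) → 0 ≤ Λ f)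
    (f g : C_c(X, ℝ)) : Λ (f * g) ^ 2 ≤ Λ (f * f) * Λ (g * g) := by
  have h : ∀ x : ℝ, 0 ≤ Λ (g * g) * (x * x) + (2 * Λ (f * g)) * x + Λ (f * f) := fun x => by
    have h0 := hΛ ((f + x • g) * (f + x • g)) fun y => mul_self_nonneg _
    have e : (f + x • g) * (f + x • g) = f * f + (2 * x) • (f * g) + (x * x) • (g * g) := by
      ext y
      simp
      ring
    rw [e, map_add, map_add, map_smul, map_smul, smul_eq_mul, smul_eq_mul] at h0
    linarith
  have := discrim_le_zero h
  rw [discrim] at this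
  nlinarith

end Positive

section Haar

variable {G : Type u} [Group G] [TopologicalSpace G] [IsTopologicalGroup G]
  [LocallyCompactSpace G]

/-- The modular function `Δ` of `G`, normalized by `∫ f (r t) dr = Δ(t)⁻¹ ∫ f (r) dr` for a left Haar
measure `dr`. (Mathlib's modular character is the inverse of this one.) -/
def modular (t : G) : ℝ := ((Measure.modularCharacterFun t : ℝ≥0) : ℝ)⁻¹

lemma modular_pos (t : G) : 0 < modular t :=
  inv_pos.2 (NNReal.coe_pos.2 (Measure.modularCharacterFun_pos t))

lemma integral_mul_right_modular [MeasurableSpace G] [BorelSpace G] (μ : Measure G)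
    [μ.IsHaarMeasure] {E : Type*} [NormedAddCommGroup E] [NormedSpace ℝ E] [CompleteSpace E]
    {f : G → E} (hf : Continuous f) (hf' : HasCompactSupport f) (t : G) :
    ∫ r, f (r * t) ∂μ = (modular t)⁻¹ • ∫ r, f r ∂μ := by
  have hft : Continuous fun r => f (r * t) := hf.comp (continuous_mul_const t)
  have hft' : HasCompactSupport fun r => f (r * t) := hf'.comp_homeomorph (Homeomorph.mulRight t)
  refine (SeparatingDual.eq_iff_forall_dual_eq (R := ℝ)).2 fun L => ?_
  rw [map_smul, ← L.integral_comp_comm (hft.integrable_of_hasCompactSupport hft'),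
    ← L.integral_comp_comm (hf.integrable_of_hasCompactSupport hf')]
  have hg : Continuous fun r => L (f r) := L.continuous.comp hf
  have hg' : HasCompactSupport fun r => L (f r) := hf'.comp_left (map_zero L)
  have h1 : ∫ r, L (f (r * t)) ∂μ = ∫ r, L (f r) ∂(Measure.map (· * t) μ) :=
    (integral_map (continuous_mul_const t).aemeasurable hg.aestronglyMeasurable).symm
  rw [h1, Measure.integral_isMulLeftInvariant_eq_smul_of_hasCompactSupport _ μ hg hg',
    integral_smul_nnreal_measure, ← Measure.modularCharacterFun_eq_haarScalarFactor, modular,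
    inv_inv]
  rfl

end Haar

section HilbertSchmidt

variable {G : Type u} [Group G] [TopologicalSpace G] [IsTopologicalGroup G]
  [T2Space G] [MeasurableSpace G] [BorelSpace G] {𝒜 : FellBundle.{u, v} G}
  {μ : Measure G} [IsFiniteMeasureOnCompacts μ]

open CompactlySupported

lemma compl_of_cc (f : C_c(G × G, ℝ)) :
    ∃ K : Set G, IsCompact K ∧ ∀ r s, r ∉ K ∨ s ∉ K → f (r, s) = 0 := by
  have hc : IsCompact (tsupport f) := f.hasCompactSupport
  refine ⟨Prod.fst '' tsupport f ∪ Prod.snd '' tsupport f,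
    (hc.image continuous_fst).union (hc.image continuous_snd), fun r s h => ?_⟩
  by_contra h0
  have hmem : (r, s) ∈ tsupport f := subset_closure h0
  rcases h with h | h
  · exact h (Or.inl ⟨_, hmem, rfl⟩)
  · exact h (Or.inr ⟨_, hmem, rfl⟩)

lemma integrable_cc_right (f : C_c(G × G, ℝ)) (r : G) : Integrable (fun s => f (r, s)) μ := by
  obtain ⟨K, hK, h0⟩ := compl_of_cc f
  exact (f.continuous.comp (Continuous.prodMk continuous_const continuous_id)
    ).integrable_of_hasCompactSupport (HasCompactSupport.intro hK fun s hs => h0 r s (Or.inr hs))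

lemma continuous_cc_integral (f : C_c(G × G, ℝ)) : Continuous fun r => ∫ s, f (r, s) ∂μ := by
  obtain ⟨K, hK, h0⟩ := compl_of_cc f
  rw [← continuousOn_univ]
  exact continuousOn_integral_of_compact_support hK f.continuous.continuousOn
    fun r s _ hs => h0 r s (Or.inr hs)

lemma hasCompactSupport_cc_integral (f : C_c(G × G, ℝ)) :
    HasCompactSupport fun r => ∫ s, f (r, s) ∂μ := by
  obtain ⟨K, hK, h0⟩ := compl_of_cc f
  refine HasCompactSupport.intro hK fun r hr => ?_
  simp [h0 r _ (Or.inl hr)]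

lemma integrable_cc_integral (f : C_c(G × G, ℝ)) : Integrable (fun r => ∫ s, f (r, s) ∂μ) μ :=
  (continuous_cc_integral f).integrable_of_hasCompactSupport (hasCompactSupport_cc_integral f)

variable (μ) in
/-- Integration over `G × G` of compactly supported continuous functions. -/
def integral₂ : C_c(G × G, ℝ) →ₗ[ℝ] ℝ where
  toFun f := ∫ r, ∫ s, f (r, s) ∂μ ∂μ
  map_add' f g := by
    rw [← integral_add (integrable_cc_integral f) (integrable_cc_integral g)]
    refine integral_congr_ae (ae_of_all _ fun r => ?_)
    exact integral_add (integrable_cc_right f r) (integrable_cc_right g r)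
  map_smul' c f := by
    simp [integral_const_mul]

variable (μ) in
/-- Integration over `G` of compactly supported continuous functions. -/
def integral₁ : C_c(G, ℝ) →ₗ[ℝ] ℝ where
  toFun f := ∫ r, f r ∂μ
  map_add' f g := integral_add (f.continuous.integrable_of_hasCompactSupport f.hasCompactSupport)
    (g.continuous.integrable_of_hasCompactSupport g.hasCompactSupport)
  map_smul' c f := by simp [integral_const_mul]

lemma integral₂_nonneg (f : C_c(G × G, ℝ)) (hf : ∀ x, 0 ≤ f x) : 0 ≤ integral₂ μ f :=
  integral_nonneg fun r => integral_nonneg fun s => hf (r, s)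

lemma integral₂_mono {f g : C_c(G × G, ℝ)} (h : ∀ x, f x ≤ g x) :
    integral₂ μ f ≤ integral₂ μ g := by
  have := integral₂_nonneg (μ := μ) (g - f) fun x => by simpa using h x
  rw [map_sub] at this
  linarith

namespace Kernel

/-- The function `(r, s) ↦ ‖k (r, s)‖`. -/
def normFn (k : Kernel 𝒜 μ) : C_c(G × G, ℝ) where
  toFun x := ‖k.app x.1 x.2‖
  continuous_toFun := continuous_norm_section (φ := fun x : G × G => x.1 * x.2⁻¹)
    (f := fun x => k.app x.1 x.2) k.continuous_app
  hasCompactSupport' := k.2.2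

lemma normFn_apply (k : Kernel 𝒜 μ) (r s : G) : k.normFn (r, s) = ‖k.app r s‖ := rfl

/-- The Hilbert–Schmidt norm `‖k‖₂ = (∫∫ ‖k (r, s)‖² dr ds) ^ (1 / 2)`. -/
def hsNorm (k : Kernel 𝒜 μ) : ℝ := √(∫ r, ∫ s, ‖k.app r s‖ ^ 2 ∂μ ∂μ)

lemma integral₂_normFn (k : Kernel 𝒜 μ) :
    integral₂ μ (k.normFn * k.normFn) = ∫ r, ∫ s, ‖k.app r s‖ ^ 2 ∂μ ∂μ := by
  simp [integral₂, normFn_apply, pow_two]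

lemma hsNorm_sq (k : Kernel 𝒜 μ) : k.hsNorm ^ 2 = integral₂ μ (k.normFn * k.normFn) := by
  rw [integral₂_normFn, hsNorm, Real.sq_sqrt]
  exact integral_nonneg fun r => integral_nonneg fun s => sq_nonneg _

lemma hsNorm_nonneg (k : Kernel 𝒜 μ) : 0 ≤ k.hsNorm := Real.sqrt_nonneg _

lemma hsNorm_add_le (k l : Kernel 𝒜 μ) : (k + l).hsNorm ≤ k.hsNorm + l.hsNorm := by
  refine le_of_sq_le_sq ?_ (add_nonneg k.hsNorm_nonneg l.hsNorm_nonneg)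
  have hcs := functional_cauchy_schwarz (integral₂ μ) integral₂_nonneg k.normFn l.normFn
  rw [← hsNorm_sq, ← hsNorm_sq, ← mul_pow] at hcs
  have hcs' := abs_le_of_sq_le_sq hcs (mul_nonneg k.hsNorm_nonneg l.hsNorm_nonneg)
  have hle : integral₂ μ ((k + l).normFn * (k + l).normFn) ≤
      integral₂ μ (k.normFn * k.normFn + (2 : ℝ) • (k.normFn * l.normFn) +
        l.normFn * l.normFn) := by
    refine integral₂_mono fun x => ?_
    have h1 : ‖k.app x.1 x.2 + l.app x.1 x.2‖ ≤ ‖k.app x.1 x.2‖ + ‖l.app x.1 x.2‖ :=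
      norm_add_le _ _
    have h2 := norm_nonneg (k.app x.1 x.2 + l.app x.1 x.2)
    change ‖k.app x.1 x.2 + l.app x.1 x.2‖ * ‖k.app x.1 x.2 + l.app x.1 x.2‖ ≤
      ‖k.app x.1 x.2‖ * ‖k.app x.1 x.2‖ + 2 * (‖k.app x.1 x.2‖ * ‖l.app x.1 x.2‖) +
        ‖l.app x.1 x.2‖ * ‖l.app x.1 x.2‖
    nlinarith
  rw [map_add, map_add, map_smul, smul_eq_mul, ← hsNorm_sq, ← hsNorm_sq, ← hsNorm_sq] at hle
  nlinarith [le_of_abs_le hcs']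

lemma hsNorm_smul (c : ℂ) (k : Kernel 𝒜 μ) : (c • k).hsNorm = ‖c‖ * k.hsNorm := by
  rw [hsNorm, hsNorm]
  simp_rw [smul_app, norm_smul, mul_pow, integral_const_mul]
  rw [Real.sqrt_mul (sq_nonneg _), Real.sqrt_sq (norm_nonneg _)]

lemma integral_swap_normFn (k : Kernel 𝒜 μ) :
    ∫ r, ∫ s, ‖k.app s r‖ ^ 2 ∂μ ∂μ = ∫ r, ∫ s, ‖k.app r s‖ ^ 2 ∂μ ∂μ := by
  refine integral_integral_swap_of_hasCompactSupport
    (f := fun r s => ‖k.app s r‖ ^ 2) ?_ ?_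
  · exact (k.normFn.continuous.comp continuous_swap).pow 2
  · obtain ⟨K, hK, h0⟩ := k.exists_compact
    refine HasCompactSupport.intro (hK.prod hK) fun x hx => ?_
    rw [Set.mem_prod, not_and_or] at hx
    simp [Function.uncurry, h0 x.2 x.1 hx.symm]

lemma hsNorm_star (k : Kernel 𝒜 μ) : (star k).hsNorm = k.hsNorm := by
  rw [hsNorm, hsNorm, ← integral_swap_normFn k]
  simp only [star_app, LinearIsometry.norm_map]

lemma sq_norm_mul_app_le (k l : Kernel 𝒜 μ) (r s : G) : ‖(k * l).app r s‖ ^ 2 ≤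
    (∫ t, ‖k.app r t‖ ^ 2 ∂μ) * ∫ t, ‖l.app t s‖ ^ 2 ∂μ := by
  obtain ⟨K, hK, h0⟩ := k.exists_compact
  obtain ⟨L, hL, h0'⟩ := l.exists_compact
  let f : C_c(G, ℝ) := ⟨⟨fun t => ‖k.app r t‖,
    k.normFn.continuous.comp (Continuous.prodMk continuous_const continuous_id)⟩,
    HasCompactSupport.intro hK fun t ht => by simp [h0 r t (Or.inr ht)]⟩
  let g : C_c(G, ℝ) := ⟨⟨fun t => ‖l.app t s‖,
    l.normFn.continuous.comp (Continuous.prodMk continuous_id continuous_const)⟩,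
    HasCompactSupport.intro hL fun t ht => by simp [h0' t s (Or.inl ht)]⟩
  have hcs := functional_cauchy_schwarz (integral₁ μ)
    (fun f hf => integral_nonneg fun t => hf t) f g
  have e1 : integral₁ μ (f * f) = ∫ t, ‖k.app r t‖ ^ 2 ∂μ := by
    simp only [pow_two]; rfl
  have e2 : integral₁ μ (g * g) = ∫ t, ‖l.app t s‖ ^ 2 ∂μ := by
    simp only [pow_two]; rfl
  rw [e1, e2] at hcs
  refine le_trans (pow_le_pow_left₀ (norm_nonneg _) ?_ 2) hcs
  rw [mul_app]
  refine norm_integral_le_of_norm_le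
    ((f * g).continuous.integrable_of_hasCompactSupport (f * g).hasCompactSupport)
    (ae_of_all _ fun t => ?_)
  exact norm_mulL_le _ _ _

lemma hsNorm_mul_le (k l : Kernel 𝒜 μ) : (k * l).hsNorm ≤ k.hsNorm * l.hsNorm := by
  refine le_of_sq_le_sq ?_ (mul_nonneg k.hsNorm_nonneg l.hsNorm_nonneg)
  rw [mul_pow, hsNorm_sq, hsNorm_sq, hsNorm_sq, integral₂_normFn, integral₂_normFn k,
    integral₂_normFn l, ← integral_swap_normFn l]
  have hi : ∀ m : Kernel 𝒜 μ, Integrable (fun r => ∫ s, ‖m.app r s‖ ^ 2 ∂μ) μ := fun m => by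
    have := integrable_cc_integral (μ := μ) (m.normFn * m.normFn)
    simpa [normFn_apply, ← pow_two] using this
  have hj : ∀ (m : Kernel 𝒜 μ) (r : G), Integrable (fun s => ‖m.app r s‖ ^ 2) μ := fun m r => by
    have := integrable_cc_right (μ := μ) (m.normFn * m.normFn) r
    simpa [normFn_apply, ← pow_two] using this
  have hl : Integrable (fun s => ∫ t, ‖l.app t s‖ ^ 2 ∂μ) μ := by
    have := hi (star l)
    simpa only [star_app, LinearIsometry.norm_map] using this
  rw [← integral_mul_const]
  refine integral_mono (hi _) ((hi k).mul_const _) fun r => ?_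
  dsimp only
  rw [← integral_const_mul]
  exact integral_mono (hj _ r) (hl.const_mul _) fun s => sq_norm_mul_app_le k l r s

instance : NonUnitalSeminormedRing (Kernel 𝒜 μ) where
  __ := (inferInstance : NonUnitalRing (Kernel 𝒜 μ))
  __ := AddGroupSeminorm.toSeminormedAddCommGroup (E := Kernel 𝒜 μ)
    { toFun := hsNorm
      map_zero' := by simp [hsNorm]
      add_le' := hsNorm_add_le
      neg' := fun k => by simp [hsNorm] }
  norm_mul_le := hsNorm_mul_le

lemma norm_def (k : Kernel 𝒜 μ) : ‖k‖ = √(∫ r, ∫ s, ‖k.app r s‖ ^ 2 ∂μ ∂μ) := rfl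

instance : NormedSpace ℂ (Kernel 𝒜 μ) where
  norm_smul_le c k := (hsNorm_smul c k).le

instance : NormedStarGroup (Kernel 𝒜 μ) where
  norm_star_le k := (hsNorm_star k).le

end Kernel

variable (𝒜 μ)

/-- The Banach `*`-algebra `HS(𝒜)` of Hilbert–Schmidt kernels: the completion of `k_c(𝒜)` for
`‖·‖₂`. -/
abbrev HS : Type (max u v) := StarCompletion (Kernel 𝒜 μ)

/-- The `C*`-algebra of kernels `k(𝒜) = C*(HS(𝒜))`. -/
abbrev KernelAlgebra : Type (max u v + 1) := Envelope (HS 𝒜 μ)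

variable {𝒜 μ}

/-- The canonical map `k_c(𝒜) → k(𝒜)`. -/
def Kernel.toAlgebra (k : Kernel 𝒜 μ) : KernelAlgebra 𝒜 μ := toEnvelope (StarCompletion.of k)

end HilbertSchmidt

/-! ### The canonical action -/

section Action

variable {G : Type u} [Group G] [TopologicalSpace G] [IsTopologicalGroup G]
  [LocallyCompactSpace G] [T2Space G] [MeasurableSpace G] [BorelSpace G]
  {𝒜 : FellBundle.{u, v} G} {μ : Measure G}

/-- The kernel `β_t(k) (r, s) = Δ(t) k (r t, s t)`. -/
def Kernel.translate (t : G) (k : Kernel 𝒜 μ) : Kernel 𝒜 μ :=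
  .mk' (fun r s => (modular t : ℂ) • Fiber.cast (by group) (k.app (r * t) (s * t)))
    (by
      have h : Continuous fun x : G × G => (k.app (x.1 * t) (x.2 * t)).val :=
        k.continuous_app.comp (Continuous.prodMk (by fun_prop) (by fun_prop))
      refine continuous_iff_continuousAt.2 fun x => ?_
      exact tendsto_smul (φ := fun x : G × G => x.1 * x.2⁻¹)
        (f := fun x => Fiber.cast (by group) (k.app (x.1 * t) (x.2 * t)))
        (a := Fiber.cast (by group) (k.app (x.1 * t) (x.2 * t))) _ (h.tendsto x))
    (by
      obtain ⟨K, hK, h0⟩ := k.exists_compact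
      refine ⟨(fun r => r * t⁻¹) '' K, hK.image (continuous_mul_const _), fun r s h => ?_⟩
      rw [h0, map_zero, smul_zero]
      refine h.imp (fun h h' => h ⟨_, h', by group⟩) (fun h h' => h ⟨_, h', by group⟩))

lemma Kernel.translate_app (t : G) (k : Kernel 𝒜 μ) (r s : G) : (k.translate t).app r s =
    (modular t : ℂ) • Fiber.cast (by group) (k.app (r * t) (s * t)) := rfl

variable [μ.IsHaarMeasure]

variable (𝒜 μ) in
/-- `β_t` as a `*`-homomorphism of `k_c(𝒜)`. -/
def translateHom (t : G) : Kernel 𝒜 μ →⋆ₙₐ[ℂ] Kernel 𝒜 μ where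
  toFun := Kernel.translate t
  map_smul' c k := by
    ext1 r s
    simp only [Kernel.translate_app, Kernel.smul_app, map_smul, MonoidHom.id_apply]
    exact smul_comm _ _ _
  map_zero' := by ext1 r s; simp [Kernel.translate_app]
  map_add' k l := by
    ext1 r s
    simp only [Kernel.translate_app, Kernel.add_app, map_add, smul_add]
  map_mul' k l := by
    ext1 r s
    obtain ⟨K, hK, h0⟩ := k.exists_compact
    have hΔ := (modular_pos t).ne'
    have h1 := integral_mul_right_modular μ
      (f := fun u => mulL (by group : r * t * u⁻¹ * (u * (s * t)⁻¹) = r * s⁻¹)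
        (k.app (r * t) u) (l.app u (s * t)))
      (continuous_val_iff.1 ((Kernel.continuous_mul_app k l).comp
        (Continuous.prodMk (continuous_const (y := (r * t, s * t))) continuous_id)))
      (HasCompactSupport.intro hK fun u hu => by simp [h0 _ _ (Or.inr hu)]) t
    rw [Kernel.translate_app, Kernel.mul_app, Kernel.mul_app]
    have h2 : Fiber.cast (by group) (∫ u, mulL (by group :
        r * t * u⁻¹ * (u * (s * t)⁻¹) = r * t * (s * t)⁻¹)
        (k.app (r * t) u) (l.app u (s * t)) ∂μ) =
        ∫ u, mulL (by group : r * t * u⁻¹ * (u * (s * t)⁻¹) = r * s⁻¹)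
        (k.app (r * t) u) (l.app u (s * t)) ∂μ :=
      ((Fiber.cast (𝒜 := 𝒜) (by group : r * t * (s * t)⁻¹ = r * s⁻¹)
        ).toContinuousLinearEquiv.toContinuousLinearMap.integral_comp_comm
        (Kernel.integrable_mul_app k l (r * t) (s * t) fun u => by group)).symm
    rw [h2]
    have h3 : ∫ u, mulL (by group : r * u⁻¹ * (u * s⁻¹) = r * s⁻¹)
        ((k.translate t).app r u) ((l.translate t).app u s) ∂μ =
        ((modular t : ℂ) * modular t) • ∫ u, mulL (by group :
          r * t * (u * t)⁻¹ * (u * t * (s * t)⁻¹) = r * s⁻¹)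
        (k.app (r * t) (u * t)) (l.app (u * t) (s * t)) ∂μ := by
      rw [← integral_smul]
      refine integral_congr_ae (ae_of_all _ fun u => ?_)
      simp only [Kernel.translate_app, map_smul, smul_apply, smul_smul]
      rfl
    rw [h3, h1, ← Complex.coe_smul, smul_smul]
    congr 1
    push_cast
    have : (modular t : ℂ) ≠ 0 := by exact_mod_cast hΔ
    field_simp
  map_star' k := by
    ext1 r s
    simp only [Kernel.translate_app, Kernel.star_app, map_smulₛₗ, Complex.conj_ofReal]
    rfl

lemma norm_translateHom (t : G) (k : Kernel 𝒜 μ) : ‖translateHom 𝒜 μ t k‖ = ‖k‖ := by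
  have hΔ := (modular_pos t).ne'
  rw [Kernel.norm_def, Kernel.norm_def]
  congr 1
  have e : ∀ r s, ‖(translateHom 𝒜 μ t k).app r s‖ ^ 2 =
      modular t ^ 2 * ‖k.app (r * t) (s * t)‖ ^ 2 := fun r s => by
    change ‖(k.translate t).app r s‖ ^ 2 = _
    rw [Kernel.translate_app, norm_smul, LinearIsometryEquiv.norm_map, mul_pow, Complex.norm_real,
      Real.norm_of_nonneg (modular_pos t).le]
  simp_rw [e, integral_const_mul]
  have h1 : ∀ r, ∫ s, ‖k.app r (s * t)‖ ^ 2 ∂μ = (modular t)⁻¹ * ∫ s, ‖k.app r s‖ ^ 2 ∂μ := by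
    intro r
    obtain ⟨K, hK, h0⟩ := k.exists_compact
    exact integral_mul_right_modular μ (f := fun s => ‖k.app r s‖ ^ 2)
      ((k.normFn.continuous.comp (Continuous.prodMk continuous_const continuous_id)).pow 2)
      (HasCompactSupport.intro hK fun u hu => by simp [h0 _ _ (Or.inr hu)]) t
  simp_rw [h1, integral_const_mul]
  have h2 := integral_mul_right_modular μ (f := fun r => ∫ s, ‖k.app r s‖ ^ 2 ∂μ)
    (by simpa [Kernel.normFn_apply, ← pow_two] using
      continuous_cc_integral (μ := μ) (k.normFn * k.normFn))
    (by simpa [Kernel.normFn_apply, ← pow_two] using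
      hasCompactSupport_cc_integral (μ := μ) (k.normFn * k.normFn)) t
  rw [h2, smul_eq_mul]
  field_simp

variable (𝒜 μ) in
/-- `β_t` as a `*`-homomorphism of `HS(𝒜)`, extended by continuity. -/
def actionHS (t : G) : HS 𝒜 μ →⋆ₙₐ[ℂ] HS 𝒜 μ :=
  StarCompletion.map (translateHom 𝒜 μ t) fun k => (norm_translateHom t k).le

lemma norm_actionHS_le (t : G) (x : HS 𝒜 μ) : ‖actionHS 𝒜 μ t x‖ ≤ ‖x‖ :=
  StarCompletion.norm_map_le _ _ x

variable (𝒜 μ) in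
/-- The canonical action `β` of `G` on the `C*`-algebra of kernels `k(𝒜)`. -/
def action (t : G) : KernelAlgebra 𝒜 μ →⋆ₙₐ[ℂ] KernelAlgebra 𝒜 μ :=
  envelopeMap (actionHS 𝒜 μ t) (norm_actionHS_le t)

lemma action_toAlgebra (t : G) (k : Kernel 𝒜 μ) :
    action 𝒜 μ t k.toAlgebra = (k.translate t).toAlgebra := by
  refine (envelopeMap_toEnvelope (actionHS 𝒜 μ t) (norm_actionHS_le t) (.of k)).trans ?_
  exact congrArg toEnvelope (StarCompletion.map_of (translateHom 𝒜 μ t) _ k)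

end Action

/-! ### The Hilbert modules `L²_t(𝒜)` -/

section HilbertModules

variable {G : Type u} [Group G] [TopologicalSpace G] [IsTopologicalGroup G]

/-- The right translation `r ↦ r t`. -/
def transMap (t : G) : C(G, G) := ⟨fun r => r * t, by fun_prop⟩

variable (𝒜 : FellBundle.{u, v} G) [MeasurableSpace G]

/-- The space `C_c^t(𝒜)` of compactly supported continuous maps `ξ : G → 𝒜` with
`ξ r ∈ A_{r t}`. -/
def CcT (_μ : Measure G) (t : G) : Type (max u v) := 𝒜.Cc (transMap t)

namespace CcT

variable {𝒜} {μ : Measure G} {t : G}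

instance : AddCommGroup (CcT 𝒜 μ t) := inferInstanceAs (AddCommGroup (𝒜.Cc (transMap t)))
instance : Module ℂ (CcT 𝒜 μ t) := inferInstanceAs (Module ℂ (𝒜.Cc (transMap t)))

/-- The value `ξ r ∈ A_{r t}`. -/
def app (ξ : CcT 𝒜 μ t) (r : G) : 𝒜.Fiber (r * t) := ξ.1 r

@[ext] lemma ext {ξ η : CcT 𝒜 μ t} (h : ∀ r, ξ.app r = η.app r) : ξ = η :=
  Subtype.ext (funext h)

@[simp] lemma add_app (ξ η : CcT 𝒜 μ t) (r : G) : (ξ + η).app r = ξ.app r + η.app r := rfl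
@[simp] lemma smul_app (c : ℂ) (ξ : CcT 𝒜 μ t) (r : G) : (c • ξ).app r = c • ξ.app r := rfl

lemma continuous_app (ξ : CcT 𝒜 μ t) : Continuous fun r => (ξ.app r).val := ξ.2.1

lemma exists_compact (ξ : CcT 𝒜 μ t) : ∃ K : Set G, IsCompact K ∧ ∀ r, r ∉ K → ξ.app r = 0 := by
  refine ⟨tsupport fun r => ‖ξ.app r‖, ξ.2.2, fun r hr => ?_⟩
  by_contra h0
  exact hr (subset_closure (by simpa using h0))

/-- Constructor for elements of `C_c^t(𝒜)`. -/
def mk' (f : ∀ r : G, 𝒜.Fiber (r * t)) (hf : Continuous fun r => (f r).val)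
    (hK : ∃ K : Set G, IsCompact K ∧ ∀ r, r ∉ K → f r = 0) : CcT 𝒜 μ t :=
  ⟨f, hf, by
    obtain ⟨K, hK, h0⟩ := hK
    exact HasCompactSupport.intro hK fun r hr => (congrArg norm (h0 r hr)).trans norm_zero⟩

/-- The right action `(ξ a) r = ξ r a` of `A_e`. -/
def rsmul (ξ : CcT 𝒜 μ t) (a : 𝒜.Fiber 1) : CcT 𝒜 μ t :=
  mk' (fun r => mulL (mul_one _) (ξ.app r) a)
    (𝒜.continuous_mul_tot.comp (Continuous.prodMk ξ.continuous_app continuous_const)) (by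
      obtain ⟨K, hK, h0⟩ := ξ.exists_compact
      exact ⟨K, hK, fun r hr => by simp [h0 r hr]⟩)

lemma rsmul_app (ξ : CcT 𝒜 μ t) (a : 𝒜.Fiber 1) (r : G) :
    (ξ.rsmul a).app r = mulL (mul_one _) (ξ.app r) a := rfl

/-- The `A_e`-valued inner product `⟪ξ, η⟫ = ∫ ξ(r)* η(r) dr`. -/
def inner (ξ η : CcT 𝒜 μ t) : 𝒜.Fiber 1 :=
  ∫ r, mulL (inv_mul_cancel (r * t)) (starL rfl (ξ.app r)) (η.app r) ∂μ

variable [T2Space G] [BorelSpace G] [IsFiniteMeasureOnCompacts μ]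

lemma integrable_inner (ξ η : CcT 𝒜 μ t) :
    Integrable (fun r => mulL (inv_mul_cancel (r * t)) (starL rfl (ξ.app r)) (η.app r)) μ := by
  obtain ⟨K, hK, h0⟩ := ξ.exists_compact
  refine integrable_section ?_ hK fun y hy => ?_
  · exact 𝒜.continuous_mul_tot.comp
      (Continuous.prodMk (𝒜.continuous_star_tot.comp ξ.continuous_app) η.continuous_app)
  · rw [h0 _ hy, map_zero, map_zero, zero_apply]

/-- The right `A_e`-module `C_c^t(𝒜)` with its inner product. -/
def core : InnerCore (𝒜.Fiber 1) (CcT 𝒜 μ t) where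
  rsmul := LinearMap.mk₂ ℂ rsmul
    (fun ξ η a => by ext1 r; simp only [rsmul_app, add_app, map_add, add_apply])
    (fun c ξ a => by ext1 r; simp only [rsmul_app, smul_app, map_smul, smul_apply])
    (fun ξ a b => by ext1 r; simp only [rsmul_app, add_app, map_add])
    (fun c ξ a => by ext1 r; simp only [rsmul_app, smul_app, map_smul])
  inner := LinearMap.mk₂'ₛₗ (starRingEnd ℂ) (RingHom.id ℂ) inner
    (fun ξ η ζ => by
      simp only [inner, add_app, map_add, add_apply]
      exact integral_add (integrable_inner ξ ζ) (integrable_inner η ζ))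
    (fun c ξ η => by
      simp only [inner, smul_app, map_smulₛₗ, smul_apply, integral_smul, RingHom.id_apply])
    (fun ξ η ζ => by
      simp only [inner, add_app, map_add]
      exact integral_add (integrable_inner ξ η) (integrable_inner ξ ζ))
    (fun c ξ η => by
      simp only [inner, smul_app, map_smul, integral_smul, RingHom.id_apply])
  rsmul_rsmul ξ a b := by
    ext1 r
    exact BundleFiber.ext (mul_assoc _ _ _)
  inner_rsmul ξ η a := by
    change inner ξ (η.rsmul a) = inner ξ η * a
    rw [fiber_mul_def]
    refine Eq.trans ?_ (((mulL (𝒜 := 𝒜) (mul_one (1 : G))).flip a).integral_comp_comm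
      (integrable_inner ξ η))
    refine integral_congr_ae (ae_of_all _ fun r => ?_)
    exact BundleFiber.ext (mul_assoc _ _ _).symm
  star_inner ξ η := by
    change star (inner ξ η) = inner η ξ
    rw [fiber_star_def]
    refine ((Kernel.starR (𝒜 := 𝒜) (inv_one (G := G))).integral_comp_comm
      (integrable_inner ξ η)).symm.trans ?_
    refine integral_congr_ae (ae_of_all _ fun r => ?_)
    refine BundleFiber.ext ?_
    change star (star (ξ.app r).val * (η.app r).val) = star (η.app r).val * (ξ.app r).val
    rw [star_mul, star_star]
  inner_self_pos ξ := by
    let _ := CStarAlgebra.spectralOrder (𝒜.Fiber 1)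
    let _ := CStarAlgebra.spectralOrderedRing (𝒜.Fiber 1)
    change ∃ c, inner ξ ξ = star c * c
    rw [← CStarAlgebra.nonneg_iff_eq_star_mul_self]
    refine integral_nonneg fun r => ?_
    obtain ⟨c, hc⟩ := 𝒜.fib_star_mul_self_pos (ξ.app r)
    have : mulL (inv_mul_cancel (r * t)) (starL rfl (ξ.app r)) (ξ.app r) = star c * c :=
      BundleFiber.ext hc
    rw [Pi.zero_apply, this]
    exact star_mul_self_nonneg c

instance : SeminormedAddCommGroup (CcT 𝒜 μ t) := core.toSeminormedAddCommGroup

lemma norm_def (ξ : CcT 𝒜 μ t) : ‖ξ‖ = √‖inner ξ ξ‖ := rfl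

instance : NormedSpace ℂ (CcT 𝒜 μ t) where
  norm_smul_le c ξ := by
    have h : inner (c • ξ) (c • ξ) = (star c * c) • inner ξ ξ := by
      change core.inner (c • ξ) (c • ξ) = (star c * c) • core.inner ξ ξ
      rw [map_smul, LinearMap.map_smulₛₗ, LinearMap.smul_apply, smul_smul, mul_comm]
      rfl
    rw [norm_def, norm_def, h, norm_smul, CStarRing.norm_star_mul_self,
      Real.sqrt_mul (mul_self_nonneg _), Real.sqrt_mul_self (norm_nonneg _)]

instance : PreHilbertModule (𝒜.Fiber 1) (CcT 𝒜 μ t) where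
  __ := core
  norm_sq := core.nrm_sq

end CcT

variable (μ : Measure G) [T2Space G] [BorelSpace G] [IsFiniteMeasureOnCompacts μ]

/-- The Hilbert `A_e`-module `L²_t(𝒜)`, the completion of `C_c^t(𝒜)`; `L²(𝒜)` is
`L²_e(𝒜)`. -/
abbrev L2 (t : G) : Type (max u v) := UniformSpace.Completion (CcT 𝒜 μ t)

/-- The `C*`-algebra `I_t(𝒜) = 𝒦(L²_t(𝒜))` of compact operators; `I(𝒜)` is `I_e(𝒜)`. -/
abbrev compactIdeal (t : G) : Type (max u v) :=
  PreHilbertModule.CompactOp (𝒜.Fiber 1) (L2 𝒜 μ t)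

variable {𝒜 μ}

/-- The kernel `⟨ξ, η⟩_l^t (r, s) = ξ(r) η(s)*` for `ξ, η ∈ C_c^t(𝒜)`. -/
def CcT.kernel {t : G} (ξ η : CcT 𝒜 μ t) : Kernel 𝒜 μ :=
  .mk' (fun r s => mulL (by group : r * t * (s * t)⁻¹ = r * s⁻¹) (ξ.app r) (starL rfl (η.app s)))
    (𝒜.continuous_mul_tot.comp (Continuous.prodMk (ξ.continuous_app.comp continuous_fst)
      (𝒜.continuous_star_tot.comp (η.continuous_app.comp continuous_snd)))) (by
      obtain ⟨K, hK, h0⟩ := ξ.exists_compact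
      obtain ⟨L, hL, h0'⟩ := η.exists_compact
      refine ⟨K ∪ L, hK.union hL, fun r s h => ?_⟩
      rcases h with h | h
      · simp [h0 r fun h' => h (Or.inl h')]
      · simp [h0' s fun h' => h (Or.inr h')])

/-- The map `ρ_t : C_c(𝒜) → C_c^t(𝒜)`, `ρ_t(ξ) r = Δ(t) ^ (1 / 2) ξ (r t)`. -/
def CcT.rho [LocallyCompactSpace G] (t : G) (ξ : CcT 𝒜 μ 1) : CcT 𝒜 μ t :=
  .mk' (fun r => (√(modular t) : ℂ) • Fiber.cast (mul_one (r * t)) (ξ.app (r * t)))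
    (by
      have h : Continuous fun r => (ξ.app (r * t)).val :=
        ξ.continuous_app.comp (continuous_mul_const t)
      refine continuous_iff_continuousAt.2 fun r => ?_
      exact tendsto_smul (φ := fun r => r * t)
        (f := fun r => Fiber.cast (mul_one (r * t)) (ξ.app (r * t)))
        (a := Fiber.cast (mul_one (r * t)) (ξ.app (r * t))) _ (h.tendsto r))
    (by
      obtain ⟨K, hK, h0⟩ := ξ.exists_compact
      refine ⟨(fun r => r * t⁻¹) '' K, hK.image (continuous_mul_const _), fun r h => ?_⟩
      rw [h0, map_zero, smul_zero]
      exact fun h' => h ⟨_, h', by group⟩)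

end HilbertModules

end FellBundle

end

noncomputable section

set_option linter.unusedSectionVars false

/-! ### Norm estimates by iterated squaring -/

/-! The whole theorem rests on one norm equality: for a kernel `k` in the span of the kernels
`ξ(r)η(s)*` with `ξ, η ∈ C_c^t(𝒜)`, the norm of `k` in the enveloping `C*`-algebra is its norm as an
operator on `L²_t(𝒜)` (`norm_toAlgebra_eq`). Once this is known, `θ_{ξ,η} ↦ [ξ(r)η(s)*]` is well
defined and isometric on the dense `*`-algebra of such operators, and `ι_t` is its continuous
extension (`exists_compactIdeal_embedding`).

Lower bound for the `C*`-norm: kernels act on `C_c^t(𝒜)` by integration, the kernel `k*` acts as the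
adjoint, and `‖kξ‖ ≤ ‖k‖₂ ‖ξ‖` (`Kernel.norm_act_le`). So `HS(𝒜)` is represented contractively in
the `C*`-algebra of adjointable operators. By the GNS construction this `C*`-algebra has enough
Hilbert space representations, hence the enveloping norm dominates
(`norm_kernelRep_le_norm_toAlgebra`).

Upper bound: let `k = k*` have finite rank. In the enveloping algebra `‖k‖^(2^n) = ‖k^(2^n)‖`, and
this is at most the Hilbert–Schmidt norm of `k^(2^n) = k l k`. If both outer factors have finite
rank, `l` enters `k l k` only through inner products `⟨η, l ξ'⟩`, so `‖k l k‖₂ ≤ C ‖l‖`, with the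
operator norm on the right and `C` independent of `l` (`exists_norm_mul_mul_le`). Taking `2^n`-th
roots removes `C`. The general case follows from the `C*`-identity applied to `k* k`.

The action: `β_t` sends the kernel of `ξ, η` to the kernel of `ρ_t ξ, ρ_t η`, since the two factors
`Δ(t)^(1/2)` multiply to `Δ(t)` (`translate_kernel`). Thus `β_t ∘ ι_e` and `ι_t ∘ ρ_t^l` agree on
the operators `θ_{ξ,η}`, which determine a `*`-homomorphism (`CompactOp.ext_of_thetaK`). The
equality of the two subalgebras follows because `ρ_t^l` is onto. -/

lemma le_of_pow_two_pow_le {x M C : ℝ} (hM : 0 < M)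
    (h : ∀ n : ℕ, x ^ 2 ^ (n + 2) ≤ C * M ^ 2 ^ (n + 2)) : x ≤ M := by
  -- If `x > M`, the powers of `x / M` eventually exceed `C`. Exponents start at `4` because the
  -- application writes `k ^ 2 ^ m` as `k l k` in an algebra that need not have a unit, so `l` must
  -- be a nonempty product.
  by_contra! hlt
  have hr : 1 < x / M := (one_lt_div hM).2 hlt
  obtain ⟨n, hn⟩ := ((tendsto_pow_atTop_atTop_of_one_lt hr).comp
    ((tendsto_pow_atTop_atTop_of_one_lt (one_lt_two (α := ℕ))).comp
      (tendsto_add_atTop_nat 2))).eventually_gt_atTop C |>.exists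
  have h1 := h n
  simp only [Function.comp_apply, div_pow] at hn
  rw [lt_div_iff₀ (by positivity)] at hn
  exact absurd h1 hn.not_ge

/-- If `a n ^ 2 ≤ c * a (n + 1)` and `a n` grows at most like `M ^ 2 ^ n`, then `a 0 ≤ c * M`. -/
lemma le_mul_of_sq_le_of_le_pow {a : ℕ → ℝ} {c C M : ℝ} (ha : ∀ n, 0 ≤ a n) (hc : 0 ≤ c)
    (hM : 0 ≤ M) (h : ∀ n, a n ^ 2 ≤ c * a (n + 1)) (hb : ∀ n, a n ≤ C * M ^ 2 ^ n) :
    a 0 ≤ c * M := by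
  rcases hc.eq_or_lt with rfl | hc
  · have := h 0
    rw [zero_mul] at this ⊢
    exact (pow_eq_zero_iff two_ne_zero).1 (le_antisymm this (sq_nonneg _)) |>.le
  -- Iterating the hypothesis gives `a 0 ^ 2 ^ n ≤ c ^ (2 ^ n - 1) * a n`. The extra factor `c` on
  -- the left avoids the subtraction in the exponent.
  have hpow : ∀ n, a 0 ^ 2 ^ n * c ≤ c ^ 2 ^ n * a n := by
    intro n
    induction n with
    | zero => simp [mul_comm]
    | succ n ih =>
      have h1 : (a 0 ^ 2 ^ n * c) ^ 2 ≤ (c ^ 2 ^ n * a n) ^ 2 :=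
        pow_le_pow_left₀ (mul_nonneg (pow_nonneg (ha 0) _) hc.le) ih 2
      have h2 : (c ^ 2 ^ n * a n) ^ 2 ≤ c ^ 2 ^ (n + 1) * (c * a (n + 1)) := by
        rw [mul_pow, ← pow_mul, ← pow_succ]
        exact mul_le_mul_of_nonneg_left (h n) (by positivity)
      have h3 : c * (a 0 ^ 2 ^ (n + 1) * c) ≤ c * (c ^ 2 ^ (n + 1) * a (n + 1)) := by
        calc c * (a 0 ^ 2 ^ (n + 1) * c) = (a 0 ^ 2 ^ n * c) ^ 2 := by
              rw [pow_succ 2 n, pow_mul]; ring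
          _ ≤ c ^ 2 ^ (n + 1) * (c * a (n + 1)) := h1.trans h2
          _ = _ := by ring
      exact le_of_mul_le_mul_left h3 hc
  rcases hM.eq_or_lt with rfl | hM
  · have h1 := hb 0
    rw [pow_zero, pow_one, mul_zero] at h1
    rwa [mul_zero]
  refine le_of_pow_two_pow_le (C := C / c) (mul_pos hc hM) fun n => ?_
  rw [div_mul_eq_mul_div, le_div_iff₀ hc]
  refine (hpow (n + 2)).trans ((mul_le_mul_of_nonneg_left (hb (n + 2)) (by positivity)).trans_eq ?_)
  rw [mul_pow]; ring

/-! ### States and Hilbert space representations of `C*`-algebras -/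

section States

variable {B : Type*} [CStarAlgebra B]

/-- Shifting `b` by `it` shifts `φ b` by `it`, while `‖b + it‖² ≤ ‖b‖² + t²`. The quadratic terms in
`t` cancel, so the term linear in `t` would violate the bound unless the imaginary part of `φ b`
vanishes. -/
lemma im_apply_eq_zero_of_isSelfAdjoint {φ : StrongDual ℂ B} (hφ : ‖φ‖ ≤ 1) (h1 : φ 1 = 1)
    {b : B} (hb : IsSelfAdjoint b) : (φ b).im = 0 := by
  have : Nontrivial B := by
    refine ⟨1, 0, fun h => ?_⟩
    rw [h, map_zero] at h1
    exact zero_ne_one h1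
  have key : ∀ t : ℝ, (φ b).re ^ 2 + ((φ b).im + t) ^ 2 ≤ ‖b‖ ^ 2 + t ^ 2 := by
    intro t
    set c : B := b + (t * Complex.I : ℂ) • (1 : B) with hc
    have e1 : φ c = φ b + t * Complex.I := by rw [hc, map_add, map_smul, h1]; simp
    have e2 : star c * c = b * b + ((t ^ 2 : ℝ) : ℂ) • (1 : B) := by
      rw [hc, star_add, star_smul, hb.star_eq, star_one]
      have h1 : star (t * Complex.I : ℂ) = -(t * Complex.I) := by simp
      have h2 : ((t ^ 2 : ℝ) : ℂ) = -((t * Complex.I) * (t * Complex.I)) := by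
        push_cast; linear_combination ((t : ℂ) ^ 2) * Complex.I_mul_I
      rw [h1, h2]
      generalize (t * Complex.I : ℂ) = z
      simp only [add_mul, mul_add, smul_mul_assoc, mul_smul_comm, one_mul, mul_one, smul_add,
        neg_smul, mul_smul, neg_mul, smul_neg]
      abel
    have e3 : ‖c‖ ^ 2 ≤ ‖b‖ ^ 2 + t ^ 2 := by
      rw [pow_two, ← CStarRing.norm_star_mul_self, e2]
      refine (norm_add_le _ _).trans (add_le_add ?_ ?_)
      · rw [pow_two]; exact norm_mul_le _ _
      · rw [norm_smul, CStarRing.norm_one, mul_one, Complex.norm_real,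
          Real.norm_of_nonneg (sq_nonneg t)]
    have e4 : ‖φ c‖ ^ 2 ≤ ‖c‖ ^ 2 := by
      refine pow_le_pow_left₀ (norm_nonneg _) ?_ 2
      exact (φ.le_opNorm c).trans (by nlinarith [norm_nonneg c])
    rw [e1, Complex.sq_norm, Complex.normSq_apply] at e4
    simp at e4
    nlinarith
  by_contra h0
  -- This `t` makes the linear term `2 t Im (φ b)` equal to `‖b‖² + 1`, just above what the bound
  -- allows.
  have := key ((‖b‖ ^ 2 + 1) / (2 * (φ b).im))
  have e : 2 * (φ b).im * ((‖b‖ ^ 2 + 1) / (2 * (φ b).im)) = ‖b‖ ^ 2 + 1 := by field_simp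
  nlinarith [sq_nonneg (φ b).re, sq_nonneg (φ b).im]

variable [PartialOrder B] [StarOrderedRing B]

-- For `b ≥ 0` the element `‖b‖ - b` again has norm at most `‖b‖`. Applying `φ` gives `|‖b‖ - φ b| ≤
-- ‖b‖`, which excludes a negative real part.
open scoped ComplexOrder in
lemma apply_nonneg_of_norm_le_one {φ : StrongDual ℂ B} (hφ : ‖φ‖ ≤ 1) (h1 : φ 1 = 1)
    {b : B} (hb : 0 ≤ b) : 0 ≤ φ b := by
  have him := im_apply_eq_zero_of_isSelfAdjoint hφ h1 (IsSelfAdjoint.of_nonneg hb)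
  have h2 : ‖algebraMap ℝ B ‖b‖ - b‖ ≤ ‖b‖ := by
    refine (CStarAlgebra.norm_le_iff_le_algebraMap _ (norm_nonneg b) ?_).2 ?_
    · exact sub_nonneg.2 (IsSelfAdjoint.of_nonneg hb).le_algebraMap_norm_self
    · exact sub_le_self _ hb
  have h3 : ‖φ (algebraMap ℝ B ‖b‖ - b)‖ ≤ ‖b‖ :=
    (φ.le_opNorm _).trans (by nlinarith [norm_nonneg (algebraMap ℝ B ‖b‖ - b), norm_nonneg φ])
  have h4 : φ (algebraMap ℝ B ‖b‖ - b) = ‖b‖ - φ b := by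
    rw [map_sub, Algebra.algebraMap_eq_smul_one, ← Complex.coe_smul, map_smul, h1]; simp
  rw [h4] at h3
  have h5 := (Complex.re_le_norm _).trans h3
  rw [Complex.sub_re, Complex.ofReal_re] at h5
  rw [Complex.nonneg_iff]
  exact ⟨by linarith, him.symm⟩

open scoped ComplexOrder in
/-- Every positive element of a unital `C*`-algebra is normed by a state. -/
lemma exists_state_apply_eq_norm [Nontrivial B] {a : B} (ha : 0 ≤ a) :
    ∃ f : B →ₚ[ℂ] ℂ, f 1 = 1 ∧ f a = ‖a‖ := by
  have hn : ‖1 + a‖ = 1 + ‖a‖ := by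
    refine le_antisymm ((norm_add_le _ _).trans (by simp)) ?_
    have h := CStarAlgebra.norm_mem_spectrum_of_nonneg ha
    have h2 : 1 + ‖a‖ ∈ spectrum ℝ (1 + a) := by
      have := spectrum.add_mem_add_iff (R := ℝ) (a := a) (r := ‖a‖) (s := (1 : ℝ))
      rw [map_one] at this
      rw [add_comm 1 ‖a‖]
      exact this.2 h
    exact (Real.le_norm_self _).trans (spectrum.norm_le_norm_of_mem h2)
  -- A functional that norms `1 + a` is better than one that norms `a`: from `φ 1 + φ a = 1 + ‖a‖`,
  -- `|φ 1| ≤ 1` and `|φ a| ≤ ‖a‖`, both summands attain their bounds. So `φ` is unital, hence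
  -- positive, and norms `a`.
  obtain ⟨φ, hφ, hφa⟩ := exists_dual_vector'' ℂ (1 + a)
  rw [hn, map_add] at hφa
  have b1 : ‖φ 1‖ ≤ 1 := (φ.le_opNorm 1).trans (by simpa using hφ)
  have b2 : ‖φ a‖ ≤ ‖a‖ := (φ.le_opNorm a).trans (by nlinarith [norm_nonneg a])
  have hre : (φ 1).re + (φ a).re = 1 + ‖a‖ := by simpa using congrArg Complex.re hφa
  have c1 := Complex.re_le_norm (φ 1)
  have c2 := Complex.re_le_norm (φ a)
  have eq_of : ∀ {z : ℂ} {r : ℝ}, ‖z‖ ≤ r → z.re = r → z = r := by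
    intro z r h1 h2
    have h3 : ‖z‖ ^ 2 ≤ r ^ 2 := pow_le_pow_left₀ (norm_nonneg _) h1 2
    rw [Complex.sq_norm, Complex.normSq_apply, h2] at h3
    refine Complex.ext h2 ?_
    have : z.im = 0 := by nlinarith
    simpa using this
  have d1 : φ 1 = 1 := by simpa using eq_of b1 (by linarith)
  have d2 : φ a = ‖a‖ := eq_of b2 (by linarith)
  exact ⟨.mk₀ φ.toLinearMap fun x hx => apply_nonneg_of_norm_le_one hφ d1 hx, d1, d2⟩

end States

open scoped ComplexOrder in
/-- Every element of a unital `C*`-algebra is normed by a representation on a Hilbert space. -/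
lemma exists_rep_norm_le (B : Type u) [CStarAlgebra B] (x : B) :
    ∃ (H : Type u) (_ : NormedAddCommGroup H) (_ : InnerProductSpace ℂ H) (_ : CompleteSpace H)
      (π : B →⋆ₙₐ[ℂ] (H →L[ℂ] H)), ‖x‖ ≤ ‖π x‖ := by
  let _ := CStarAlgebra.spectralOrder B
  let _ := CStarAlgebra.spectralOrderedRing B
  rcases subsingleton_or_nontrivial B with hB | hB
  -- In the zero algebra there is no unital functional, but the norm is zero and any representation
  -- will do.
  · let f : B →ₚ[ℂ] ℂ := 0
    exact ⟨f.GNS, inferInstance, inferInstance, inferInstance, f.gnsNonUnitalStarAlgHom, by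
      rw [Subsingleton.elim x 0]; simp⟩
  -- In the GNS representation of a state that norms `x* x`, the class of `1` is a unit vector `v`
  -- with `‖π(x) v‖² = f (x* x) = ‖x‖²`.
  obtain ⟨f, h1, hf⟩ := exists_state_apply_eq_norm (star_mul_self_nonneg x)
  refine ⟨f.GNS, inferInstance, inferInstance, inferInstance, f.gnsNonUnitalStarAlgHom, ?_⟩
  have n1 : ‖((f.toPreGNS 1 : f.PreGNS) : f.GNS)‖ = 1 := by
    rw [UniformSpace.Completion.norm_coe, PositiveLinearMap.preGNS_norm_def]
    simp [h1]
  have n2 : ‖f.gnsNonUnitalStarAlgHom x (f.toPreGNS 1 : f.PreGNS)‖ = ‖x‖ := by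
    rw [PositiveLinearMap.gnsNonUnitalStarAlgHom_apply_coe, UniformSpace.Completion.norm_coe,
      PositiveLinearMap.preGNS_norm_def]
    simp only [PositiveLinearMap.leftMulMapPreGNS_apply, PositiveLinearMap.ofPreGNS_toPreGNS,
      mul_one]
    rw [hf, Complex.ofReal_re, CStarRing.norm_star_mul_self, Real.sqrt_mul_self (norm_nonneg _)]
  have := (f.gnsNonUnitalStarAlgHom x).le_opNorm (f.toPreGNS 1 : f.PreGNS)
  rwa [n1, n2, mul_one] at this

/-- The norm of the enveloping `C*`-algebra dominates that of every contractive homomorphism to a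
`C*`-algebra. -/
lemma norm_apply_le_norm_toEnvelope {B C : Type u} [NonUnitalNormedRing B] [NormedSpace ℂ B]
    [StarRing B] [CStarAlgebra C] (Φ : B →⋆ₙₐ[ℂ] C) (hΦ : ∀ b, ‖Φ b‖ ≤ ‖b‖) (b : B) :
    ‖Φ b‖ ≤ ‖toEnvelope b‖ := by
  obtain ⟨H, _, _, _, π, hπ⟩ := exists_rep_norm_le C (Φ b)
  -- The representation pulled back along `Φ` is one of those over which the enveloping norm is a
  -- supremum. For this its Hilbert space must lie in the universe of `B`, which is why `C` is taken
  -- there too.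
  let ρ : HilbertRep B :=
    { H := H
      π := π.comp Φ
      norm_le := fun b => (NonUnitalStarAlgHom.norm_apply_le π (Φ b)).trans (hΦ b) }
  exact hπ.trans (RepProduct.norm_comp_le (universalRep B b) ρ)

lemma norm_toEnvelope_le {B : Type u} [NonUnitalNormedRing B] [NormedSpace ℂ B]
    [StarRing B] (b : B) : ‖toEnvelope b‖ ≤ ‖b‖ :=
  RepProduct.norm_le (x := universalRep B b) (norm_nonneg b) fun ρ => ρ.norm_le b

/-! ### Extension of homomorphisms by continuity -/

/-- The source `S` has no norm of its own. Pulling the norm of `C` back along `f` makes `f` a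
uniform embedding up to null vectors, and the hypothesis `h` then says that `g` is contractive.
Injectivity of `f` is therefore not needed. The lemma serves twice: to extend the operator
representation from `k_c(𝒜)` to `HS(𝒜)`, and to define `ι_t`. -/
lemma exists_starAlgHom_extension {S C D : Type*} [NonUnitalRing S] [Module ℂ S] [StarRing S]
    [NonUnitalNormedRing C] [NormedSpace ℂ C] [IsScalarTower ℂ C C] [SMulCommClass ℂ C C]
    [StarRing C] [ContinuousStar C] [NonUnitalCStarAlgebra D]
    (f : S →⋆ₙₐ[ℂ] C) (g : S →⋆ₙₐ[ℂ] D) (hf : DenseRange f) (h : ∀ s, ‖g s‖ ≤ ‖f s‖) :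
    ∃ F : C →⋆ₙₐ[ℂ] D, (∀ s, F (f s) = g s) ∧ Continuous F := by
  let _ : SeminormedAddCommGroup S := SeminormedAddCommGroup.induced S C f
  let _ : NormedSpace ℂ S := NormedSpace.induced ℂ S C (f : S →ₗ[ℂ] C)
  have hn : ∀ s : S, ‖f s‖ = ‖s‖ := fun s => rfl
  let e : S →L[ℂ] C := LinearMap.mkContinuous (f : S →ₗ[ℂ] C) 1 fun s => by
    rw [one_mul]; exact (hn s).le
  let g' : S →L[ℂ] D := LinearMap.mkContinuous (g : S →ₗ[ℂ] D) 1 fun s => by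
    rw [one_mul, ← hn]; exact h s
  have he : IsUniformInducing e :=
    (AddMonoidHomClass.isometry_of_norm e fun s => hn s).isUniformInducing
  have hde : DenseRange e := hf
  let F := g'.extend e
  have hF : ∀ s, F (f s) = g s := fun s => ContinuousLinearMap.extend_eq g' hde he s
  refine ⟨{ toFun := F
            map_smul' := fun c x => map_smul F c x
            map_zero' := map_zero F
            map_add' := map_add F
            map_mul' := fun x y => ?_
            map_star' := fun x => ?_ }, hF, F.continuous⟩
  · refine hf.induction_on₂ (p := fun x y => F (x * y) = F x * F y)
      (isClosed_eq (by fun_prop) (by fun_prop)) (fun x y => ?_) x y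
    rw [← map_mul, hF, hF, hF, map_mul]
  · refine hf.induction_on (p := fun x => F (star x) = star (F x)) x
      (isClosed_eq (by fun_prop) (by fun_prop)) (fun x => ?_)
    rw [← map_star, hF, hF, map_star]

namespace FellBundle

open CompactlySupported PreHilbertModule

/-! ### The action of kernels on `C_c^t(𝒜)` -/

section KernelAction

variable {G : Type u} [Group G] [TopologicalSpace G] [IsTopologicalGroup G]
  [MeasurableSpace G] {𝒜 : FellBundle.{u, v} G} {μ : Measure G} {t : G}

namespace CcT

@[simp] lemma mk'_app (f : ∀ r : G, 𝒜.Fiber (r * t)) (hf hK) (r : G) :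
    (mk' f hf hK : CcT 𝒜 μ t).app r = f r := rfl

/-- The function `r ↦ ‖ξ r‖`. -/
def normFn (ξ : CcT 𝒜 μ t) : C_c(G, ℝ) where
  toFun r := ‖ξ.app r‖
  continuous_toFun := continuous_norm_section (φ := fun r : G => r * t) ξ.continuous_app
  hasCompactSupport' := ξ.2.2

variable [T2Space G] [BorelSpace G] [IsFiniteMeasureOnCompacts μ]

lemma integrable_norm_sq (ξ : CcT 𝒜 μ t) : Integrable (fun r => ‖ξ.app r‖ ^ 2) μ := by
  have := (ξ.normFn * ξ.normFn).continuous.integrable_of_hasCompactSupport (μ := μ)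
    (ξ.normFn * ξ.normFn).hasCompactSupport
  exact this.congr (ae_of_all _ fun r => (pow_two _).symm)

/-- The integral `∫ ‖ξ r‖² dr`. -/
def sqInt (ξ : CcT 𝒜 μ t) : ℝ := ∫ r, ‖ξ.app r‖ ^ 2 ∂μ

lemma sqInt_nonneg (ξ : CcT 𝒜 μ t) : 0 ≤ ξ.sqInt := integral_nonneg fun _ => sq_nonneg _

/-- The norm is moved inside the integral that defines the inner product. There is no converse
estimate in general, so Hilbert–Schmidt bounds in terms of `sqInt` do not directly give bounds for
the module norm. -/
lemma norm_sq_le_sqInt (ξ : CcT 𝒜 μ t) : ‖ξ‖ ^ 2 ≤ ξ.sqInt := by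
  rw [norm_def, Real.sq_sqrt (norm_nonneg _), inner]
  refine norm_integral_le_of_norm_le ξ.integrable_norm_sq (ae_of_all _ fun r => ?_)
  refine (norm_mulL_le _ _ _).trans_eq ?_
  rw [LinearIsometry.norm_map, pow_two]

lemma sqInt_rsmul_le (ξ : CcT 𝒜 μ t) (a : 𝒜.Fiber 1) :
    (ξ.rsmul a).sqInt ≤ ‖a‖ ^ 2 * ξ.sqInt := by
  rw [sqInt, sqInt, ← integral_const_mul]
  refine integral_mono (integrable_norm_sq _) (ξ.integrable_norm_sq.const_mul _) fun r => ?_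
  dsimp only
  rw [rsmul_app, ← mul_pow, mul_comm]
  exact pow_le_pow_left₀ (norm_nonneg _) (norm_mulL_le _ _ _) 2

end CcT

namespace Kernel

variable [T2Space G] [BorelSpace G] [IsFiniteMeasureOnCompacts μ]

/-- The action `(k ξ) r = ∫ k (r, s) ξ(s) ds` of kernels on `C_c^t(𝒜)`. -/
def act (k : Kernel 𝒜 μ) (ξ : CcT 𝒜 μ t) : CcT 𝒜 μ t :=
  .mk' (fun r => ∫ s, mulL (by group : r * s⁻¹ * (s * t) = r * t) (k.app r s) (ξ.app s) ∂μ)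
    (by
      obtain ⟨K, hK, h0⟩ := ξ.exists_compact
      refine continuous_integral_section (φ := fun r : G => r * t) (by fun_prop)
        (F := fun r s => mulL (by group) (k.app r s) (ξ.app s)) ?_ hK ?_
      · exact 𝒜.continuous_mul_tot.comp
          (Continuous.prodMk k.continuous_app (ξ.continuous_app.comp continuous_snd))
      · intro x y hy
        rw [h0 _ hy, map_zero])
    (by
      obtain ⟨K, hK, h0⟩ := k.exists_compact
      refine ⟨K, hK, fun r hr => integral_eq_zero_of_ae (ae_of_all _ fun s => ?_)⟩
      simp [h0 r s (Or.inl hr)])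

lemma act_app (k : Kernel 𝒜 μ) (ξ : CcT 𝒜 μ t) (r : G) : (k.act ξ).app r =
    ∫ s, mulL (by group : r * s⁻¹ * (s * t) = r * t) (k.app r s) (ξ.app s) ∂μ := rfl

lemma continuous_act_app (k : Kernel 𝒜 μ) (ξ : CcT 𝒜 μ t) (r : G) :
    Continuous fun s => (k.app r s).val * (ξ.app s).val :=
  𝒜.continuous_mul_tot.comp (Continuous.prodMk
    (k.continuous_app.comp (Continuous.prodMk continuous_const continuous_id)) ξ.continuous_app)

lemma integrable_act_app (k : Kernel 𝒜 μ) (ξ : CcT 𝒜 μ t) (r : G) {u : G}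
    (h : ∀ s, r * s⁻¹ * (s * t) = u) :
    Integrable (fun s => mulL (h s) (k.app r s) (ξ.app s)) μ := by
  obtain ⟨K, hK, h0⟩ := ξ.exists_compact
  refine integrable_section (continuous_act_app k ξ r) hK fun y hy => ?_
  rw [h0 _ hy, map_zero]

lemma add_act (k l : Kernel 𝒜 μ) (ξ : CcT 𝒜 μ t) : (k + l).act ξ = k.act ξ + l.act ξ := by
  ext1 r
  rw [CcT.add_app, act_app, act_app, act_app, ← integral_add (integrable_act_app _ _ _ _)
    (integrable_act_app _ _ _ _)]
  simp only [add_app, map_add, _root_.add_apply]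

lemma act_add (k : Kernel 𝒜 μ) (ξ η : CcT 𝒜 μ t) : k.act (ξ + η) = k.act ξ + k.act η := by
  ext1 r
  rw [CcT.add_app, act_app, act_app, act_app, ← integral_add (integrable_act_app _ _ _ _)
    (integrable_act_app _ _ _ _)]
  simp only [CcT.add_app, map_add]

lemma smul_act (c : ℂ) (k : Kernel 𝒜 μ) (ξ : CcT 𝒜 μ t) : (c • k).act ξ = c • k.act ξ := by
  ext1 r
  simp only [CcT.smul_app, act_app, smul_app, map_smul, _root_.smul_apply, integral_smul]

lemma act_smul (c : ℂ) (k : Kernel 𝒜 μ) (ξ : CcT 𝒜 μ t) : k.act (c • ξ) = c • k.act ξ := by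
  ext1 r
  simp only [CcT.smul_app, act_app, map_smul, integral_smul]

lemma mul_act (k l : Kernel 𝒜 μ) (ξ : CcT 𝒜 μ t) : (k * l).act ξ = k.act (l.act ξ) := by
  ext1 r
  obtain ⟨K, hK, h0⟩ := k.exists_compact
  obtain ⟨L, hL, h0'⟩ := ξ.exists_compact
  have e1 : ∀ s, mulL (by group : r * s⁻¹ * (s * t) = r * t) ((k * l).app r s) (ξ.app s) =
      ∫ u, mulL (by group : r * s⁻¹ * (s * t) = r * t)
        (mulL (by group) (k.app r u) (l.app u s)) (ξ.app s) ∂μ := fun s => by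
    rw [mul_app]
    exact (((mulL (by group : r * s⁻¹ * (s * t) = r * t)).flip
      (ξ.app s)).integral_comp_comm (integrable_mul_app k l r s fun t => by group)).symm
  have e2 : ∀ u, mulL (by group : r * u⁻¹ * (u * t) = r * t) (k.app r u) ((l.act ξ).app u) =
      ∫ s, mulL (by group : r * u⁻¹ * (u * t) = r * t) (k.app r u)
        (mulL (by group) (l.app u s) (ξ.app s)) ∂μ := fun u => by
    rw [act_app]
    exact ((mulL (by group : r * u⁻¹ * (u * t) = r * t)
      (k.app r u)).integral_comp_comm (integrable_act_app l ξ u fun t => by group)).symm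
  rw [act_app, act_app]
  simp_rw [e1, e2]
  rw [integral_integral_swap_of_hasCompactSupport]
  · refine integral_congr_ae (ae_of_all _ fun u => integral_congr_ae (ae_of_all _ fun s => ?_))
    exact BundleFiber.ext (mul_assoc _ _ _)
  · refine continuous_val_iff.1 ?_
    refine 𝒜.continuous_mul_tot.comp (Continuous.prodMk (𝒜.continuous_mul_tot.comp
      (Continuous.prodMk ?_ ?_)) ?_)
    · exact k.continuous_app.comp (Continuous.prodMk continuous_const continuous_snd)
    · exact l.continuous_app.comp (Continuous.prodMk continuous_snd continuous_fst)
    · exact ξ.continuous_app.comp continuous_fst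
  · refine HasCompactSupport.intro (hL.prod hK) fun x hx => ?_
    rw [Set.mem_prod, not_and_or] at hx
    rcases hx with hx | hx
    · simp [Function.uncurry, h0' x.1 hx]
    · simp [Function.uncurry, h0 r x.2 (Or.inr hx)]

lemma inner_act_left (k : Kernel 𝒜 μ) (ξ η : CcT 𝒜 μ t) :
    CcT.inner (k.act ξ) η = CcT.inner ξ ((star k).act η) := by
  obtain ⟨K, hK, h0⟩ := η.exists_compact
  obtain ⟨L, hL, h0'⟩ := ξ.exists_compact
  have e1 : ∀ r, mulL (inv_mul_cancel (r * t)) (starL rfl ((k.act ξ).app r)) (η.app r) =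
      ∫ s, mulL (inv_mul_cancel (r * t)) (starL rfl
        (mulL (by group : r * s⁻¹ * (s * t) = r * t) (k.app r s) (ξ.app s))) (η.app r) ∂μ :=
    fun r => by
    rw [act_app]
    -- The involution is only conjugate-linear over `ℂ`, so it is moved through the integral as a
    -- bounded real-linear map.
    exact ((((((mulL (inv_mul_cancel (r * t))).flip (η.app r)).restrictScalars ℝ).comp
      (starR rfl))).integral_comp_comm (integrable_act_app k ξ r fun s => by group)).symm
  have e2 : ∀ s, mulL (inv_mul_cancel (s * t)) (starL rfl (ξ.app s)) (((star k).act η).app s) =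
      ∫ r, mulL (inv_mul_cancel (s * t)) (starL rfl (ξ.app s))
        (mulL (by group : s * r⁻¹ * (r * t) = s * t) ((star k).app s r) (η.app r)) ∂μ :=
    fun s => by
    rw [act_app]
    exact ((mulL (inv_mul_cancel (s * t)) (starL rfl (ξ.app s))).integral_comp_comm
      (integrable_act_app (star k) η s fun r => by group)).symm
  rw [CcT.inner, CcT.inner]
  simp_rw [e1, e2]
  rw [integral_integral_swap_of_hasCompactSupport]
  · refine integral_congr_ae (ae_of_all _ fun u => integral_congr_ae (ae_of_all _ fun s => ?_))
    refine BundleFiber.ext ?_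
    change star (_ * _) * _ = star _ * (star _ * _)
    rw [star_mul, mul_assoc]
  · refine continuous_val_iff.1 ?_
    refine 𝒜.continuous_mul_tot.comp (Continuous.prodMk (𝒜.continuous_star_tot.comp
      (𝒜.continuous_mul_tot.comp (Continuous.prodMk k.continuous_app ?_))) ?_)
    · exact ξ.continuous_app.comp continuous_snd
    · exact η.continuous_app.comp continuous_fst
  · refine HasCompactSupport.intro (hK.prod hL) fun x hx => ?_
    rw [Set.mem_prod, not_and_or] at hx
    rcases hx with hx | hx
    · simp [Function.uncurry, h0 x.1 hx]
    · simp [Function.uncurry, h0' x.2 hx]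

lemma sq_norm_act_app_le (k : Kernel 𝒜 μ) (ξ : CcT 𝒜 μ t) (r : G) :
    ‖(k.act ξ).app r‖ ^ 2 ≤ (∫ s, ‖k.app r s‖ ^ 2 ∂μ) * ξ.sqInt := by
  obtain ⟨K, hK, h0⟩ := k.exists_compact
  let f : C_c(G, ℝ) := ⟨⟨fun t => ‖k.app r t‖,
    k.normFn.continuous.comp (Continuous.prodMk continuous_const continuous_id)⟩,
    HasCompactSupport.intro hK fun t ht => by simp [h0 r t (Or.inr ht)]⟩
  have hcs := functional_cauchy_schwarz (integral₁ μ)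
    (fun f hf => integral_nonneg fun t => hf t) f ξ.normFn
  have e1 : integral₁ μ (f * f) = ∫ t, ‖k.app r t‖ ^ 2 ∂μ := by
    simp only [pow_two]; rfl
  have e2 : integral₁ μ (ξ.normFn * ξ.normFn) = ξ.sqInt := by
    simp only [CcT.sqInt, pow_two]; rfl
  rw [e1, e2] at hcs
  refine le_trans (pow_le_pow_left₀ (norm_nonneg _) ?_ 2) hcs
  rw [act_app]
  refine norm_integral_le_of_norm_le ((f * ξ.normFn).continuous.integrable_of_hasCompactSupport
    (f * ξ.normFn).hasCompactSupport) (ae_of_all _ fun t => ?_)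
  exact norm_mulL_le _ _ _

lemma norm_sq_eq_integral (k : Kernel 𝒜 μ) : ‖k‖ ^ 2 = ∫ r, ∫ s, ‖k.app r s‖ ^ 2 ∂μ ∂μ := by
  rw [norm_def, Real.sq_sqrt]
  exact integral_nonneg fun r => integral_nonneg fun s => sq_nonneg _

lemma sqInt_act_le (k : Kernel 𝒜 μ) (ξ : CcT 𝒜 μ t) :
    (k.act ξ).sqInt ≤ ‖k‖ ^ 2 * ξ.sqInt := by
  have hi : Integrable (fun r => ∫ s, ‖k.app r s‖ ^ 2 ∂μ) μ := by
    have := integrable_cc_integral (μ := μ) (k.normFn * k.normFn)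
    simpa [normFn_apply, ← pow_two] using this
  rw [norm_sq_eq_integral, CcT.sqInt, ← integral_mul_const]
  exact integral_mono (CcT.integrable_norm_sq _) (hi.mul_const _) (sq_norm_act_app_le k ξ)

/-- Cauchy–Schwarz for `⟨kξ, kξ⟩ = ⟨ξ, k*kξ⟩`. It plays the part of the `C*`-identity for a single
vector, before boundedness of the action is known. -/
lemma norm_sq_act_le (k : Kernel 𝒜 μ) (ξ : CcT 𝒜 μ t) :
    ‖k.act ξ‖ ^ 2 ≤ ‖ξ‖ * ‖(star k * k).act ξ‖ := by
  have h := CcT.core.norm_inner_le ξ ((star k * k).act ξ)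
  have e : CcT.inner ξ ((star k * k).act ξ) = CcT.inner (k.act ξ) (k.act ξ) := by
    rw [mul_act, ← inner_act_left]
  rw [CcT.norm_def (k.act ξ), Real.sq_sqrt (norm_nonneg _), ← e]
  exact h

/-- The pointwise Cauchy–Schwarz estimate yields only `‖kξ‖ ≤ ‖k‖ √(sqInt ξ)`, with the wrong norm
of `ξ`. Applied to the powers `(k*k)^(2^n)` it still bounds their growth, and the constant `√(sqInt
ξ)` disappears when roots are taken. -/
lemma norm_act_le (k : Kernel 𝒜 μ) (ξ : CcT 𝒜 μ t) : ‖k.act ξ‖ ≤ ‖k‖ * ‖ξ‖ := by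
  -- iterated squares of the selfadjoint kernel `k* k`
  let a : ℕ → Kernel 𝒜 μ := fun n => Nat.rec (star k * k) (fun _ l => l * l) n
  have ha : ∀ n, star (a n) = a n := fun n => by
    induction n with
    | zero => change star (star k * k) = star k * k; simp
    | succ n ih => change star (a n * a n) = a n * a n; rw [star_mul, ih]
  have hn : ∀ n, ‖a n‖ ≤ (‖k‖ ^ 2) ^ 2 ^ n := fun n => by
    induction n with
    | zero =>
      refine (norm_mul_le (star k) k).trans_eq ?_
      rw [norm_star]; ring
    | succ n ih =>
      refine (norm_mul_le (a n) (a n)).trans ?_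
      rw [pow_succ 2 n, pow_mul _ (2 ^ n) 2, pow_two ((‖k‖ ^ 2) ^ 2 ^ n)]
      gcongr
  have key : ‖(star k * k).act ξ‖ ≤ ‖ξ‖ * ‖k‖ ^ 2 := by
    -- Here `c = ‖ξ‖` and `M = ‖k‖²`. The recursion is `norm_sq_act_le` for the selfadjoint kernel
    -- `a n`, because `a (n + 1) = (a n)* (a n)`.
    refine le_mul_of_sq_le_of_le_pow (a := fun n => ‖(a n).act ξ‖) (C := √ξ.sqInt)
      (fun n => norm_nonneg _) (norm_nonneg _) (sq_nonneg _) (fun n => ?_) (fun n => ?_)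
    · have := norm_sq_act_le (a n) ξ
      rwa [ha] at this
    · refine le_of_sq_le_sq ?_ (by positivity)
      calc ‖(a n).act ξ‖ ^ 2 ≤ ((a n).act ξ).sqInt := CcT.norm_sq_le_sqInt _
        _ ≤ ‖a n‖ ^ 2 * ξ.sqInt := sqInt_act_le _ _
        _ ≤ ((‖k‖ ^ 2) ^ 2 ^ n) ^ 2 * ξ.sqInt := by
          gcongr
          · exact ξ.sqInt_nonneg
          · exact hn n
        _ = _ := by rw [mul_pow, Real.sq_sqrt ξ.sqInt_nonneg, mul_comm]
  refine le_of_sq_le_sq ((norm_sq_act_le k ξ).trans ?_) (by positivity)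
  rw [mul_pow]
  nlinarith [norm_nonneg ξ]

/-- The operator on `C_c^t(𝒜)` given by a kernel. -/
def actL (t : G) (k : Kernel 𝒜 μ) : CcT 𝒜 μ t →L[ℂ] CcT 𝒜 μ t :=
  LinearMap.mkContinuous
    { toFun := k.act
      map_add' := act_add k
      map_smul' := fun c ξ => act_smul c k ξ } ‖k‖ (norm_act_le k)

@[simp] lemma actL_apply (k : Kernel 𝒜 μ) (ξ : CcT 𝒜 μ t) : k.actL t ξ = k.act ξ := rfl

end Kernel

variable [T2Space G] [BorelSpace G] [IsFiniteMeasureOnCompacts μ]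

/-! ### Extension of the kernel action to adjointable operators on `L²_t(𝒜)`. -/

lemma L2.innerL_coe (ξ η : CcT 𝒜 μ t) :
    innerL (𝒜.Fiber 1) (ξ : L2 𝒜 μ t) (η : L2 𝒜 μ t) = CcT.inner ξ η :=
  innerCompl_coe (𝒜.Fiber 1) ξ η

lemma L2.rsmulL_coe (ξ : CcT 𝒜 μ t) (a : 𝒜.Fiber 1) :
    rsmulL (𝒜.Fiber 1) (ξ : L2 𝒜 μ t) a = (ξ.rsmul a : CcT 𝒜 μ t) :=
  rsmulCompl_coe (𝒜.Fiber 1) ξ a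

/-- The adjointable operator on `L²_t(𝒜)` given by a kernel. -/
def Kernel.toAdjointable (t : G) (k : Kernel 𝒜 μ) : Adjointable (𝒜.Fiber 1) (L2 𝒜 μ t) :=
  ⟨(k.actL t).completion, ((star k).actL t).completion, fun x y => by
    induction x, y using UniformSpace.Completion.induction_on₂ with
    | hp => exact isClosed_eq (by fun_prop) (by fun_prop)
    | ih x y =>
      simp only [ContinuousLinearMap.completion_apply_coe, Kernel.actL_apply, L2.innerL_coe]
      exact Kernel.inner_act_left k x y⟩

lemma Kernel.toAdjointable_op_coe (k : Kernel 𝒜 μ) (ξ : CcT 𝒜 μ t) :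
    (k.toAdjointable t).op (ξ : L2 𝒜 μ t) = (k.act ξ : CcT 𝒜 μ t) :=
  ContinuousLinearMap.completion_apply_coe (k.actL t) ξ

lemma L2.adjointable_ext {T S : Adjointable (𝒜.Fiber 1) (L2 𝒜 μ t)}
    (h : ∀ ξ : CcT 𝒜 μ t, T.op (ξ : L2 𝒜 μ t) = S.op (ξ : L2 𝒜 μ t)) : T = S :=
  Adjointable.ext_op fun x => by
    induction x using UniformSpace.Completion.induction_on with
    | hp => exact isClosed_eq (by fun_prop) (by fun_prop)
    | ih x => exact h x

lemma L2.star_adjointable_eq {T S : Adjointable (𝒜.Fiber 1) (L2 𝒜 μ t)}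
    (h : ∀ ξ η : CcT 𝒜 μ t, innerL (𝒜.Fiber 1) (T.op (ξ : L2 𝒜 μ t)) (η : L2 𝒜 μ t) =
      innerL (𝒜.Fiber 1) (ξ : L2 𝒜 μ t) (S.op (η : L2 𝒜 μ t))) : star T = S :=
  star_eq_of_inner fun x y => by
    induction x, y using UniformSpace.Completion.induction_on₂ with
    | hp => exact isClosed_eq (by fun_prop) (by fun_prop)
    | ih x y => exact h x y

variable (𝒜 μ t) in
/-- The representation of `k_c(𝒜)` on `L²_t(𝒜)`. -/
def kernelRep : Kernel 𝒜 μ →⋆ₙₐ[ℂ] Adjointable (𝒜.Fiber 1) (L2 𝒜 μ t) where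
  toFun := Kernel.toAdjointable t
  map_smul' c k := L2.adjointable_ext fun ξ => by
    change _ = c • (k.toAdjointable t).op (ξ : L2 𝒜 μ t)
    simp only [Kernel.toAdjointable_op_coe, Kernel.smul_act, UniformSpace.Completion.coe_smul]
  map_zero' := L2.adjointable_ext fun ξ => by
    change _ = (0 : L2 𝒜 μ t)
    have := Kernel.smul_act (0 : ℂ) (0 : Kernel 𝒜 μ) ξ
    rw [zero_smul, zero_smul] at this
    rw [Kernel.toAdjointable_op_coe, this, UniformSpace.Completion.coe_zero]
  map_add' k l := L2.adjointable_ext fun ξ => by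
    change _ = (k.toAdjointable t).op (ξ : L2 𝒜 μ t) + (l.toAdjointable t).op (ξ : L2 𝒜 μ t)
    simp only [Kernel.toAdjointable_op_coe, Kernel.add_act, UniformSpace.Completion.coe_add]
  map_mul' k l := L2.adjointable_ext fun ξ => by
    change _ = (k.toAdjointable t).op ((l.toAdjointable t).op (ξ : L2 𝒜 μ t))
    simp only [Kernel.toAdjointable_op_coe, Kernel.mul_act]
  map_star' k := (L2.star_adjointable_eq fun ξ η => by
    simp only [Kernel.toAdjointable_op_coe, L2.innerL_coe]
    exact Kernel.inner_act_left k ξ η).symm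

lemma kernelRep_op_coe (k : Kernel 𝒜 μ) (ξ : CcT 𝒜 μ t) :
    (kernelRep 𝒜 μ t k).op (ξ : L2 𝒜 μ t) = (k.act ξ : CcT 𝒜 μ t) :=
  k.toAdjointable_op_coe ξ

lemma norm_kernelRep_le (k : Kernel 𝒜 μ) : ‖kernelRep 𝒜 μ t k‖ ≤ ‖k‖ := by
  rw [← Adjointable.norm_op]
  refine ContinuousLinearMap.opNorm_le_bound _ (norm_nonneg _) fun x => ?_
  induction x using UniformSpace.Completion.induction_on with
  | hp => exact isClosed_le (by fun_prop) (by fun_prop)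
  | ih x =>
    rw [kernelRep_op_coe, UniformSpace.Completion.norm_coe, UniformSpace.Completion.norm_coe]
    exact k.norm_act_le x

/-! ### The maps into `HS(𝒜)` and `k(𝒜)`, and the comparison of norms. -/

variable (𝒜 μ) in
/-- The canonical map `k_c(𝒜) → HS(𝒜)` as a `*`-homomorphism. -/
def Kernel.ofHom : Kernel 𝒜 μ →⋆ₙₐ[ℂ] HS 𝒜 μ where
  toFun := StarCompletion.of
  map_smul' c k := map_smul _ c k
  map_zero' := map_zero _
  map_add' := map_add _
  map_mul' := StarCompletion.of_mul
  map_star' := StarCompletion.of_star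

variable (𝒜 μ) in
/-- The canonical map `k_c(𝒜) → k(𝒜)` as a `*`-homomorphism. -/
def Kernel.toAlgebraHom : Kernel 𝒜 μ →⋆ₙₐ[ℂ] KernelAlgebra 𝒜 μ :=
  toEnvelope.comp (Kernel.ofHom 𝒜 μ)

lemma Kernel.toAlgebraHom_apply (k : Kernel 𝒜 μ) : Kernel.toAlgebraHom 𝒜 μ k = k.toAlgebra := rfl

lemma Kernel.norm_toAlgebra_le (k : Kernel 𝒜 μ) : ‖k.toAlgebra‖ ≤ ‖k‖ :=
  (norm_toEnvelope_le _).trans_eq (StarCompletion.norm_of k)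

/-- The `C*`-norm of a kernel dominates its norm as an operator on `L²_t(𝒜)`. -/
lemma norm_kernelRep_le_norm_toAlgebra (k : Kernel 𝒜 μ) :
    ‖kernelRep 𝒜 μ t k‖ ≤ ‖k.toAlgebra‖ := by
  have : ContinuousStar (HS 𝒜 μ) :=
    ⟨(StarCompletion.starCompl : HS 𝒜 μ →L⋆[ℂ] HS 𝒜 μ).continuous⟩
  obtain ⟨Φ, hΦ, hc⟩ := exists_starAlgHom_extension (Kernel.ofHom 𝒜 μ) (kernelRep 𝒜 μ t)
    StarCompletion.denseRange_of fun k =>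
      (norm_kernelRep_le k).trans_eq (StarCompletion.norm_of k).symm
  -- The enveloping algebra is built from representations that carry a contractivity bound, so the
  -- bound has to be passed from kernels to all of `HS(𝒜)`.
  have hle : ∀ b, ‖Φ b‖ ≤ ‖b‖ := fun b =>
    StarCompletion.denseRange_of.induction_on (p := fun b : HS 𝒜 μ => ‖Φ b‖ ≤ ‖b‖) b
      (isClosed_le hc.norm continuous_norm) fun k => by
        refine (congrArg norm (hΦ k)).trans_le ?_
        exact (norm_kernelRep_le k).trans_eq (StarCompletion.norm_of k).symm
  have := norm_apply_le_norm_toEnvelope Φ hle (Kernel.ofHom 𝒜 μ k)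
  rw [hΦ] at this
  exact this

end KernelAction

end FellBundle

/-! ### Density of the rank-one operators -/

namespace PreHilbertModule

section Density

variable {A E : Type*} [NonUnitalCStarAlgebra A] [NormedAddCommGroup E]
  [NormedSpace ℂ E] [PreHilbertModule A E] [CompleteSpace E]

lemma CompactOp.isometry_op : Isometry (CompactOp.op (A := A) (E := E)) :=
  Isometry.of_dist_eq fun _ _ => rfl

lemma continuous_thetaK : Continuous fun p : E × E => thetaK A p.1 p.2 := by
  refine CompactOp.isometry_op.isUniformInducing.isInducing.continuous_iff.2 ?_
  change Continuous fun p : E × E => (rsmulL A p.1).comp (innerL A p.2)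
  fun_prop

/-- A closed subspace of `𝒦(E)` which contains `θ_{x, y}` for all `x`, `y` in a dense set is
everything. -/
lemma CompactOp.mem_of_isClosed {D : Type*} {j : D → E} (hj : DenseRange j)
    {p : Submodule ℂ (CompactOp A E)} (hp : IsClosed (p : Set (CompactOp A E)))
    (h : ∀ x y, thetaK A (j x) (j y) ∈ p) (T : CompactOp A E) : T ∈ p := by
  have h1 : ∀ x y, thetaK A x y ∈ p := fun x y =>
    hj.induction_on₂ (p := fun x y => thetaK A x y ∈ p) (hp.preimage continuous_thetaK) h x y
  -- The span is formed in the algebra of adjointable operators while `p` lives in the subtype of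
  -- compact ones. Membership in `compacts` is therefore carried through the induction as an
  -- existential.
  have h2 : ∀ S ∈ Submodule.span ℂ (Set.range fun q : E × E => theta (A := A) q.1 q.2),
      ∃ hS : S ∈ compacts A E, (⟨S, hS⟩ : CompactOp A E) ∈ p := by
    intro S hS
    induction hS using Submodule.span_induction with
    | mem S hS =>
      obtain ⟨q, rfl⟩ := hS
      exact ⟨_, h1 q.1 q.2⟩
    | zero => exact ⟨zero_mem _, p.zero_mem⟩
    | add x y _ _ hx hy =>
      obtain ⟨hx, hx'⟩ := hx
      obtain ⟨hy, hy'⟩ := hy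
      exact ⟨add_mem hx hy, p.add_mem hx' hy'⟩
    | smul c x _ hx =>
      obtain ⟨hx, hx'⟩ := hx
      exact ⟨SMulMemClass.smul_mem c hx, p.smul_mem c hx'⟩
  -- Density of the finite-rank operators, transferred from the ambient algebra to the subspace
  -- topology of the compact operators.
  have h3 : T ∈ closure {S : CompactOp A E | S.1 ∈ finiteRank A E} := by
    have hT : T.1 ∈ closure (finiteRank A E : Set (Adjointable A E)) := T.2
    refine (closure_subtype (X := Adjointable A E) (p := (· ∈ compacts A E))
      (s := {S | S.1 ∈ finiteRank A E})).2 (closure_mono ?_ hT)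
    intro S hS
    exact ⟨⟨S, (h2 S hS).1⟩, hS, rfl⟩
  refine closure_minimal (fun S hS => ?_) hp h3
  exact (h2 S.1 hS).2

/-- Since `*`-homomorphisms between `C*`-algebras are automatically contractive, the set where `f`
and `g` agree is a closed subspace. This gives both the uniqueness of `ι_t` and the identity `β_t ∘
ι_e = ι_t ∘ ρ_t^l`. -/
lemma CompactOp.ext_of_thetaK {D F : Type*} {j : D → E} (hj : DenseRange j)
    [NonUnitalCStarAlgebra F] {f g : CompactOp A E →⋆ₙₐ[ℂ] F}
    (h : ∀ x y, f (thetaK A (j x) (j y)) = g (thetaK A (j x) (j y))) : f = g := by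
  have hc : ∀ f : CompactOp A E →⋆ₙₐ[ℂ] F, Continuous f := fun f =>
    AddMonoidHomClass.continuous_of_bound f 1 fun x => by
      rw [one_mul]; exact NonUnitalStarAlgHom.norm_apply_le f x
  refine NonUnitalStarAlgHom.ext fun T => ?_
  exact CompactOp.mem_of_isClosed hj
    (p := LinearMap.eqLocus (f : CompactOp A E →ₗ[ℂ] F) (g : CompactOp A E →ₗ[ℂ] F))
    (isClosed_eq (hc f) (hc g)) h T

end Density

end PreHilbertModule

namespace FellBundle

open PreHilbertModule

section RankOne

variable {G : Type u} [Group G] [TopologicalSpace G] [IsTopologicalGroup G]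
  [MeasurableSpace G] [T2Space G] [BorelSpace G] {𝒜 : FellBundle.{u, v} G} {μ : Measure G}
  [IsFiniteMeasureOnCompacts μ] {t : G}

/-! ### Rank-one kernels -/

lemma CcT.kernel_app (ξ η : CcT 𝒜 μ t) (r s : G) : (ξ.kernel η).app r s =
    mulL (by group : r * t * (s * t)⁻¹ = r * s⁻¹) (ξ.app r) (starL rfl (η.app s)) := rfl

lemma CcT.star_kernel (ξ η : CcT 𝒜 μ t) : star (ξ.kernel η) = η.kernel ξ := by
  ext1 r s
  refine BundleFiber.ext ?_
  change star (_ * star _) = _ * star _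
  rw [star_mul, star_star]

/-- By associativity in the bundle, `ξ(r)` comes out of `∫ ξ(r) η(s)* ζ(s) ds`. So rank-one kernels
act as rank-one operators. -/
lemma CcT.kernel_act (ξ η ζ : CcT 𝒜 μ t) :
    (ξ.kernel η).act ζ = ξ.rsmul (CcT.inner η ζ) := by
  ext1 r
  rw [Kernel.act_app, CcT.rsmul_app, CcT.inner]
  refine Eq.trans ?_ ((mulL (mul_one (r * t)) (ξ.app r)).integral_comp_comm
    (CcT.integrable_inner η ζ))
  refine integral_congr_ae (ae_of_all _ fun s => ?_)
  exact BundleFiber.ext (mul_assoc _ _ _)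

/-- The left factor `k` is absorbed into `ξ`. Consequently the span of the rank-one kernels is a
left ideal of `k_c(𝒜)`, and being closed under `*` it is a two-sided one. -/
lemma CcT.mul_kernel (k : Kernel 𝒜 μ) (ξ η : CcT 𝒜 μ t) :
    k * ξ.kernel η = (k.act ξ).kernel η := by
  ext1 r s
  rw [Kernel.mul_app, CcT.kernel_app, Kernel.act_app]
  refine Eq.trans ?_ (((mulL (by group : r * t * (s * t)⁻¹ = r * s⁻¹)).flip
    (starL rfl (η.app s))).integral_comp_comm (k.integrable_act_app ξ r fun s => by group))
  refine integral_congr_ae (ae_of_all _ fun u => ?_)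
  exact BundleFiber.ext (mul_assoc _ _ _).symm

lemma CcT.norm_sq_kernel_le (ξ η : CcT 𝒜 μ t) :
    ‖ξ.kernel η‖ ^ 2 ≤ ξ.sqInt * η.sqInt := by
  have hi : Integrable (fun r => ∫ s, ‖(ξ.kernel η).app r s‖ ^ 2 ∂μ) μ := by
    have := integrable_cc_integral (μ := μ) ((ξ.kernel η).normFn * (ξ.kernel η).normFn)
    simpa [Kernel.normFn_apply, ← pow_two] using this
  have hj : ∀ r, Integrable (fun s => ‖(ξ.kernel η).app r s‖ ^ 2) μ := fun r => by
    have := integrable_cc_right (μ := μ) ((ξ.kernel η).normFn * (ξ.kernel η).normFn) r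
    simpa [Kernel.normFn_apply, ← pow_two] using this
  rw [Kernel.norm_sq_eq_integral, CcT.sqInt, ← integral_mul_const]
  refine integral_mono hi (ξ.integrable_norm_sq.mul_const _) fun r => ?_
  dsimp only
  rw [CcT.sqInt, ← integral_const_mul]
  refine integral_mono (hj r) (η.integrable_norm_sq.const_mul _) fun s => ?_
  dsimp only
  rw [CcT.kernel_app, ← mul_pow]
  refine pow_le_pow_left₀ (norm_nonneg _) ((norm_mulL_le _ _ _).trans_eq ?_) 2
  rw [LinearIsometry.norm_map]

lemma kernelRep_kernel (ξ η : CcT 𝒜 μ t) :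
    kernelRep 𝒜 μ t (ξ.kernel η) = theta (ξ : L2 𝒜 μ t) (η : L2 𝒜 μ t) :=
  L2.adjointable_ext fun ζ => by
    rw [kernelRep_op_coe, theta_op, L2.innerL_coe, L2.rsmulL_coe, CcT.kernel_act]

lemma norm_act_le_kernelRep (k : Kernel 𝒜 μ) (ξ : CcT 𝒜 μ t) :
    ‖k.act ξ‖ ≤ ‖kernelRep 𝒜 μ t k‖ * ‖ξ‖ := by
  have := (kernelRep 𝒜 μ t k).op.le_opNorm (ξ : L2 𝒜 μ t)
  rwa [kernelRep_op_coe, UniformSpace.Completion.norm_coe, UniformSpace.Completion.norm_coe,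
    Adjointable.norm_op] at this

/-! ### Finite-rank kernels and the equality of their `C*`-norm and operator norm. -/

variable (𝒜 μ t) in
/-- The `*`-algebra of finite-rank kernels: the linear span of the kernels `ξ(r) η(s)*` with
`ξ, η ∈ C_c^t(𝒜)`. -/
def finiteRankKernels : NonUnitalStarSubalgebra ℂ (Kernel 𝒜 μ) where
  __ := Submodule.span ℂ (Set.range fun p : CcT 𝒜 μ t × CcT 𝒜 μ t => p.1.kernel p.2)
  mul_mem' := by
    intro k l _ hl
    induction hl using Submodule.span_induction with
    | mem l hl =>
      obtain ⟨p, rfl⟩ := hl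
      rw [CcT.mul_kernel]
      exact Submodule.subset_span ⟨(k.act p.1, p.2), rfl⟩
    | zero => rw [mul_zero]; exact Submodule.zero_mem _
    | add x y _ _ hx hy => rw [mul_add]; exact Submodule.add_mem _ hx hy
    | smul c x _ hx => rw [mul_smul_comm]; exact Submodule.smul_mem _ _ hx
  star_mem' := by
    intro l hl
    induction hl using Submodule.span_induction with
    | mem l hl =>
      obtain ⟨p, rfl⟩ := hl
      rw [CcT.star_kernel]
      exact Submodule.subset_span ⟨(p.2, p.1), rfl⟩
    | zero => rw [star_zero]; exact Submodule.zero_mem _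
    | add x y _ _ hx hy => rw [star_add]; exact Submodule.add_mem _ hx hy
    | smul c x _ hx => rw [star_smul]; exact Submodule.smul_mem _ _ hx

lemma kernel_mem_finiteRankKernels (ξ η : CcT 𝒜 μ t) : ξ.kernel η ∈ finiteRankKernels 𝒜 μ t :=
  Submodule.subset_span ⟨(ξ, η), rfl⟩

lemma finiteRankKernels_induction {P : Kernel 𝒜 μ → Prop} {k : Kernel 𝒜 μ}
    (hk : k ∈ finiteRankKernels 𝒜 μ t) (mem : ∀ ξ η : CcT 𝒜 μ t, P (ξ.kernel η))
    (zero : P 0) (add : ∀ k l, P k → P l → P (k + l)) (smul : ∀ (c : ℂ) k, P k → P (c • k)) :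
    P k := by
  change k ∈ Submodule.span ℂ _ at hk
  induction hk using Submodule.span_induction with
  | mem l hl =>
    obtain ⟨p, rfl⟩ := hl
    exact mem p.1 p.2
  | zero => exact zero
  | add x y _ _ hx hy => exact add x y hx hy
  | smul c x _ hx => exact smul c x hx

/-- The product collapses to the rank-one kernel of `ξ a` and `η'`, where `a = ⟨η, l ξ'⟩ ∈ A_e`. All
dependence on `l` sits in `a`, and `‖a‖` is controlled by the operator norm of `l`. This is how a
Hilbert–Schmidt norm comes to be bounded by an operator norm. -/
lemma CcT.norm_kernel_mul_mul_kernel_le (ξ η ξ' η' : CcT 𝒜 μ t) (l : Kernel 𝒜 μ) :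
    ‖ξ.kernel η * l * ξ'.kernel η'‖ ≤
      (√(ξ.sqInt * η'.sqInt) * ‖η‖ * ‖ξ'‖) * ‖kernelRep 𝒜 μ t l‖ := by
  rw [CcT.mul_kernel, Kernel.mul_act, CcT.kernel_act]
  set a := CcT.inner η (l.act ξ') with ha
  have h1 : ‖a‖ ≤ ‖η‖ * (‖kernelRep 𝒜 μ t l‖ * ‖ξ'‖) := by
    have h := CcT.core.norm_inner_le η (l.act ξ')
    exact h.trans (mul_le_mul_of_nonneg_left (norm_act_le_kernelRep l ξ') (norm_nonneg η))
  have h2 : ‖(ξ.rsmul a).kernel η'‖ ≤ √(ξ.sqInt * η'.sqInt) * ‖a‖ := by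
    refine le_of_sq_le_sq ?_ (by positivity)
    rw [mul_pow, Real.sq_sqrt (mul_nonneg ξ.sqInt_nonneg η'.sqInt_nonneg)]
    refine (CcT.norm_sq_kernel_le _ _).trans ?_
    nlinarith [mul_le_mul_of_nonneg_right (ξ.sqInt_rsmul_le a) η'.sqInt_nonneg]
  refine h2.trans ((mul_le_mul_of_nonneg_left h1 (Real.sqrt_nonneg _)).trans_eq ?_)
  ring

/-- The Hilbert–Schmidt norm of `k l k'`, where `k` and `k'` have finite rank, is controlled by the
operator norm of `l`. -/
lemma exists_norm_mul_mul_le {k k' : Kernel 𝒜 μ} (hk : k ∈ finiteRankKernels 𝒜 μ t)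
    (hk' : k' ∈ finiteRankKernels 𝒜 μ t) :
    ∃ C, ∀ l : Kernel 𝒜 μ, ‖k * l * k'‖ ≤ C * ‖kernelRep 𝒜 μ t l‖ := by
  refine finiteRankKernels_induction (t := t)
    (P := fun k => ∃ C, ∀ l : Kernel 𝒜 μ, ‖k * l * k'‖ ≤ C * ‖kernelRep 𝒜 μ t l‖) hk
    (fun ξ η => ?_) ⟨0, fun l => by simp⟩ ?_ ?_
  · refine finiteRankKernels_induction (t := t) (P := fun k' => ∃ C, ∀ l : Kernel 𝒜 μ,
      ‖ξ.kernel η * l * k'‖ ≤ C * ‖kernelRep 𝒜 μ t l‖) hk'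
      (fun ξ' η' => ⟨_, CcT.norm_kernel_mul_mul_kernel_le ξ η ξ' η'⟩) ⟨0, fun l => by simp⟩ ?_ ?_
    · rintro k₁ k₂ ⟨C₁, h₁⟩ ⟨C₂, h₂⟩
      refine ⟨C₁ + C₂, fun l => ?_⟩
      rw [mul_add, add_mul]
      exact (norm_add_le _ _).trans (add_le_add (h₁ l) (h₂ l))
    · rintro c k₁ ⟨C₁, h₁⟩
      refine ⟨‖c‖ * C₁, fun l => ?_⟩
      rw [mul_smul_comm, norm_smul, mul_assoc ‖c‖]
      exact mul_le_mul_of_nonneg_left (h₁ l) (norm_nonneg c)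
  · rintro k₁ k₂ ⟨C₁, h₁⟩ ⟨C₂, h₂⟩
    refine ⟨C₁ + C₂, fun l => ?_⟩
    rw [add_mul k₁, add_mul _ _ k', add_mul]
    exact (norm_add_le _ _).trans (add_le_add (h₁ l) (h₂ l))
  · rintro c k₁ ⟨C₁, h₁⟩
    refine ⟨‖c‖ * C₁, fun l => ?_⟩
    rw [smul_mul_assoc, smul_mul_assoc, norm_smul, mul_assoc ‖c‖]
    exact mul_le_mul_of_nonneg_left (h₁ l) (norm_nonneg c)

/-- A spectral radius argument. The `C*`-norm is multiplicative along repeated squares of `k`, while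
`k^(2^m) = k l k` has Hilbert–Schmidt norm at most a constant times the operator norm of `l`, a
power of `k`. -/
lemma norm_toAlgebra_le_of_isSelfAdjoint {k : Kernel 𝒜 μ} (hk : k ∈ finiteRankKernels 𝒜 μ t)
    (hs : star k = k) : ‖k.toAlgebra‖ ≤ ‖kernelRep 𝒜 μ t k‖ := by
  -- A strict upper bound `M` replaces the operator norm, so that division by `M ^ 2` is allowed
  -- even if that norm is zero.
  refine le_of_forall_gt_imp_ge_of_dense fun M hM => ?_
  have hM0 : 0 < M := (norm_nonneg _).trans_lt hM
  obtain ⟨C, hC⟩ := exists_norm_mul_mul_le hk hk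
  let a : ℕ → Kernel 𝒜 μ := fun n => Nat.rec k (fun _ l => l * l) n
  have hsucc : ∀ n, a (n + 1) = a n * a n := fun n => rfl
  have ha : ∀ n, star (a n) = a n := fun n => by
    induction n with
    | zero => exact hs
    | succ n ih => rw [hsucc, star_mul, ih]
  have hpow : ∀ n, ‖(a n).toAlgebra‖ = ‖k.toAlgebra‖ ^ 2 ^ n := fun n => by
    induction n with
    | zero => rw [pow_zero, pow_one]; rfl
    | succ n ih =>
      have h1 : star (a n).toAlgebra = (a n).toAlgebra := by
        simp only [← Kernel.toAlgebraHom_apply, ← map_star, ha]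
      have h2 : (a (n + 1)).toAlgebra = star (a n).toAlgebra * (a n).toAlgebra := by
        rw [h1, hsucc]
        simp only [← Kernel.toAlgebraHom_apply, map_mul]
      rw [h2, CStarRing.norm_star_mul_self, ih, pow_succ 2 n, pow_mul _ (2 ^ n) 2, pow_two]
  -- Here `l` is `k^(2^(n+2) - 2)`. The factor `M ^ 2` on the left makes up for the two powers of
  -- `k` split off. The successor step uses `(k l k)(k l k) = k (l k k l) k`.
  have hmid : ∀ n, ∃ l, a (n + 2) = k * l * k ∧
      ‖kernelRep 𝒜 μ t l‖ * M ^ 2 ≤ M ^ 2 ^ (n + 2) := fun n => by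
    induction n with
    | zero =>
      refine ⟨k * k, ?_, ?_⟩
      · change k * k * (k * k) = _
        simp only [mul_assoc]
      · rw [map_mul]
        have h1 : ‖kernelRep 𝒜 μ t k * kernelRep 𝒜 μ t k‖ ≤ M * M :=
          (norm_mul_le _ _).trans (mul_le_mul hM.le hM.le (norm_nonneg _) hM0.le)
        calc _ ≤ M * M * M ^ 2 := mul_le_mul_of_nonneg_right h1 (sq_nonneg M)
          _ = _ := by ring
    | succ n ih =>
      obtain ⟨l, hl, hn⟩ := ih
      refine ⟨l * k * (k * l), ?_, ?_⟩
      · rw [hsucc (n + 2), hl]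
        simp only [mul_assoc]
      · rw [map_mul, map_mul, map_mul]
        set L := kernelRep 𝒜 μ t l
        set K := kernelRep 𝒜 μ t k
        have h1 : ‖L * K * (K * L)‖ ≤ ‖L‖ * M * (M * ‖L‖) := by
          refine (norm_mul_le _ _).trans (mul_le_mul ((norm_mul_le _ _).trans ?_)
            ((norm_mul_le _ _).trans ?_) (norm_nonneg _) (by positivity))
          · exact mul_le_mul_of_nonneg_left hM.le (norm_nonneg _)
          · exact mul_le_mul_of_nonneg_right hM.le (norm_nonneg _)
        calc ‖L * K * (K * L)‖ * M ^ 2 ≤ ‖L‖ * M * (M * ‖L‖) * M ^ 2 :=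
              mul_le_mul_of_nonneg_right h1 (sq_nonneg M)
          _ = (‖L‖ * M ^ 2) ^ 2 := by ring
          _ ≤ (M ^ 2 ^ (n + 2)) ^ 2 := pow_le_pow_left₀ (by positivity) hn 2
          _ = _ := by rw [← pow_mul, ← pow_succ]
  -- `C` comes from an existence statement without a sign, hence the absolute value; the divisor `M
  -- ^ 2` is the loss recorded in `hmid`.
  refine le_of_pow_two_pow_le (C := |C| / M ^ 2) hM0 fun n => ?_
  obtain ⟨l, hl, hn⟩ := hmid n
  rw [← hpow, hl, div_mul_eq_mul_div, le_div_iff₀ (by positivity)]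
  have h1 : ‖(k * l * k).toAlgebra‖ ≤ |C| * ‖kernelRep 𝒜 μ t l‖ :=
    ((Kernel.norm_toAlgebra_le _).trans (hC l)).trans
      (mul_le_mul_of_nonneg_right (le_abs_self C) (norm_nonneg _))
  calc _ ≤ |C| * ‖kernelRep 𝒜 μ t l‖ * M ^ 2 := mul_le_mul_of_nonneg_right h1 (sq_nonneg M)
    _ = |C| * (‖kernelRep 𝒜 μ t l‖ * M ^ 2) := by ring
    _ ≤ _ := mul_le_mul_of_nonneg_left hn (abs_nonneg C)

/-- For kernels of finite rank the `C*`-norm is the operator norm. -/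
lemma norm_toAlgebra_eq {k : Kernel 𝒜 μ} (hk : k ∈ finiteRankKernels 𝒜 μ t) :
    ‖k.toAlgebra‖ = ‖kernelRep 𝒜 μ t k‖ := by
  refine le_antisymm ?_ (norm_kernelRep_le_norm_toAlgebra k)
  refine le_of_sq_le_sq ?_ (norm_nonneg _)
  -- The `C*`-identity on both sides turns the inequality for `k* k` into the one for squares of
  -- norms.
  have h := norm_toAlgebra_le_of_isSelfAdjoint (k := star k * k)
    (mul_mem (star_mem hk) hk) (by rw [star_mul, star_star])
  rw [map_mul, map_star, CStarRing.norm_star_mul_self, ← Kernel.toAlgebraHom_apply, map_mul,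
    map_star, CStarRing.norm_star_mul_self] at h
  rw [pow_two, pow_two]
  exact h

/-! ### The embedding of the compact operators -/

variable (𝒜 μ t) in
/-- The representation of the kernels of finite rank by compact operators on `L²_t(𝒜)`. -/
def finiteRankRep : finiteRankKernels 𝒜 μ t →⋆ₙₐ[ℂ] compactIdeal 𝒜 μ t :=
  NonUnitalStarAlgHom.codRestrict
    ((kernelRep 𝒜 μ t).comp (NonUnitalStarSubalgebraClass.subtype (finiteRankKernels 𝒜 μ t)))
    (compacts (𝒜.Fiber 1) (L2 𝒜 μ t)) fun k => by
      refine finiteRankKernels_induction (t := t)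
        (P := fun k => kernelRep 𝒜 μ t k ∈ compacts (𝒜.Fiber 1) (L2 𝒜 μ t)) k.2
        (fun ξ η => ?_) ?_ (fun k l hk hl => ?_) (fun c k hk => ?_)
      · rw [kernelRep_kernel]
        exact (thetaK (𝒜.Fiber 1) (ξ : L2 𝒜 μ t) (η : L2 𝒜 μ t)).2
      · rw [map_zero]; exact zero_mem _
      · rw [map_add]; exact add_mem hk hl
      · rw [map_smul]; exact SMulMemClass.smul_mem c hk

lemma finiteRankRep_kernel (ξ η : CcT 𝒜 μ t) :
    finiteRankRep 𝒜 μ t ⟨ξ.kernel η, kernel_mem_finiteRankKernels ξ η⟩ =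
      thetaK (𝒜.Fiber 1) (ξ : L2 𝒜 μ t) (η : L2 𝒜 μ t) :=
  Subtype.ext (kernelRep_kernel ξ η)

/-- Kernels supply `θ_{ξ,η}` only for `ξ, η` in the dense subspace `C_c^t(𝒜)`. This suffices because
the closure of the range is a closed subspace. -/
lemma denseRange_finiteRankRep : DenseRange (finiteRankRep 𝒜 μ t) := by
  intro T
  let f : finiteRankKernels 𝒜 μ t →ₗ[ℂ] compactIdeal 𝒜 μ t := finiteRankRep 𝒜 μ t
  have h := CompactOp.mem_of_isClosed (A := 𝒜.Fiber 1) (E := L2 𝒜 μ t)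
    (UniformSpace.Completion.denseRange_coe (α := CcT 𝒜 μ t))
    (p := (LinearMap.range f).topologicalClosure)
    (Submodule.isClosed_topologicalClosure _) (fun ξ η => subset_closure
      ⟨⟨ξ.kernel η, kernel_mem_finiteRankKernels ξ η⟩, finiteRankRep_kernel ξ η⟩) T
  exact h

-- Both halves of `norm_toAlgebra_eq` enter. That the `C*`-norm is at most the operator norm lets
-- the class map factor through the operators and extend continuously; equality then passes to the
-- limit and makes the extension isometric.
variable (𝒜 μ t) in
lemma exists_compactIdeal_embedding : ∃ ι : compactIdeal 𝒜 μ t →⋆ₙₐ[ℂ] KernelAlgebra 𝒜 μ,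
    (∀ ξ η : CcT 𝒜 μ t,
      ι (thetaK (𝒜.Fiber 1) (ξ : L2 𝒜 μ t) (η : L2 𝒜 μ t)) = (ξ.kernel η).toAlgebra) ∧
    ∀ T, ‖ι T‖ = ‖T‖ := by
  have hn : ∀ k : finiteRankKernels 𝒜 μ t, ‖k.1.toAlgebra‖ = ‖finiteRankRep 𝒜 μ t k‖ :=
    fun k => norm_toAlgebra_eq k.2
  obtain ⟨ι, hι, hc⟩ := exists_starAlgHom_extension (finiteRankRep 𝒜 μ t)
    ((Kernel.toAlgebraHom 𝒜 μ).comp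
      (NonUnitalStarSubalgebraClass.subtype (finiteRankKernels 𝒜 μ t)))
    denseRange_finiteRankRep fun k => (hn k).le
  refine ⟨ι, fun ξ η => ?_, fun T => ?_⟩
  · rw [← finiteRankRep_kernel, hι]
    rfl
  · refine denseRange_finiteRankRep.induction_on (p := fun T => ‖ι T‖ = ‖T‖) T
      (isClosed_eq hc.norm continuous_norm) fun k => ?_
    rw [hι, ← hn]
    rfl

end RankOne

end FellBundle

/-! ### Conjugation of compact operators by a unitary -/

namespace PreHilbertModule

section Conjugation

variable {A E F : Type*} [NonUnitalCStarAlgebra A] [NormedAddCommGroup E] [NormedSpace ℂ E]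
  [PreHilbertModule A E] [NormedAddCommGroup F] [NormedSpace ℂ F] [PreHilbertModule A F]

/-- The map `T ↦ U T U*` of adjointable operators, for a unitary `U : E → F`. -/
def conjAdjointable (U : E ≃ₗᵢ[ℂ] F) (hU : ∀ x y, innerL A (U x) (U y) = innerL A x y) :
    Adjointable A E →⋆ₙₐ[ℂ] Adjointable A F where
  toFun T := ⟨U.toContinuousLinearEquiv.toContinuousLinearMap.comp
      (T.op.comp U.symm.toContinuousLinearEquiv.toContinuousLinearMap),
    U.toContinuousLinearEquiv.toContinuousLinearMap.comp
      ((star T).op.comp U.symm.toContinuousLinearEquiv.toContinuousLinearMap), fun x y => by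
    obtain ⟨x, rfl⟩ := U.surjective x
    obtain ⟨y, rfl⟩ := U.surjective y
    change innerL A (U (T.op (U.symm (U x)))) (U y) =
      innerL A (U x) (U ((star T).op (U.symm (U y))))
    rw [hU, hU, U.symm_apply_apply, U.symm_apply_apply, inner_star]⟩
  map_smul' c T := Adjointable.ext_op fun x => map_smul U c _
  map_zero' := Adjointable.ext_op fun x => map_zero U
  map_add' T S := Adjointable.ext_op fun x => map_add U _ _
  map_mul' T S := Adjointable.ext_op fun x => by
    change U (T.op (S.op (U.symm x))) = U (T.op (U.symm (U (S.op (U.symm x)))))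
    rw [U.symm_apply_apply]
  map_star' T := (star_eq_of_inner fun x y => by
    obtain ⟨x, rfl⟩ := U.surjective x
    obtain ⟨y, rfl⟩ := U.surjective y
    change innerL A (U (T.op (U.symm (U x)))) (U y) =
      innerL A (U x) (U ((star T).op (U.symm (U y))))
    rw [hU, hU, U.symm_apply_apply, U.symm_apply_apply, inner_star]).symm

lemma conjAdjointable_op (U : E ≃ₗᵢ[ℂ] F) (hU : ∀ x y, innerL A (U x) (U y) = innerL A x y)
    (T : Adjointable A E) (x : F) : (conjAdjointable U hU T).op x = U (T.op (U.symm x)) := rfl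

/-- Preservation of inner products and surjectivity force `A`-linearity: the two sides have the same
inner product with every `U z`, and the inner product of a normed module is nondegenerate. -/
lemma map_rsmulL_of_inner (U : E ≃ₗᵢ[ℂ] F) (hU : ∀ x y, innerL A (U x) (U y) = innerL A x y)
    (x : E) (a : A) : U (rsmulL A x a) = rsmulL A (U x) a :=
  ext_inner (A := A) fun z => by
    obtain ⟨z, rfl⟩ := U.surjective z
    rw [hU, innerL_rsmulL, innerL_rsmulL, hU]

lemma conjAdjointable_theta (U : E ≃ₗᵢ[ℂ] F) (hU : ∀ x y, innerL A (U x) (U y) = innerL A x y)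
    (x y : E) : conjAdjointable U hU (theta x y) = theta (U x) (U y) :=
  Adjointable.ext_op fun z => by
    obtain ⟨z, rfl⟩ := U.surjective z
    rw [conjAdjointable_op, theta_op, theta_op, U.symm_apply_apply, map_rsmulL_of_inner U hU, hU]

lemma inner_symm_of_inner (U : E ≃ₗᵢ[ℂ] F) (hU : ∀ x y, innerL A (U x) (U y) = innerL A x y)
    (x y : F) : innerL A (U.symm x) (U.symm y) = innerL A x y := by
  rw [← hU, U.apply_symm_apply, U.apply_symm_apply]

variable [CompleteSpace E] [CompleteSpace F]

lemma conjAdjointable_mem_compacts (U : E ≃ₗᵢ[ℂ] F)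
    (hU : ∀ x y, innerL A (U x) (U y) = innerL A x y) {T : Adjointable A E}
    (hT : T ∈ compacts A E) : conjAdjointable U hU T ∈ compacts A F := by
  have hc : Continuous (conjAdjointable U hU) :=
    AddMonoidHomClass.continuous_of_bound _ 1 fun x => by
      rw [one_mul]; exact NonUnitalStarAlgHom.norm_apply_le (conjAdjointable U hU) x
  refine map_mem_closure (t := (finiteRank A F : Set (Adjointable A F))) hc hT fun S hS => ?_
  change S ∈ Submodule.span ℂ _ at hS
  change conjAdjointable U hU S ∈ Submodule.span ℂ _
  induction hS using Submodule.span_induction with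
  | mem S hS =>
    obtain ⟨p, rfl⟩ := hS
    rw [conjAdjointable_theta]
    exact Submodule.subset_span ⟨(U p.1, U p.2), rfl⟩
  | zero => rw [map_zero]; exact Submodule.zero_mem _
  | add x y _ _ hx hy => rw [map_add]; exact Submodule.add_mem _ hx hy
  | smul c x _ hx => rw [map_smul]; exact Submodule.smul_mem _ _ hx

/-- The isomorphism `T ↦ U T U*` of compact operators, for a unitary `U : E → F`. -/
def conjCompact (U : E ≃ₗᵢ[ℂ] F) (hU : ∀ x y, innerL A (U x) (U y) = innerL A x y) :
    CompactOp A E ≃⋆ₐ[ℂ] CompactOp A F where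
  toFun T := ⟨conjAdjointable U hU T.1, conjAdjointable_mem_compacts U hU T.2⟩
  invFun T := ⟨conjAdjointable U.symm (inner_symm_of_inner U hU) T.1,
    conjAdjointable_mem_compacts U.symm (inner_symm_of_inner U hU) T.2⟩
  left_inv T := Subtype.ext (Adjointable.ext_op fun x => by
    simp only [conjAdjointable_op, LinearIsometryEquiv.symm_symm, U.symm_apply_apply])
  right_inv T := Subtype.ext (Adjointable.ext_op fun x => by
    simp only [conjAdjointable_op, LinearIsometryEquiv.symm_symm, U.apply_symm_apply])
  map_mul' T S := Subtype.ext (map_mul (conjAdjointable U hU) T.1 S.1)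
  map_add' T S := Subtype.ext (map_add (conjAdjointable U hU) T.1 S.1)
  map_star' T := Subtype.ext (map_star (conjAdjointable U hU) T.1)
  map_smul' c T := Subtype.ext (map_smul (conjAdjointable U hU) c T.1)

lemma conjCompact_op (U : E ≃ₗᵢ[ℂ] F) (hU : ∀ x y, innerL A (U x) (U y) = innerL A x y)
    (T : CompactOp A E) (x : E) : (conjCompact U hU T).op (U x) = U (T.op x) :=
  (conjAdjointable_op U hU T.1 (U x)).trans (by rw [U.symm_apply_apply]; rfl)

lemma conjCompact_thetaK (U : E ≃ₗᵢ[ℂ] F) (hU : ∀ x y, innerL A (U x) (U y) = innerL A x y)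
    (x y : E) : conjCompact U hU (thetaK A x y) = thetaK A (U x) (U y) :=
  Subtype.ext (conjAdjointable_theta U hU x y)

end Conjugation

end PreHilbertModule

namespace FellBundle

open PreHilbertModule

/-! ### The unitaries `ρ_t` -/

section Rho

variable {G : Type u} [Group G] [TopologicalSpace G] [IsTopologicalGroup G]
  [LocallyCompactSpace G] [MeasurableSpace G] [T2Space G] [BorelSpace G]
  {𝒜 : FellBundle.{u, v} G} {μ : Measure G}

lemma CcT.rho_app [IsFiniteMeasureOnCompacts μ] (t : G) (ξ : CcT 𝒜 μ 1) (r : G) :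
    (ξ.rho t).app r = (√(modular t) : ℂ) • Fiber.cast (mul_one (r * t)) (ξ.app (r * t)) := rfl

lemma sqrt_modular_ne_zero (t : G) : (√(modular t) : ℂ) ≠ 0 := by
  exact_mod_cast (Real.sqrt_pos.2 (modular_pos t)).ne'

lemma CcT.rho_surjective [IsFiniteMeasureOnCompacts μ] (t : G) :
    Function.Surjective (CcT.rho (𝒜 := 𝒜) (μ := μ) t) := by
  intro η
  -- The preimage inverts the formula of `ρ_t`, namely `r ↦ Δ(t)^(-1/2) η(r t⁻¹)`.
  refine ⟨.mk' (fun r => (√(modular t) : ℂ)⁻¹ •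
    Fiber.cast (by group : r * t⁻¹ * t = r * 1) (η.app (r * t⁻¹))) ?_ ?_, ?_⟩
  · have h : Continuous fun r => (η.app (r * t⁻¹)).val :=
      η.continuous_app.comp (continuous_mul_const t⁻¹)
    refine continuous_iff_continuousAt.2 fun r => ?_
    exact tendsto_smul (φ := fun r => r * 1)
      (f := fun r => Fiber.cast (by group) (η.app (r * t⁻¹)))
      (a := Fiber.cast (by group : r * t⁻¹ * t = r * 1) (η.app (r * t⁻¹))) _ (h.tendsto r)
  · obtain ⟨K, hK, h0⟩ := η.exists_compact
    refine ⟨(fun r => r * t) '' K, hK.image (continuous_mul_const _), fun r h => ?_⟩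
    rw [h0, map_zero, smul_zero]
    exact fun h' => h ⟨_, h', by group⟩
  · ext1 r
    rw [CcT.rho_app, CcT.mk'_app, map_smul, smul_smul, mul_inv_cancel₀ (sqrt_modular_ne_zero t),
      one_smul]
    -- The equality `r t t⁻¹ = r` is not definitional. With a free variable `s` for the left side,
    -- the transport between fibres disappears by substitution.
    have key : ∀ s (h : s = r) (h' : s * t = r * t),
        Fiber.cast h' (η.app s) = η.app r := by rintro s rfl h'; rfl
    exact key (r * t * t⁻¹) (by group) (by group)

variable [μ.IsHaarMeasure]

/-- The two factors `Δ(t)^(1/2)` give `Δ(t)`, which cancels the factor `Δ(t)⁻¹` produced by right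
translation in the left Haar integral. -/
lemma CcT.inner_rho (t : G) (ξ η : CcT 𝒜 μ 1) :
    CcT.inner (ξ.rho t) (η.rho t) = CcT.inner ξ η := by
  have hΔ := modular_pos t
  obtain ⟨K, hK, h0⟩ := ξ.exists_compact
  have h1 := integral_mul_right_modular μ
    (f := fun r => mulL (inv_mul_cancel (r * 1)) (starL rfl (ξ.app r)) (η.app r))
    (continuous_val_iff.1 (𝒜.continuous_mul_tot.comp
      (Continuous.prodMk (𝒜.continuous_star_tot.comp ξ.continuous_app) η.continuous_app)))
    (HasCompactSupport.intro hK fun u hu => by simp [h0 u hu]) t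
  have h2 : CcT.inner (ξ.rho t) (η.rho t) = ∫ r, (modular t : ℂ) •
      mulL (inv_mul_cancel (r * t * 1)) (starL rfl (ξ.app (r * t))) (η.app (r * t)) ∂μ := by
    refine integral_congr_ae (ae_of_all _ fun r => ?_)
    simp only [CcT.rho_app, map_smul, map_smulₛₗ, smul_apply, smul_smul, Complex.conj_ofReal]
    have e : (√(modular t) : ℂ) * √(modular t) = modular t := by
      exact_mod_cast Real.mul_self_sqrt hΔ.le
    rw [e]
    rfl
  rw [h2, integral_smul, h1, ← Complex.coe_smul, smul_smul]
  have : (modular t : ℂ) ≠ 0 := by exact_mod_cast hΔ.ne'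
  push_cast
  rw [mul_inv_cancel₀ this, one_smul]
  rfl

/-- The map `ρ_t` as an isometry of `C_c(𝒜)` onto `C_c^t(𝒜)`. -/
def CcT.rhoₗᵢ (t : G) : CcT 𝒜 μ 1 →ₗᵢ[ℂ] CcT 𝒜 μ t where
  toFun := CcT.rho t
  map_add' ξ η := by
    ext1 r
    simp only [CcT.rho_app, CcT.add_app, map_add, smul_add]
  map_smul' c ξ := by
    ext1 r
    simp only [CcT.rho_app, CcT.smul_app, map_smul, RingHom.id_apply]
    exact smul_comm _ _ _
  norm_map' ξ := by
    change ‖ξ.rho t‖ = ‖ξ‖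
    rw [CcT.norm_def, CcT.norm_def, CcT.inner_rho]

variable (𝒜 μ) in
/-- The extension of `ρ_t` to an isometry `L²(𝒜) → L²_t(𝒜)`. -/
def L2.rhoₗᵢ (t : G) : L2 𝒜 μ 1 →ₗᵢ[ℂ] L2 𝒜 μ t where
  toLinearMap := (CcT.rhoₗᵢ (𝒜 := 𝒜) (μ := μ) t).toContinuousLinearMap.completion.toLinearMap
  norm_map' x := by
    change ‖(CcT.rhoₗᵢ (𝒜 := 𝒜) (μ := μ) t).toContinuousLinearMap.completion x‖ = ‖x‖
    induction x using UniformSpace.Completion.induction_on with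
    | hp => exact isClosed_eq (by fun_prop) (by fun_prop)
    | ih x =>
      rw [ContinuousLinearMap.completion_apply_coe, UniformSpace.Completion.norm_coe,
        UniformSpace.Completion.norm_coe]
      exact (CcT.rhoₗᵢ t).norm_map x

lemma L2.rhoₗᵢ_coe (t : G) (ξ : CcT 𝒜 μ 1) :
    L2.rhoₗᵢ 𝒜 μ t (ξ : L2 𝒜 μ 1) = (ξ.rho t : CcT 𝒜 μ t) :=
  ContinuousLinearMap.completion_apply_coe (CcT.rhoₗᵢ (𝒜 := 𝒜) (μ := μ) t).toContinuousLinearMap ξ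

/-- The range contains the dense subspace `C_c^t(𝒜)`, and it is closed as the isometric image of a
complete space. -/
lemma L2.rhoₗᵢ_surjective (t : G) : Function.Surjective (L2.rhoₗᵢ 𝒜 μ t) := by
  have hd : DenseRange (L2.rhoₗᵢ 𝒜 μ t) := by
    refine UniformSpace.Completion.denseRange_coe.mono ?_
    rintro _ ⟨η, rfl⟩
    obtain ⟨ξ, rfl⟩ := CcT.rho_surjective t η
    exact ⟨ξ, L2.rhoₗᵢ_coe t ξ⟩
  rw [← Set.range_eq_univ, ← (L2.rhoₗᵢ 𝒜 μ t).isometry.isClosedEmbedding.isClosed_range.closure_eq]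
  exact hd.closure_range

variable (𝒜 μ) in
/-- The unitary `ρ_t : L²(𝒜) → L²_t(𝒜)`. -/
def L2.rho (t : G) : L2 𝒜 μ 1 ≃ₗᵢ[ℂ] L2 𝒜 μ t :=
  LinearIsometryEquiv.ofSurjective (L2.rhoₗᵢ 𝒜 μ t) (L2.rhoₗᵢ_surjective t)

lemma L2.rho_coe (t : G) (ξ : CcT 𝒜 μ 1) :
    L2.rho 𝒜 μ t (ξ : L2 𝒜 μ 1) = (ξ.rho t : CcT 𝒜 μ t) :=
  L2.rhoₗᵢ_coe t ξ

lemma L2.inner_rho (t : G) (x y : L2 𝒜 μ 1) :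
    innerL (𝒜.Fiber 1) (L2.rho 𝒜 μ t x) (L2.rho 𝒜 μ t y) = innerL (𝒜.Fiber 1) x y := by
  have hc : Continuous (L2.rho 𝒜 μ t) := (L2.rho 𝒜 μ t).continuous
  induction x, y using UniformSpace.Completion.induction_on₂ with
  | hp => exact isClosed_eq (by fun_prop) (by fun_prop)
  | ih x y => rw [L2.rho_coe, L2.rho_coe, L2.innerL_coe, L2.innerL_coe, CcT.inner_rho]

/-- The link between `β_t` and `ρ_t`: the factor `Δ(t)` of `β_t` is shared equally between the two
vectors. -/
lemma translate_kernel (t : G) (ξ η : CcT 𝒜 μ 1) :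
    (ξ.kernel η).translate t = (ξ.rho t).kernel (η.rho t) := by
  ext1 r s
  rw [Kernel.translate_app, CcT.kernel_app, CcT.kernel_app, CcT.rho_app, CcT.rho_app]
  simp only [map_smul, map_smulₛₗ, smul_apply, smul_smul, Complex.conj_ofReal]
  have e : (√(modular t) : ℂ) * √(modular t) = modular t := by
    exact_mod_cast Real.mul_self_sqrt (modular_pos t).le
  rw [e]
  rfl

end Rho

end FellBundle

end

/-! ### Proof of the three statements. -/

open FellBundle PreHilbertModule in
theorem proposition2p5 {G : Type u} [Group G] [TopologicalSpace G] [IsTopologicalGroup G]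
    [LocallyCompactSpace G] [T2Space G] [MeasurableSpace G] [BorelSpace G]
    (μ : Measure G) [μ.IsHaarMeasure] (𝒜 : FellBundle.{u, v} G) :
    ∃ ι : ∀ t : G, compactIdeal 𝒜 μ t →⋆ₙₐ[ℂ] KernelAlgebra 𝒜 μ,
      (∀ t : G,
        (∀ ξ η : CcT 𝒜 μ t,
          ι t (thetaK (𝒜.Fiber 1) (ξ : L2 𝒜 μ t) (η : L2 𝒜 μ t)) = (ξ.kernel η).toAlgebra) ∧
        (∀ T : compactIdeal 𝒜 μ t, ‖ι t T‖ = ‖T‖) ∧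
        (∀ ι' : compactIdeal 𝒜 μ t →⋆ₙₐ[ℂ] KernelAlgebra 𝒜 μ,
          (∀ ξ η : CcT 𝒜 μ t,
            ι' (thetaK (𝒜.Fiber 1) (ξ : L2 𝒜 μ t) (η : L2 𝒜 μ t)) = (ξ.kernel η).toAlgebra) →
          ι' = ι t)) ∧
      ∀ t : G,
        NonUnitalStarAlgHom.range (ι t) =
          (NonUnitalStarAlgHom.range (ι 1)).map (action 𝒜 μ t) ∧
        ∃ (ρ : L2 𝒜 μ 1 ≃ₗᵢ[ℂ] L2 𝒜 μ t) (ρl : compactIdeal 𝒜 μ 1 ≃⋆ₐ[ℂ] compactIdeal 𝒜 μ t),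
          (∀ ξ : CcT 𝒜 μ 1, ρ (ξ : L2 𝒜 μ 1) = (ξ.rho t : L2 𝒜 μ t)) ∧
          (∀ x y : L2 𝒜 μ 1, innerL (𝒜.Fiber 1) (ρ x) (ρ y) = innerL (𝒜.Fiber 1) x y) ∧
          (∀ (x : L2 𝒜 μ 1) (a : 𝒜.Fiber 1),
            ρ (rsmulL (𝒜.Fiber 1) x a) = rsmulL (𝒜.Fiber 1) (ρ x) a) ∧
          (∀ (T : compactIdeal 𝒜 μ 1) (x : L2 𝒜 μ 1), (ρl T).op (ρ x) = ρ (T.op x)) ∧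
          ∀ T : compactIdeal 𝒜 μ 1, action 𝒜 μ t (ι 1 T) = ι t (ρl T) := by
  choose ι hθ hn using exists_compactIdeal_embedding 𝒜 μ
  have hd : ∀ t, DenseRange ((↑) : CcT 𝒜 μ t → L2 𝒜 μ t) :=
    fun t => UniformSpace.Completion.denseRange_coe
  refine ⟨ι, fun t => ⟨hθ t, hn t, fun ι' h => ?_⟩, fun t => ?_⟩
  · exact CompactOp.ext_of_thetaK (hd t) fun ξ η => (h ξ η).trans (hθ t ξ η).symm
  set ρl := conjCompact (L2.rho 𝒜 μ t) (L2.inner_rho t)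
  -- Both sides are `*`-homomorphisms of `T`, so it is enough to compare them on `θ_{ξ,η}` with `ξ,
  -- η ∈ C_c^e(𝒜)`, where `translate_kernel` applies.
  have key : ∀ T, action 𝒜 μ t (ι 1 T) = ι t (ρl T) := fun T => by
    have h : (action 𝒜 μ t).comp (ι 1) = (ι t).comp (ρl : _ →⋆ₙₐ[ℂ] compactIdeal 𝒜 μ t) :=
      CompactOp.ext_of_thetaK (hd 1) fun ξ η => by
        change action 𝒜 μ t (ι 1 _) = ι t (ρl _)
        rw [hθ, action_toAlgebra, conjCompact_thetaK, L2.rho_coe, L2.rho_coe, hθ,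
          translate_kernel]
    exact DFunLike.congr_fun h T
  refine ⟨?_, L2.rho 𝒜 μ t, ρl, L2.rho_coe t, L2.inner_rho t,
    map_rsmulL_of_inner (L2.rho 𝒜 μ t) (L2.inner_rho t),
    conjCompact_op (L2.rho 𝒜 μ t) (L2.inner_rho t), key⟩
  -- Both inclusions are read off from `key`; the first uses that `ρl` is surjective.
  refine SetLike.coe_injective (Set.Subset.antisymm ?_ ?_)
  · rintro _ ⟨T, rfl⟩
    exact ⟨ι 1 (ρl.symm T), ⟨ρl.symm T, rfl⟩, by
      refine (key _).trans ?_
      rw [StarAlgEquiv.apply_symm_apply]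
      rfl⟩
  · rintro _ ⟨_, ⟨T, rfl⟩, rfl⟩
    exact ⟨ρl T, (key T).symm⟩
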